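/- **Operators.** Let $\mathsf{Un}=\{\neg,\mathbf X,\mathbf F,\mathbf G\}$, $\mathsf{Bin}_{tp}=\{\mathbf U,\mathbf R,\mathbf W,\mathbf M\}$ (until, release, weak until, mighty release), and let $\mathsf{Bin}_{lg}$ consist of $\lor,\land,\Rightarrow,\Leftarrow,\Leftrightarrow$ and their five negations. On a sequence of positions $0,1,\dots$, with $\varphi$ and $\psi$ evaluated at each position: $\mathbf X\varphi$ means that $\varphi$ holds at position $1$; $\mathbf F\varphi$ that it holds at some position; $\mathbf G\varphi$ that it holds at every position; $\varphi\,\mathbf U\,\psi$ that $\psi$ holds at some position $i$ and $\varphi$ at all positions $j<i$; $\varphi\,\mathbf R\,\psi=\neg(\neg\varphi\,\mathbf U\,\neg\psi)$; $\varphi\,\mathbf W\,\psi=(\varphi\,\mathbf U\,\psi)\lor\mathbf G\varphi$; $\varphi\,\mathbf M\,\psi=(\varphi\,\mathbf R\,\psi)\land\mathbf F\varphi$. Let $\mathsf U^t\subseteq\mathsf{Un}$, $\mathsf B^t\subseteq\mathsf{Bin}_{tp}$, $\mathsf B^l\subseteq\mathsf{Bin}_{lg}$. **Formulas.** Over a non-empty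 finite set $\mathsf{Prop}$ of propositions, the LTL formulas of the fragment $(\mathsf U^t,\mathsf B^t,\mathsf B^l)$ are built from propositions with the operators in $\mathsf U^t\cup\mathsf B^t\cup\mathsf B^l$. For $k\ge 1$, the $\mathrm{ATL}^k$ (state) formulas of the fragment are $\phi ::= p \mid \neg\phi \mid \phi * \phi \mid \langle\!\langle A\rangle\!\rangle(*_1\phi)\mid\langle\!\langle A\rangle\!\rangle(\phi *_2\phi)$ with $p\in\mathsf{Prop}$, negation allowed only if $\neg\in\mathsf U^t$, $*\in\mathsf B^l$, $*_1\in\mathsf U^t\setminus\{\neg\}$, $*_2\in\mathsf B^t$ and $A\subseteq\{1,\dots,k\}$. CTL formulas are $\mathrm{ATL}^1$ formulas, $\langle\!\langle\emptyset\rangle\!\rangle$ being read as $\forall$ and $\langle\!\langle\{1\}\rangle\!\rangle$ as $\exists$. The size $|\varphi|$ is the number of distinct sub-formulas of $\varphi$ (for ATL and CTL: state sub-formulas), and $|\varphi|_{\mathsf{Bin}}$ is the number of those whose outermost logical or temporal operator (below the quantifier $\langle\!\langle A\rangle\!\rangle$, if there is one) is binary. **Models.** - LTL: ultimately periodic words $u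 v^\omega$, given by finite words $u,v$ over $2^{\mathsf{Prop}}$ with $v$ non-empty, of size $|u|+|v|$, with the usual LTL semantics. - $\mathrm{ATL}^k$: concurrent game structures with finite state set $Q$, initial states $I\subseteq Q$, labels $\pi:Q\to2^{\mathsf{Prop}}$, agents $1,\dots,k$, $d(q,a)\ge1$ actions for agent $a$ at state $q$, and a transition function $\delta$ that maps a state and one available action per agent to a state. The size is the number of pairs of a state and a joint action available there, plus $|\mathsf{Prop}|$. The formula $\langle\!\langle A\rangle\!\rangle\psi$ holds at $q$ iff the agents of $A$ have strategies, depending on the history of visited states, such that all compatible infinite paths from $q$ satisfy $\psi$. A structure satisfies $\phi$ iff $\phi$ holds at all its initial states. - CTL: Kripke structures, with finite $Q$, $I$, $\pi$ as above and a non-empty set $\mathrm{Succ}(q)\subseteq Q$ for every state $q$. The size is $\sum_{q}|\mathrm{Succ}(q)|+|\mathsf{Prop}|$; $\forall\psi$ and $\exists\psi$ quantify over the infinite paths from a state, and satisfaction again means at all initial states. **Learning problem.** For $L\in\{\mathrm{LTL},\mathrm{CTL},\mathrm{ATL}^k\mid k\ge1\}$ and $n\in\mathbb N\cup\{\infty\}$,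 the problem $L_{\mathsf{Learn}}(\mathsf U^t,\mathsf B^t,\mathsf B^l,n)$ is: given a non-empty finite set $\mathsf{Prop}$, finite collections $\mathcal P,\mathcal N$ of models for $L$ over $\mathsf{Prop}$, and $B\in\mathbb N$, decide whether there is an $L$-formula $\varphi$ over $\mathsf{Prop}$ in the fragment $(\mathsf U^t,\mathsf B^t,\mathsf B^l)$ with $|\varphi|\le B$ and $|\varphi|_{\mathsf{Bin}}\le n$ that is satisfied by every model in $\mathcal P$ and by no model in $\mathcal N$. The size of the input is $|\mathsf{Prop}|+\sum_{X\in\mathcal P}|X|+\sum_{X\in\mathcal N}|X|+B$ (so $B$ counts as written in unary). **Proposition.** For all $\mathsf U^t\subseteq\mathsf{Un}$, $\mathsf B^t\subseteq\mathsf{Bin}_{tp}$, $\mathsf B^l\subseteq\mathsf{Bin}_{lg}$ and $n\in\mathbb N\cup\{\infty\}$, the decision problems $\mathrm{LTL}_{\mathsf{Learn}}(\mathsf U^t,\mathsf B^t,\mathsf B^l,n)$, $\mathrm{CTL}_{\mathsf{Learn}}(\mathsf U^t,\mathsf B^t,\mathsf B^l,n)$ and, for every $k\ge1$, $\mathrm{ATL}^k_{\mathsf{Learn}}(\mathsf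 U^t,\mathsf B^t,\mathsf B^l,n)$ are in $\mathsf{NP}$. That is, the inputs have a string encoding of length polynomial in their size, for which a verifier running in polynomial time on a Turing machine accepts an input together with some certificate of polynomial length if and only if the input is positive. -/

import Mathlib

open Computability

namespace TemporalLearning

/-! ### Decision problems and the class NP -/

/-- A decision problem: its inputs, the size of an input, a string encoding of the inputs over a
fixed finite alphabet, and the set of positive inputs. -/
structure DecisionProblem where
  Input : Type
  size : Input → ℕ
  encode : Input → List Γ'
  yes : Set Input

/-- A pair of an input and a certificate, written as one string over the disjoint union of the two
alphabets. -/
def DecisionProblem.encodePair (D : DecisionProblem) {Δ : Type} (x : D.Input × List Δ) :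
    List (Γ' ⊕ Δ) :=
  (D.encode x.1).map Sum.inl ++ x.2.map Sum.inr

/-- Membership in NP: the encoding of the inputs has length polynomial in their size, and there is a
verifier, computed by a polynomial-time Turing machine, such that an input is positive if and only
if the verifier accepts it together with some certificate of polynomial length. -/
def DecisionProblem.InNP (D : DecisionProblem) : Prop :=
  (∃ q : Polynomial ℕ, ∀ x, (D.encode x).length ≤ q.eval (D.size x)) ∧
  ∃ (Δ : Type) (_ : Fintype Δ) (p : Polynomial ℕ) (V : D.Input × List Δ → Bool),
    Nonempty (Turing.TM2ComputableInPolyTime D.encodePair encodeBool V) ∧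
    ∀ x, x ∈ D.yes ↔ ∃ c : List Δ, c.length ≤ p.eval (D.encode x).length ∧ V (x, c) = true

/-! ### Operators -/

/-- Unary temporal operators: next, future, globally. -/
inductive UnTp
  | X | F | G
  deriving DecidableEq

/-- Unary operators: negation and the unary temporal operators. -/
inductive UnOp
  | neg
  | tp (o : UnTp)
  deriving DecidableEq

/-- Binary temporal operators: until, release, weak until, mighty release. -/
inductive BinTp
  | U | R | W | M
  deriving DecidableEq

/-- Binary logical operators and their negations; `impl` is `⇒` and `conv` is `⇐`. -/
inductive BinLg
  | or | and | impl | conv | iff | nor | nand | nimpl | nconv | niff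
  deriving DecidableEq

/-- The truth value of a unary temporal operator at the start of a sequence, where `f i` says that
the operand holds at position `i` (positions start at `0`). -/
def UnTp.eval : UnTp → (ℕ → Prop) → Prop
  | .X, f => f 1
  | .F, f => ∃ i, f i
  | .G, f => ∀ i, f i

/-- The truth value of a unary operator at the start of a sequence. -/
def UnOp.eval : UnOp → (ℕ → Prop) → Prop
  | .neg, f => ¬ f 0
  | .tp o, f => o.eval f

/-- `f` until `g`. -/
def untilSem (f g : ℕ → Prop) : Prop := ∃ i, g i ∧ ∀ j < i, f j

/-- `f` releases `g`, the dual of until. -/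
def releaseSem (f g : ℕ → Prop) : Prop := ¬ untilSem (fun i => ¬ f i) (fun i => ¬ g i)

/-- The truth value of a binary temporal operator at the start of a sequence. -/
def BinTp.eval : BinTp → (ℕ → Prop) → (ℕ → Prop) → Prop
  | .U, f, g => untilSem f g
  | .R, f, g => releaseSem f g
  | .W, f, g => untilSem f g ∨ ∀ i, f i
  | .M, f, g => releaseSem f g ∧ ∃ i, f i

/-- The truth table of a binary logical operator. -/
def BinLg.eval : BinLg → Prop → Prop → Prop
  | .or, a, b => a ∨ b
  | .and, a, b => a ∧ b
  | .impl, a, b => a → b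
  | .conv, a, b => b → a
  | .iff, a, b => a ↔ b
  | .nor, a, b => ¬ (a ∨ b)
  | .nand, a, b => ¬ (a ∧ b)
  | .nimpl, a, b => ¬ (a → b)
  | .nconv, a, b => ¬ (b → a)
  | .niff, a, b => ¬ (a ↔ b)

/-! ### LTL -/

/-- LTL formulas over the propositions `P`. -/
inductive LTL (P : Type)
  | prop (p : P)
  | un (o : UnOp) (φ : LTL P)
  | tp (o : BinTp) (φ ψ : LTL P)
  | lg (o : BinLg) (φ ψ : LTL P)
  deriving DecidableEq

namespace LTL

variable {P : Type}

/-- The formula only uses the given operators. -/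
def InFragment (Ut : Set UnOp) (Bt : Set BinTp) (Bl : Set BinLg) : LTL P → Prop
  | prop _ => True
  | un o φ => o ∈ Ut ∧ φ.InFragment Ut Bt Bl
  | tp o φ ψ => o ∈ Bt ∧ φ.InFragment Ut Bt Bl ∧ ψ.InFragment Ut Bt Bl
  | lg o φ ψ => o ∈ Bl ∧ φ.InFragment Ut Bt Bl ∧ ψ.InFragment Ut Bt Bl

/-- The set of sub-formulas. -/
def subF [DecidableEq P] : LTL P → Finset (LTL P)
  | prop p => {prop p}
  | un o φ => insert (un o φ) φ.subF
  | tp o φ ψ => insert (tp o φ ψ) (φ.subF ∪ ψ.subF)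
  | lg o φ ψ => insert (lg o φ ψ) (φ.subF ∪ ψ.subF)

/-- The outermost operator is binary. -/
def isBin : LTL P → Bool
  | prop _ => false
  | un _ _ => false
  | tp _ _ _ => true
  | lg _ _ _ => true

/-- The size of a formula is its number of distinct sub-formulas. -/
def size [DecidableEq P] (φ : LTL P) : ℕ := φ.subF.card

/-- The number of distinct sub-formulas whose outermost operator is binary. -/
def numBin [DecidableEq P] (φ : LTL P) : ℕ := (φ.subF.filter fun ψ => ψ.isBin).card

/-- `φ.Sat w`: the infinite word `w` satisfies `φ`. -/
def Sat : LTL P → (ℕ → Finset P) → Prop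
  | prop p, w => p ∈ w 0
  | un o φ, w => o.eval fun i => φ.Sat fun j => w (i + j)
  | tp o φ ψ, w => o.eval (fun i => φ.Sat fun j => w (i + j)) (fun i => ψ.Sat fun j => w (i + j))
  | lg o φ ψ, w => o.eval (φ.Sat w) (ψ.Sat w)

end LTL

/-- A (finite representation of an) ultimately periodic word `u · v^ω` with `v` non-empty. -/
structure UPWord (P : Type) where
  u : List (Finset P)
  v : List (Finset P)
  v_ne : v ≠ []

namespace UPWord

variable {P : Type}

/-- The infinite word `u · v^ω`. -/
def word (w : UPWord P) (i : ℕ) : Finset P :=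
  if h : i < w.u.length then w.u[i]
  else w.v[(i - w.u.length) % w.v.length]'(Nat.mod_lt _ (List.length_pos_of_ne_nil w.v_ne))

/-- The size `|u| + |v|`. -/
def size (w : UPWord P) : ℕ := w.u.length + w.v.length

end UPWord

/-! ### ATL and CTL -/

/-- State formulas of `ATL^k` over the propositions `P`, for the agents `Fin k`; the constructors
`un` and `tp` are a strategic quantifier applied to a path formula. -/
inductive ATL (k : ℕ) (P : Type)
  | prop (p : P)
  | neg (φ : ATL k P)
  | lg (o : BinLg) (φ ψ : ATL k P)
  | un (A : Finset (Fin k)) (o : UnTp) (φ : ATL k P)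
  | tp (A : Finset (Fin k)) (o : BinTp) (φ ψ : ATL k P)
  deriving DecidableEq

namespace ATL

variable {k : ℕ} {P : Type}

/-- The formula only uses the given operators. -/
def InFragment (Ut : Set UnOp) (Bt : Set BinTp) (Bl : Set BinLg) : ATL k P → Prop
  | prop _ => True
  | neg φ => UnOp.neg ∈ Ut ∧ φ.InFragment Ut Bt Bl
  | lg o φ ψ => o ∈ Bl ∧ φ.InFragment Ut Bt Bl ∧ ψ.InFragment Ut Bt Bl
  | un _ o φ => UnOp.tp o ∈ Ut ∧ φ.InFragment Ut Bt Bl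
  | tp _ o φ ψ => o ∈ Bt ∧ φ.InFragment Ut Bt Bl ∧ ψ.InFragment Ut Bt Bl

/-- The set of (state) sub-formulas. -/
def subF [DecidableEq P] : ATL k P → Finset (ATL k P)
  | prop p => {prop p}
  | neg φ => insert (neg φ) φ.subF
  | lg o φ ψ => insert (lg o φ ψ) (φ.subF ∪ ψ.subF)
  | un A o φ => insert (un A o φ) φ.subF
  | tp A o φ ψ => insert (tp A o φ ψ) (φ.subF ∪ ψ.subF)

/-- The outermost logical or temporal operator is binary. -/
def isBin : ATL k P → Bool
  | prop _ => false
  | neg _ => false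
  | lg _ _ _ => true
  | un _ _ _ => false
  | tp _ _ _ _ => true

/-- The size of a formula is its number of distinct sub-formulas. -/
def size [DecidableEq P] (φ : ATL k P) : ℕ := φ.subF.card

/-- The number of distinct sub-formulas whose outermost operator is binary. -/
def numBin [DecidableEq P] (φ : ATL k P) : ℕ := (φ.subF.filter fun ψ => ψ.isBin).card

/-- Satisfaction at a state, given the labels of the states and the meaning of the strategic
quantifiers: `quant A q Π` says that `⟨⟨A⟩⟩` holds at `q` for the set `Π` of paths. -/
def SatAt {Q : Type} (label : Q → Finset P)
    (quant : Finset (Fin k) → Q → Set (ℕ → Q) → Prop) : ATL k P → Q → Prop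
  | prop p, q => p ∈ label q
  | neg φ, q => ¬ φ.SatAt label quant q
  | lg o φ ψ, q => o.eval (φ.SatAt label quant q) (ψ.SatAt label quant q)
  | un A o φ, q => quant A q {ρ | o.eval fun i => φ.SatAt label quant (ρ i)}
  | tp A o φ ψ, q => quant A q
      {ρ | o.eval (fun i => φ.SatAt label quant (ρ i)) (fun i => ψ.SatAt label quant (ρ i))}

end ATL

/-- CTL formulas are `ATL^1` formulas: `⟨⟨∅⟩⟩` is `∀` and `⟨⟨{1}⟩⟩` is `∃`. -/
abbrev CTL (P : Type) := ATL 1 P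

/-- A concurrent game structure with agents `Fin k` and states `Fin numStates`. -/
structure CGS (k : ℕ) (P : Type) where
  numStates : ℕ
  init : Finset (Fin numStates)
  label : Fin numStates → Finset P
  /-- the number of actions available to an agent at a state -/
  d : Fin numStates → Fin k → ℕ
  d_pos : ∀ q a, 0 < d q a
  /-- the transition function -/
  δ : (q : Fin numStates) → ((a : Fin k) → Fin (d q a)) → Fin numStates

namespace CGS

variable {k : ℕ} {P : Type} (C : CGS k P)

/-- The states. -/
abbrev Q : Type := Fin C.numStates

/-- The successors of `q` compatible with the actions `α` of the coalition `A`. -/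
def succ (A : Finset (Fin k)) (q : C.Q) (α : (a : Fin k) → a ∈ A → Fin (C.d q a)) : Set C.Q :=
  {q' | ∃ β : (a : Fin k) → Fin (C.d q a), (∀ a (ha : a ∈ A), β a = α a ha) ∧ C.δ q β = q'}

/-- A strategy of agent `a`: an available action for every non-empty history, which is given as the
list of its earlier states together with its last state. -/
abbrev Strategy (a : Fin k) : Type := List C.Q → (q : C.Q) → Fin (C.d q a)

/-- The infinite paths from `q` that are compatible with the strategy profile `s`. -/
def out (A : Finset (Fin k)) (s : (a : Fin k) → a ∈ A → C.Strategy a) (q : C.Q) : Set (ℕ → C.Q) :=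
  {ρ | ρ 0 = q ∧
    ∀ i, ρ (i + 1) ∈ C.succ A (ρ i) fun a ha => s a ha ((List.range i).map ρ) (ρ i)}

/-- The coalition `A` has a strategy profile from `q` all of whose outcomes lie in `S`. -/
def Enforces (A : Finset (Fin k)) (q : C.Q) (S : Set (ℕ → C.Q)) : Prop :=
  ∃ s : (a : Fin k) → a ∈ A → C.Strategy a, ∀ ρ ∈ C.out A s q, ρ ∈ S

/-- The formula holds at all initial states. -/
def Sat (φ : ATL k P) : Prop := ∀ q ∈ C.init, φ.SatAt C.label C.Enforces q

/-- The number of pairs of a state and a joint action there, plus the number of propositions. -/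
def size [Fintype P] : ℕ := (∑ q, ∏ a, C.d q a) + Fintype.card P

end CGS

/-- A Kripke structure with states `Fin numStates`. -/
structure Kripke (P : Type) where
  numStates : ℕ
  init : Finset (Fin numStates)
  label : Fin numStates → Finset P
  succ : Fin numStates → Finset (Fin numStates)
  succ_nonempty : ∀ q, (succ q).Nonempty

namespace Kripke

variable {P : Type} (K : Kripke P)

/-- The states. -/
abbrev Q : Type := Fin K.numStates

/-- The infinite paths from `q`. -/
def out (q : K.Q) : Set (ℕ → K.Q) := {ρ | ρ 0 = q ∧ ∀ i, ρ (i + 1) ∈ K.succ (ρ i)}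

/-- The path quantifiers: the empty coalition is `∀`, the full one is `∃`. -/
def Quant (A : Finset (Fin 1)) (q : K.Q) (S : Set (ℕ → K.Q)) : Prop :=
  (A = ∅ ∧ ∀ ρ ∈ K.out q, ρ ∈ S) ∨ (A = Finset.univ ∧ ∃ ρ ∈ K.out q, ρ ∈ S)

/-- The formula holds at all initial states. -/
def Sat (φ : CTL P) : Prop := ∀ q ∈ K.init, φ.SatAt K.label K.Quant q

/-- The number of transitions, plus the number of propositions. -/
def size [Fintype P] : ℕ := (∑ q, (K.succ q).card) + Fintype.card P

end Kripke

/-! ### Encodings -/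

/-- A natural number in unary. -/
def encNat (n : ℕ) : List Γ' := List.replicate n (Γ'.bit true) ++ [Γ'.comma]

/-- A list, in brackets. -/
def encList {α : Type} (e : α → List Γ') (l : List α) : List Γ' :=
  [Γ'.bra] ++ l.flatMap e ++ [Γ'.ket]

/-- A subset of `Fin m` as a bracketed bit string of length `m`. -/
def encSubset {m : ℕ} (s : Finset (Fin m)) : List Γ' :=
  encList (fun i => [Γ'.bit (decide (i ∈ s))]) (List.finRange m)

def UPWord.encode {m : ℕ} (w : UPWord (Fin m)) : List Γ' :=
  encList encSubset w.u ++ encList encSubset w.v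

def Kripke.encode {m : ℕ} (K : Kripke (Fin m)) : List Γ' :=
  encNat K.numStates ++ encSubset K.init ++
    encList (fun q => encSubset (K.label q)) (List.finRange K.numStates) ++
    encList (fun q => encSubset (K.succ q)) (List.finRange K.numStates)

/-- One line of the transition table: the state, the action of every agent, the next state. -/
def CGS.encodeRow {k m : ℕ} (C : CGS k (Fin m)) (q : C.Q) (α : (a : Fin k) → Fin (C.d q a)) :
    List Γ' :=
  encNat q ++ encList (fun a => encNat (α a)) (List.finRange k) ++ encNat (C.δ q α)

/-- The joint actions at each state are listed in the order given by `finPiFinEquiv`. -/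
def CGS.encode {k m : ℕ} (C : CGS k (Fin m)) : List Γ' :=
  encNat C.numStates ++ encSubset C.init ++
    encList (fun q => encSubset (C.label q)) (List.finRange C.numStates) ++
    encList (fun q => encList (fun a => encNat (C.d q a)) (List.finRange k))
      (List.finRange C.numStates) ++
    encList (fun q => encList (fun j => C.encodeRow q (finPiFinEquiv.symm j))
      (List.finRange (∏ a, C.d q a))) (List.finRange C.numStates)

/-! ### The learning problems -/

/-- An input of a learning problem: a non-empty finite set of propositions `Fin numProp`, finite
collections of positive and of negative models over them, and a bound. -/
structure Sample (Model : ℕ → Type) where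
  numProp : ℕ
  numProp_pos : 0 < numProp
  pos : List (Model numProp)
  neg : List (Model numProp)
  bound : ℕ

namespace Sample

variable {Model : ℕ → Type}

/-- The size of an input, from the sizes of the models. -/
def size (modelSize : {m : ℕ} → Model m → ℕ) (x : Sample Model) : ℕ :=
  x.numProp + (x.pos.map modelSize).sum + (x.neg.map modelSize).sum + x.bound

/-- The encoding of an input, from an encoding of the models; the bound is in unary. -/
def encode (modelEnc : {m : ℕ} → Model m → List Γ') (x : Sample Model) : List Γ' :=
  encNat x.numProp ++ encList modelEnc x.pos ++ encList modelEnc x.neg ++ encNat x.bound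

end Sample

/-- The LTL learning problem. -/
def LTLLearn (Ut : Set UnOp) (Bt : Set BinTp) (Bl : Set BinLg) (n : ℕ∞) : DecisionProblem where
  Input := Sample fun m => UPWord (Fin m)
  size := Sample.size UPWord.size
  encode := Sample.encode UPWord.encode
  yes := {x | ∃ φ : LTL (Fin x.numProp), φ.InFragment Ut Bt Bl ∧
    φ.size ≤ x.bound ∧ (φ.numBin : ℕ∞) ≤ n ∧
    (∀ w ∈ x.pos, φ.Sat w.word) ∧ (∀ w ∈ x.neg, ¬ φ.Sat w.word)}

/-- The CTL learning problem. -/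
def CTLLearn (Ut : Set UnOp) (Bt : Set BinTp) (Bl : Set BinLg) (n : ℕ∞) : DecisionProblem where
  Input := Sample fun m => Kripke (Fin m)
  size := Sample.size fun K => K.size
  encode := Sample.encode Kripke.encode
  yes := {x | ∃ φ : CTL (Fin x.numProp), φ.InFragment Ut Bt Bl ∧
    φ.size ≤ x.bound ∧ (φ.numBin : ℕ∞) ≤ n ∧
    (∀ K ∈ x.pos, K.Sat φ) ∧ (∀ K ∈ x.neg, ¬ K.Sat φ)}

/-- The `ATL^k` learning problem. -/
def ATLLearn (k : ℕ) (Ut : Set UnOp) (Bt : Set BinTp) (Bl : Set BinLg) (n : ℕ∞) :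
    DecisionProblem where
  Input := Sample fun m => CGS k (Fin m)
  size := Sample.size fun C => C.size
  encode := Sample.encode CGS.encode
  yes := {x | ∃ φ : ATL k (Fin x.numProp), φ.InFragment Ut Bt Bl ∧
    φ.size ≤ x.bound ∧ (φ.numBin : ℕ∞) ≤ n ∧
    (∀ C ∈ x.pos, C.Sat φ) ∧ (∀ C ∈ x.neg, ¬ C.Sat φ)}

end TemporalLearning

/-! A formula with at most `B` distinct sub-formulas is a directed acyclic graph with at most `B`
nodes, so it has a short description even when its syntax tree is exponentially large
(`Dag.exists_represents`). It remains to model-check a guessed graph in polynomial time.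

All three logics are reduced to one. An ultimately periodic word is a game structure without agents,
a lasso with a single path from each state, on which LTL formulas are `ATL 0` formulas
(`UPWord.sat_toATL`). A Kripke structure is a game structure with one agent, who picks the successor
(`Kripke.quant_eq`). In a game structure with `N` states an operator is local, or looks one step
ahead, or is a fixed point: release and mighty release are a weak until and an until (`release_iff`,
`mighty_iff`), and enforcing an until or a weak until is the least or the greatest fixed point of a
monotone operator built from the one-step predecessor `CGS.pre` (`enforces_until`, `enforces_weak`).
Such a fixed point is reached after `N` iterations from the empty or the full set
(`mem_iterate_bot`, `mem_iterate_top`).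

The certificate contains the graph together with all these iterates, one truth value for every node,
iteration step, model and state. The verifier evaluates nothing; it checks that the entries satisfy
the local equations from one step to the next. On a valid graph these equations force the last
column of every node to be the semantics of its formula (`Dag.Represents.table_iff`), and the true
iterates solve them (`Dag.Represents.tableOK`). If `L` is the length of the encoded input, all four
indices are below `L`, so `L ^ 4` symbols suffice (`Coding.verify_of_learnable`,
`Coding.learnable_of_verify`).

The verifier is thus a combination of bounded quantifiers over symbols at computable positions. Its
running time is controlled by a class `PT` of functions of a word and of unary numbers, closed under
local definitions and under primitive recursion with polynomially bounded values. By definition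
these functions are computed by structured stack programs in polynomial time, and `Run.steps`
compiles programs to Turing machines step by step. The fragment and the bound `n` are parameters of
the problem and not part of its input, so they are wired into the machine and nothing about their
effectiveness is needed. -/

namespace TemporalLearning

open Function (update)
open Turing (TM2.Stmt TM2.Cfg TM2.step TM2.stepAux)

/-! ### Structured stack programs and their compilation to Turing machines -/

/-- Structured programs acting on a family of stacks indexed by `ℕ`. -/
inductive Prog (A : Type)
  | push (k : ℕ) (a : A)
  | pop (k : ℕ)
  /-- move the top symbol of one stack, if there is one, to another stack -/
  | move (i j : ℕ)
  | seq (p q : Prog A)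
  /-- branch on the top symbol -/
  | ifTop (k : ℕ) (P : Option A → Bool) (p q : Prog A)
  /-- iterate as long as the stack is non-empty -/
  | whileNE (k : ℕ) (p : Prog A)

namespace Prog

variable {A : Type}

/-- The effect of moving the top symbol of stack `i` to stack `j`. -/
def moveTop (i j : ℕ) (s : ℕ → List A) : ℕ → List A :=
  match s i with
  | [] => s
  | a :: l => update (update s i l) j (a :: update s i l j)

/-- `Run p s s' t`: started with the stacks `s`, the program `p` ends with the stacks `s'` after `t`
machine steps. -/
inductive Run : Prog A → (ℕ → List A) → (ℕ → List A) → ℕ → Prop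
  | push (k a s) : Run (push k a) s (update s k (a :: s k)) 1
  | pop (k s) : Run (pop k) s (update s k (s k).tail) 1
  | move (i j s) : Run (move i j) s (moveTop i j s) 1
  | seq {p q s s₁ s₂ t₁ t₂} (h₁ : Run p s s₁ t₁) (h₂ : Run q s₁ s₂ t₂) :
      Run (seq p q) s s₂ (t₁ + t₂)
  | ifTop_true {k P p q s s' t} (h : P (s k).head? = true) (h₁ : Run p s s' t) :
      Run (ifTop k P p q) s s' (1 + t)
  | ifTop_false {k P p q s s' t} (h : P (s k).head? = false) (h₁ : Run q s s' t) :
      Run (ifTop k P p q) s s' (1 + t)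
  | while_nil {k p s} (h : s k = []) : Run (whileNE k p) s s 1
  | while_cons {k p s s₁ s₂ t₁ t₂} (h : s k ≠ []) (h₁ : Run p s s₁ t₁)
      (h₂ : Run (whileNE k p) s₁ s₂ t₂) : Run (whileNE k p) s s₂ (1 + (t₁ + t₂))

/-- A bound on the stacks that a program touches. -/
def maxStack : Prog A → ℕ
  | push k _ => k
  | pop k => k
  | move i j => max i j
  | seq p q => max p.maxStack q.maxStack
  | ifTop k _ p q => max k (max p.maxStack q.maxStack)
  | whileNE k p => max k p.maxStack

/-- The labels of the machine for a program. -/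
def Lab : Prog A → Type
  | push _ _ => Unit
  | pop _ => Unit
  | move _ _ => Unit
  | seq p q => p.Lab ⊕ q.Lab
  | ifTop _ _ p q => Option (p.Lab ⊕ q.Lab)
  | whileNE _ p => Option p.Lab

/-- The finitely many labels. -/
@[reducible]
def labFintype : (p : Prog A) → Fintype p.Lab
  | push _ _ => inferInstanceAs (Fintype Unit)
  | pop _ => inferInstanceAs (Fintype Unit)
  | move _ _ => inferInstanceAs (Fintype Unit)
  | seq p q =>
    let _ := p.labFintype
    let _ := q.labFintype
    inferInstanceAs (Fintype (p.Lab ⊕ q.Lab))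
  | ifTop _ _ p q =>
    let _ := p.labFintype
    let _ := q.labFintype
    inferInstanceAs (Fintype (Option (p.Lab ⊕ q.Lab)))
  | whileNE _ p =>
    let _ := p.labFintype
    inferInstanceAs (Fintype (Option p.Lab))

/-- The entry label. -/
def entry : (p : Prog A) → p.Lab
  | push _ _ => ()
  | pop _ => ()
  | move _ _ => ()
  | seq p _ => Sum.inl p.entry
  | ifTop _ _ _ _ => none
  | whileNE _ _ => none

/-- The stack alphabets of the machine: the stack `none` is for the output. -/
abbrev Alph (A : Type) (m : ℕ) : Option (Fin (m + 1)) → Type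
  | none => Bool
  | some _ => A

variable [Inhabited A] {m : ℕ} {L : Type}

/-- The machine code of a program, with labels embedded by `e` and with exit label `x`. -/
def code (m : ℕ) : (p : Prog A) → (e : p.Lab → L) → (x : L) → p.Lab →
    TM2.Stmt (Alph A m) L (Option A)
  | push k a, _, x, _ => .push (some (Fin.ofNat (m + 1) k)) (fun _ => a) (.goto fun _ => x)
  | pop k, _, x, _ => .pop (some (Fin.ofNat (m + 1) k)) (fun _ _ => none) (.goto fun _ => x)
  | move i j, _, x, _ => .pop (some (Fin.ofNat (m + 1) i)) (fun _ o => o)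
      (.branch Option.isSome
        (.push (some (Fin.ofNat (m + 1) j)) (fun v => v.getD default) (.goto fun _ => x))
        (.goto fun _ => x))
  | seq p q, e, _, Sum.inl l => p.code m (fun l => e (Sum.inl l)) (e (Sum.inr q.entry)) l
  | seq _ q, e, x, Sum.inr l => q.code m (fun l => e (Sum.inr l)) x l
  | ifTop k P p q, e, _, none => .peek (some (Fin.ofNat (m + 1) k)) (fun _ o => o)
      (.branch P (.goto fun _ => e (some (Sum.inl p.entry)))
        (.goto fun _ => e (some (Sum.inr q.entry))))
  | ifTop _ _ p _, e, x, some (Sum.inl l) => p.code m (fun l => e (some (Sum.inl l))) x l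
  | ifTop _ _ _ q, e, x, some (Sum.inr l) => q.code m (fun l => e (some (Sum.inr l))) x l
  | whileNE k p, e, x, none => .peek (some (Fin.ofNat (m + 1) k)) (fun _ o => o)
      (.branch Option.isSome (.goto fun _ => e (some p.entry)) (.goto fun _ => x))
  | whileNE _ p, e, _, some l => p.code m (fun l => e (some l)) (e none) l

/-- The stacks of the machine that correspond to the stacks of the program. -/
def machStk (m : ℕ) (s : ℕ → List A) : (k : Option (Fin (m + 1))) → List (Alph A m k)
  | none => []
  | some i => s i

omit [Inhabited A] in
theorem machStk_some {k : ℕ} (hk : k ≤ m) (s : ℕ → List A) :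
    machStk m s (some (Fin.ofNat (m + 1) k)) = s k := by
  simp only [machStk, Fin.ofNat, Nat.mod_eq_of_lt (Nat.lt_succ_of_le hk)]

omit [Inhabited A] in
theorem update_machStk {k : ℕ} (hk : k ≤ m) (s : ℕ → List A) (l : List A) :
    update (machStk m s) (some (Fin.ofNat (m + 1) k)) l = machStk m (update s k l) := by
  funext i
  rcases i with _ | i
  · simp [machStk]
  · by_cases h : i = Fin.ofNat (m + 1) k
    · subst h
      rw [machStk_some hk, Function.update_self, Function.update_self]
    · rw [Function.update_of_ne (by simpa using h)]
      have : (i : ℕ) ≠ k := by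
        rintro rfl
        exact h (by ext; simp)
      simp [machStk, Function.update_of_ne this]

/-- `t` steps of a machine lead from one configuration to another. -/
def Steps (M : L → TM2.Stmt (Alph A m) L (Option A))
    (c c' : TM2.Cfg (Alph A m) L (Option A)) (t : ℕ) : Prop :=
  (flip bind (TM2.step M))^[t] (some c) = some c'

omit [Inhabited A] in
theorem Steps.trans {M : L → TM2.Stmt (Alph A m) L (Option A)}
    {c₁ c₂ c₃ : TM2.Cfg (Alph A m) L (Option A)} {t₁ t₂ : ℕ}
    (h₁ : Steps M c₁ c₂ t₁) (h₂ : Steps M c₂ c₃ t₂) : Steps M c₁ c₃ (t₁ + t₂) := by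
  unfold Steps at *
  rw [show t₁ + t₂ = t₂ + t₁ from add_comm _ _, Function.iterate_add_apply, h₁, h₂]

omit [Inhabited A] in
theorem Steps.single {M : L → TM2.Stmt (Alph A m) L (Option A)} {l : L} {v : Option A}
    {S : ∀ k, List (Alph A m k)} {c : TM2.Cfg (Alph A m) L (Option A)}
    (h : TM2.stepAux (M l) v S = c) : Steps M ⟨some l, v, S⟩ c 1 := by
  subst h; rfl

/-- The embedding `e` and the exit label `x` are arbitrary, so the induction hypothesis applies to a
sub-program running inside the machine of the whole program. The internal state carries no
information between instructions; hence `v` is arbitrary and `v'` is only claimed to exist. -/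
theorem Run.steps {p : Prog A} {s s' : ℕ → List A} {t : ℕ} (h : Run p s s' t)
    (M : L → TM2.Stmt (Alph A m) L (Option A)) (hm : p.maxStack ≤ m) (e : p.Lab → L) (x : L)
    (hM : ∀ l, M (e l) = p.code m e x l) (v : Option A) :
    ∃ v', Steps M ⟨some (e p.entry), v, machStk m s⟩ ⟨some x, v', machStk m s'⟩ t := by
  induction h generalizing x v with
  | push k a s =>
    refine ⟨v, Steps.single ?_⟩
    rw [hM]
    simp only [code, TM2.stepAux]
    erw [machStk_some hm, update_machStk hm]
    rfl
  | pop k s =>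
    refine ⟨none, Steps.single ?_⟩
    rw [hM]
    simp only [code, TM2.stepAux]
    erw [machStk_some hm, update_machStk hm]
    rfl
  | move i j s =>
    have hi : i ≤ m := (le_max_left _ _).trans hm
    have hj : j ≤ m := (le_max_right _ _).trans hm
    refine ⟨(s i).head?, Steps.single ?_⟩
    rw [hM]
    simp only [code, TM2.stepAux]
    erw [machStk_some hi, update_machStk hi]
    cases hs : s i with
    | nil =>
      have : update s i [] = s := by rw [← hs]; exact Function.update_eq_self i s
      simp [moveTop, hs, this]
    | cons a l =>
      simp only [List.head?_cons, List.tail_cons, Option.isSome_some, cond_true, moveTop, hs,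
        Option.getD_some]
      erw [machStk_some hj, update_machStk hj]
  | @seq p q s s₁ s₂ t₁ t₂ _ _ ih₁ ih₂ =>
    obtain ⟨v₁, hv₁⟩ := ih₁ ((le_max_left _ _).trans hm) (fun l => e (Sum.inl l))
      (e (Sum.inr q.entry)) (fun l => hM (Sum.inl l)) v
    obtain ⟨v₂, hv₂⟩ := ih₂ ((le_max_right _ _).trans hm) (fun l => e (Sum.inr l)) x
      (fun l => hM (Sum.inr l)) v₁
    exact ⟨v₂, hv₁.trans hv₂⟩
  | @ifTop_true k P p q s s' t h _ ih =>
    simp only [maxStack, sup_le_iff] at hm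
    obtain ⟨v₁, hv₁⟩ := ih hm.2.1 (fun l => e (some (Sum.inl l))) x
      (fun l => hM (some (Sum.inl l))) (s k).head?
    refine ⟨v₁, (Steps.single ?_).trans hv₁⟩
    rw [hM]
    simp only [entry, code, TM2.stepAux]
    erw [machStk_some hm.1]
    rw [h]; rfl
  | @ifTop_false k P p q s s' t h _ ih =>
    simp only [maxStack, sup_le_iff] at hm
    obtain ⟨v₁, hv₁⟩ := ih hm.2.2 (fun l => e (some (Sum.inr l))) x
      (fun l => hM (some (Sum.inr l))) (s k).head?
    refine ⟨v₁, (Steps.single ?_).trans hv₁⟩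
    rw [hM]
    simp only [entry, code, TM2.stepAux]
    erw [machStk_some hm.1]
    rw [h]; rfl
  | @while_nil k p s h =>
    simp only [maxStack, sup_le_iff] at hm
    refine ⟨none, Steps.single ?_⟩
    rw [hM]
    simp only [entry, code, TM2.stepAux]
    erw [machStk_some hm.1]
    rw [h]; rfl
  | @while_cons k p s s₁ s₂ t₁ t₂ h _ _ ih₁ ih₂ =>
    have hm' := hm
    simp only [maxStack, sup_le_iff] at hm'
    obtain ⟨v₁, hv₁⟩ := ih₁ hm'.2 (fun l => e (some l)) (e none)
      (fun l => hM (some l)) (s k).head?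
    -- The exit label of the body is the loop head, so the remaining rounds are a run of the same
    -- loop with the same labels.
    obtain ⟨v₂, hv₂⟩ := ih₂ hm e x hM v₁
    refine ⟨v₂, (Steps.single ?_).trans (hv₁.trans hv₂)⟩
    rw [hM]
    simp only [entry, code, TM2.stepAux]
    erw [machStk_some hm'.1]
    obtain ⟨a, l, hl⟩ := List.exists_cons_of_ne_nil h
    rw [hl]; rfl

/-- The machine that runs a program and then outputs whether stack `2` is non-empty. -/
def machine (p : Prog A) [Fintype A] : Turing.FinTM2 :=
  let _ := p.labFintype
  -- The `+ 2` guarantees that the answer stack exists even if the program does not mention it.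
  { K := Option (Fin (p.maxStack + 2 + 1))
    k₀ := some (Fin.ofNat _ 0)
    k₁ := none
    Γ := Alph A (p.maxStack + 2)
    Λ := Option p.Lab
    main := some p.entry
    σ := Option A
    initialState := none
    Γk₀Fin := inferInstanceAs (Fintype A)
    m := fun l => match l with
      | some l => p.code (p.maxStack + 2) some none l
      | none => .pop (some (Fin.ofNat _ 2)) (fun _ o => o)
          (.branch Option.isSome (.push none (fun _ => true) (.load (fun _ => none) .halt))
            (.push none (fun _ => false) (.load (fun _ => none) .halt))) }

/-- A program that decides `P` in polynomial time, leaving at most one symbol, gives a Turing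
machine that decides `P` in polynomial time. -/
theorem tm2ComputableInPolyTime [Fintype A] {α : Type} (ea : α → List A) (f : α → Bool)
    (p : Prog A) (Q : Polynomial ℕ)
    (h : ∀ a, ∃ t ≤ Q.eval (ea a).length,
      Run p (update (fun _ => []) 0 (ea a)) (update (fun _ => []) 2 (if f a then [default] else []))
        t) :
    Nonempty (Turing.TM2ComputableInPolyTime ea encodeBool f) := by
  -- The additional unit of time is for the exit label, where the answer bit is written and the
  -- machine halts.
  refine ⟨{ tm := p.machine, inputAlphabet := Equiv.refl A, outputAlphabet := Equiv.refl Bool,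
            time := Q + 1, outputsFun := fun a => ?_ }⟩
  have key : ∃ t ≤ Q.eval (ea a).length,
      (flip bind p.machine.step)^[t + 1] (some (Turing.initList p.machine (ea a))) =
        some (Turing.haltList p.machine [f a]) := by
    obtain ⟨t, ht, hr⟩ := h a
    refine ⟨t, ht, ?_⟩
    obtain ⟨v', hv'⟩ := hr.steps (m := p.maxStack + 2) p.machine.m (by omega) some none
      (fun l => rfl) none
    have h1 : Steps p.machine.m
        ⟨some none, v', machStk (p.maxStack + 2)
          (update (fun _ => []) 2 (if f a then [default] else []))⟩
        (Turing.haltList p.machine [f a]) 1 := by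
      refine Steps.single ?_
      change TM2.stepAux (.pop (some (Fin.ofNat (p.maxStack + 2 + 1) 2)) (fun _ o => o)
          (.branch Option.isSome (.push none (fun _ => true) (.load (fun _ => none) .halt))
            (.push none (fun _ => false) (.load (fun _ => none) .halt))) :
          TM2.Stmt (Alph A (p.maxStack + 2)) (Option p.Lab) (Option A)) _ _ = _
      simp only [TM2.stepAux]
      erw [machStk_some (by omega), update_machStk (by omega)]
      -- A halting configuration in the sense of `haltList` has the initial internal state and no
      -- content outside the output stack. This is why the exit code resets the state and pops the
      -- answer, and why programs have to erase everything else.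
      have hE : ∀ b : Bool, (⟨none, none, update (machStk (p.maxStack + 2)
            (fun _ => ([] : List A))) none [b]⟩ :
          TM2.Cfg (Alph A (p.maxStack + 2)) (Option p.Lab) (Option A)) =
          Turing.haltList p.machine [b] := by
        intro b
        unfold Turing.haltList
        congr 1
        funext k
        rcases k with _ | k
        · simp [machine]
          rfl
        · simp [machine, machStk]
      have hU : ∀ l : List A, update (update (fun _ : ℕ => ([] : List A)) 2 l) 2 [] =
          fun _ => [] := by
        intro l; simp
      by_cases hf : f a
      · simp only [hf, if_true, Function.update_self, List.head?_cons, Option.isSome_some,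
          cond_true, List.tail_cons, hU]
        exact hE true
      · simp only [hf, Function.update_self, if_false, Bool.false_eq_true, List.head?_nil,
          Option.isSome_none, cond_false, List.tail_nil, hU]
        exact hE false
    have h0 : Turing.initList p.machine (ea a) =
        ⟨some (some p.entry), none, machStk (p.maxStack + 2) (update (fun _ => []) 0 (ea a))⟩ := by
      unfold Turing.initList
      congr 1
      funext k
      rcases k with _ | k
      · simp [machine, machStk]
      · by_cases hk : k = Fin.ofNat _ 0
        · subst hk
          rw [machStk_some (by omega)]
          simp [machine]
          rfl
        · have : (k : ℕ) ≠ 0 := by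
            intro h; exact hk (by ext; simpa using h)
          have h2 : (some k : p.machine.K) ≠ p.machine.k₀ := by
            intro h; exact hk (Option.some.inj h)
          exact (dif_neg h2).trans (by simp [machStk, Function.update_of_ne this]; rfl)
    rw [h0]
    exact hv'.trans h1
  have hid : List.map (Equiv.refl A).invFun (ea a) = ea a := List.map_id _
  have out : Turing.TM2OutputsInTime p.machine (ea a) (some [f a])
      ((Q + 1).eval (ea a).length) :=
    { steps := key.choose + 1
      evals_in_steps := key.choose_spec.2
      steps_le_m := by
        have := key.choose_spec.1
        simpa using this }
  exact hid.symm ▸ out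

end Prog

end TemporalLearning

/-! ### Polynomial-time functions on words and unary numbers. -/

namespace TemporalLearning

open Function (update)

/-! ### Unary arithmetic by stack programs -/

namespace Prog

variable {A : Type}

/-- The loop rule used throughout: `S i` describes all stacks after `i` rounds, and stack `k` is a
counter that loses one symbol per round. A round costs the body plus one test; one more test ends
the loop. -/
theorem Run.while_of_seq {k : ℕ} {p : Prog A} {T N : ℕ} (S : ℕ → ℕ → List A)
    (hS : ∀ i ≤ N, (S i k).length = N - i) (hp : ∀ i < N, ∃ t ≤ T, Run p (S i) (S (i + 1)) t) :
    ∃ t ≤ N * (T + 1) + 1, Run (whileNE k p) (S 0) (S N) t := by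
  induction N generalizing S with
  | zero => exact ⟨1, by omega, .while_nil (List.length_eq_zero_iff.1 (by simpa using hS 0 le_rfl))⟩
  | succ N ih =>
    obtain ⟨t₂, ht₂, h₂⟩ := ih (fun i => S (i + 1)) (fun i hi => by rw [hS _ (by omega)]; omega)
      (fun i hi => hp _ (by omega))
    obtain ⟨t₁, ht₁, h₁⟩ := hp 0 (by omega)
    refine ⟨_, ?_, .while_cons ?_ h₁ h₂⟩
    · rw [Nat.succ_mul]; omega
    · intro h
      have := hS 0 (by omega)
      rw [h] at this
      simp at this

theorem reverse_take_succ {l : List A} {i : ℕ} (hi : i < l.length) :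
    (l.take (i + 1)).reverse = l[i] :: (l.take i).reverse := by
  rw [List.take_succ_eq_append_getElem hi, List.reverse_append]
  rfl

/-- Empty a stack. -/
def clear (k : ℕ) : Prog A := whileNE k (pop k)

theorem run_clear (k : ℕ) (s : ℕ → List A) :
    ∃ t ≤ 2 * (s k).length + 1, Run (clear k) s (update s k []) t := by
  obtain ⟨t, ht, h⟩ := Run.while_of_seq (k := k) (p := pop k) (T := 1) (N := (s k).length)
    (fun i => update s k ((s k).drop i)) (fun i _ => by simp) (fun i hi => by
      refine ⟨1, le_rfl, ?_⟩
      have := Run.pop k (update s k ((s k).drop i))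
      simpa using this)
  refine ⟨t, by omega, ?_⟩
  simpa [clear] using h

/-- Move the whole content of a stack to another one. -/
def drain (i j : ℕ) : Prog A := whileNE i (move i j)

theorem run_drain {i j : ℕ} (hij : i ≠ j) (s : ℕ → List A) :
    ∃ t ≤ 2 * (s i).length + 1,
      Run (drain i j) s (update (update s i []) j ((s i).reverse ++ s j)) t := by
  obtain ⟨t, ht, h⟩ := Run.while_of_seq (k := i) (p := move i j) (T := 1) (N := (s i).length)
    (fun n => update (update s i ((s i).drop n)) j (((s i).take n).reverse ++ s j))
    (fun n _ => by simp [Function.update_of_ne hij]) (fun n hn => by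
      refine ⟨1, le_rfl, ?_⟩
      have := Run.move i j
        (update (update s i ((s i).drop n)) j (((s i).take n).reverse ++ s j))
      convert this using 1
      rw [moveTop, Function.update_of_ne hij, Function.update_self, List.drop_eq_getElem_cons hn]
      funext l
      by_cases hl : l = j
      · subst hl
        simp [Function.update_of_ne hij.symm, reverse_take_succ hn]
      · by_cases hl' : l = i
        · subst hl'; simp [Function.update_of_ne hij]
        · simp [Function.update_of_ne hl, Function.update_of_ne hl'])
  refine ⟨t, by omega, ?_⟩
  simpa [drain] using h

variable [Inhabited A]

/-- A number in unary. -/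
def num (A : Type) [Inhabited A] (n : ℕ) : List A := List.replicate n default

@[simp] theorem length_num (n : ℕ) : (num A n).length = n := by simp [num]

@[simp] theorem num_zero : num A 0 = [] := rfl

theorem num_succ (n : ℕ) : num A (n + 1) = default :: num A n := rfl

@[simp] theorem tail_num (n : ℕ) : (num A n).tail = num A (n - 1) := by simp [num]

@[simp] theorem reverse_num (n : ℕ) : (num A n).reverse = num A n := by simp [num]

/-- Copy the number in register `i` to the empty register `d`, with the empty register `d + 1` as
scratch. -/
def copy (i d : ℕ) : Prog A :=
  seq (drain i (d + 1))
    (whileNE (d + 1) (seq (pop (d + 1)) (seq (push i default) (push d default))))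

theorem run_copy {i d x : ℕ} (hid : i < d) (s : ℕ → List A) (hi : s i = num A x)
    (hd : s d = []) (hd' : s (d + 1) = []) :
    ∃ t ≤ 6 * x + 2, Run (copy i d) s (update s d (num A x)) t := by
  obtain ⟨t₁, ht₁, h₁⟩ := run_drain (i := i) (j := d + 1) (by omega) s
  obtain ⟨t₂, ht₂, h₂⟩ := Run.while_of_seq (k := d + 1)
    (p := seq (pop (d + 1)) (seq (push i default) (push d (default : A)))) (T := 3) (N := x)
    (fun n => update (update (update s i (num A n)) (d + 1) (num A (x - n))) d (num A n))
    (fun n _ => by simp) (fun n hn => by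
      refine ⟨1 + (1 + 1), le_rfl, ?_⟩
      have h := Run.seq (Run.pop (d + 1)
        (update (update (update s i (num A n)) (d + 1) (num A (x - n))) d (num A n)))
        (Run.seq (Run.push i default _) (Run.push d (default : A) _))
      convert h using 1
      have h1 : i ≠ d := by omega
      have h2 : i ≠ d + 1 := by omega
      funext l
      by_cases hl : l = d
      · subst hl; simp [num_succ, h1.symm]
      · by_cases hl' : l = i
        · subst hl'; simp [num_succ, h1, h2]
        · by_cases hl'' : l = d + 1
          · subst hl''; simp [h2.symm, Nat.sub_sub]
          · simp [hl, hl', hl''])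
  refine ⟨t₁ + t₂, ?_, .seq h₁ ?_⟩
  · rw [hi] at ht₁; simp at ht₁; omega
  · convert h₂ using 1
    · rw [hi, hd']
      funext l
      by_cases hl : l = d
      · subst hl; simp [hd, show l ≠ i by omega]
      · simp [hl]
    · funext l
      by_cases hl : l = d
      · subst hl; simp
      · by_cases hl' : l = i
        · subst hl'; simp [hi, hl, show l ≠ d + 1 by omega]
        · by_cases hl'' : l = d + 1
          · subst hl''; simp [hd']
          · simp [hl, hl', hl'']

end Prog

/-! ### Functions computable in polynomial time -/

/-- Contexts: a word and a list of numbers. -/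
class Ctx (A : outParam Type) (α : Type) where
  word : α → List A
  val : α → List ℕ

instance {A : Type} : Ctx A (List A) := ⟨id, fun _ => []⟩

instance {A α : Type} [Ctx A α] : Ctx A (α × ℕ) :=
  ⟨fun a => Ctx.word a.1, fun a => a.2 :: Ctx.val a.1⟩

namespace Ctx

variable {A α : Type} [Ctx A α]

/-- The size of a context, its numbers being in unary. -/
def size (a : α) : ℕ := (word a).length + (val a).sum

@[simp] theorem word_list (w : List A) : word w = w := rfl
@[simp] theorem val_list (w : List A) : val w = [] := rfl
@[simp] theorem word_prod (a : α × ℕ) : word a = word a.1 := rfl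
@[simp] theorem val_prod (a : α × ℕ) : val a = a.2 :: val a.1 := rfl
@[simp] theorem size_prod (a : α × ℕ) : size a = size a.1 + a.2 := by simp [size]; omega

end Ctx

theorem eval_mono (P : Polynomial ℕ) {m n : ℕ} (h : m ≤ n) : P.eval m ≤ P.eval n := by
  induction P using Polynomial.induction_on' with
  | add p q hp hq => simpa using Nat.add_le_add hp hq
  | monomial k a => simpa using Nat.mul_le_mul_left a (Nat.pow_le_pow_left h k)

/-- A function that is bounded by a polynomial in the size of the context. -/
def PolyBdd {A α : Type} [Ctx A α] (f : α → ℕ) : Prop :=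
  ∃ P : Polynomial ℕ, ∀ a, f a ≤ P.eval (Ctx.size a)

namespace PolyBdd

variable {A α : Type} [Ctx A α] {f g : α → ℕ}

theorem mono (hg : PolyBdd g) (h : ∀ a, f a ≤ g a) : PolyBdd f :=
  let ⟨P, hP⟩ := hg
  ⟨P, fun a => (h a).trans (hP a)⟩

theorem const (c : ℕ) : PolyBdd fun _ : α => c := ⟨Polynomial.C c, fun _ => by simp⟩

theorem size : PolyBdd fun a : α => Ctx.size a := ⟨Polynomial.X, fun _ => by simp⟩

theorem add (hf : PolyBdd f) (hg : PolyBdd g) : PolyBdd fun a => f a + g a :=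
  let ⟨P, hP⟩ := hf
  let ⟨Q, hQ⟩ := hg
  ⟨P + Q, fun a => by simpa using Nat.add_le_add (hP a) (hQ a)⟩

theorem mul (hf : PolyBdd f) (hg : PolyBdd g) : PolyBdd fun a => f a * g a :=
  let ⟨P, hP⟩ := hf
  let ⟨Q, hQ⟩ := hg
  ⟨P * Q, fun a => by simpa using Nat.mul_le_mul (hP a) (hQ a)⟩

theorem eval (P : Polynomial ℕ) (hf : PolyBdd f) : PolyBdd fun a => P.eval (f a) :=
  let ⟨Q, hQ⟩ := hf
  ⟨P.comp Q, fun a => by simpa using eval_mono P (hQ a)⟩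

theorem length : PolyBdd fun a : α => (Ctx.word a).length :=
  size.mono fun a => by simp [Ctx.size]

end PolyBdd

/-- `PT f`: the number `f a` is bounded by a polynomial and can be computed in polynomial time, all
numbers being in unary. The program is to work for any placement `ρ` of the variables in registers
below the target register `d`; the registers `0` and `1` are for the input word. -/
def PT {A α : Type} [Inhabited A] [Ctx A α] (f : α → ℕ) : Prop :=
  PolyBdd f ∧ ∀ (ρ : List ℕ) (d : ℕ), 2 ≤ d → (∀ r ∈ ρ, r < d) →
    ∃ (p : Prog A) (T : α → ℕ), PolyBdd T ∧ ∀ (a : α) (s : ℕ → List A),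
      s 0 = Ctx.word a → s 1 = [] → ρ.map s = (Ctx.val a).map (Prog.num A) → (∀ j ≥ d, s j = []) →
      ∃ t ≤ T a, Prog.Run p s (update s d (Prog.num A (f a))) t

namespace PT

open Prog

variable {A α β : Type} [Inhabited A] [Ctx A α] [Ctx A β]

/-- The variable bound last. -/
theorem var₀ : PT fun c : α × ℕ => c.2 := by
  refine ⟨PolyBdd.size.mono fun a => by simp, fun ρ d hd hρ => ?_⟩
  rcases ρ with _ | ⟨r, ρ⟩
  -- An empty placement cannot carry the value of a variable, so the requirement is vacuous and any
  -- program will do.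
  · exact ⟨pop 0, fun _ => 0, .const 0, fun a s _ _ h => by simp at h⟩
  · refine ⟨copy r d, fun a => 6 * a.2 + 2, ((PolyBdd.const 6).mul
      (PolyBdd.size.mono fun a => by simp)).add (.const 2), fun a s _ _ h hs => ?_⟩
    simp only [Ctx.val_prod, List.map_cons, List.cons.injEq] at h
    exact run_copy (hρ r (by simp)) s h.1 (hs d le_rfl) (hs _ (by omega))

/-- Change of context by choosing some of the variables. -/
theorem reindex {f : α → ℕ} (hf : PT f) (φ : β → α) (R : List ℕ → List ℕ)
    (hR : ∀ ρ, R ρ ⊆ ρ) (hw : ∀ b, Ctx.word (φ b) = Ctx.word b)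
    (hv : ∀ (b : β) (s : ℕ → List A) (ρ : List ℕ), ρ.map s = (Ctx.val b).map (num A) →
      (R ρ).map s = (Ctx.val (φ b)).map (num A))
    (hsz : ∀ b, Ctx.size (φ b) ≤ Ctx.size b) : PT fun b => f (φ b) := by
  obtain ⟨⟨P, hP⟩, h⟩ := hf
  refine ⟨⟨P, fun b => (hP _).trans (eval_mono P (hsz b))⟩, fun ρ d hd hρ => ?_⟩
  obtain ⟨p, T, ⟨Q, hQ⟩, hp⟩ := h (R ρ) d hd (fun r hr => hρ r (hR ρ hr))
  refine ⟨p, fun b => T (φ b), ⟨Q, fun b => (hQ _).trans (eval_mono Q (hsz b))⟩,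
    fun b s h0 h1 hs hd => ?_⟩
  exact hp (φ b) s (by rw [h0, hw]) h1 (hv b s ρ hs) hd

theorem weaken {f : α → ℕ} (hf : PT f) : PT fun c : α × ℕ => f c.1 :=
  hf.reindex Prod.fst List.tail (fun ρ => List.tail_subset ρ) (fun _ => rfl)
    (fun b s ρ h => by rw [List.map_tail, h]; simp) (fun b => by simp)

/-- Local definitions. -/
theorem bind {f : α × ℕ → ℕ} (hf : PT f) {g : α → ℕ} (hg : PT g) : PT fun a => f (a, g a) := by
  obtain ⟨⟨Pf, hPf⟩, hf⟩ := hf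
  obtain ⟨bg, hg⟩ := hg
  have hbf : PolyBdd fun a => f (a, g a) :=
    (PolyBdd.eval Pf (PolyBdd.size.add bg)).mono fun a => by simpa using hPf (a, g a)
  refine ⟨hbf, fun ρ d hd hρ => ?_⟩
  obtain ⟨p, T, hT, hp⟩ := hg ρ d hd hρ
  obtain ⟨q, U, ⟨PU, hU⟩, hq⟩ := hf (d :: ρ) (d + 1) (by omega) (fun r hr => by
    rcases List.mem_cons.1 hr with rfl | hr
    · omega
    · exact (hρ r hr).trans (Nat.lt_succ_self d))
  -- Register `d` first holds `g a` and serves as the newest variable while `f` is computed into `d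
  -- + 1`. Then it is erased and receives the result.
  refine ⟨seq p (seq q (seq (clear d) (drain (d + 1) d))),
    fun a => T a + (PU.eval (Ctx.size a + g a) + ((2 * g a + 1) + (2 * f (a, g a) + 1))),
    hT.add ((PolyBdd.eval PU (PolyBdd.size.add bg)).add
      ((((PolyBdd.const 2).mul bg).add (.const 1)).add (((PolyBdd.const 2).mul hbf).add (.const 1)))),
    fun a s h0 h1 hs hds => ?_⟩
  obtain ⟨t₁, ht₁, r₁⟩ := hp a s h0 h1 hs hds
  set s₁ := update s d (num A (g a)) with hs₁
  have hρs : ρ.map s₁ = ρ.map s := List.map_congr_left fun r hr => by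
    rw [hs₁, Function.update_of_ne (hρ r hr).ne]
  obtain ⟨t₂, ht₂, r₂⟩ := hq (a, g a) s₁ (by rw [hs₁, Function.update_of_ne (by omega), h0]; rfl)
    (by rw [hs₁, Function.update_of_ne (by omega), h1])
    (by rw [List.map_cons, hρs, hs]; simp [hs₁])
    (fun j hj => by rw [hs₁, Function.update_of_ne (by omega), hds j (by omega)])
  set s₂ := update s₁ (d + 1) (num A (f (a, g a))) with hs₂
  obtain ⟨t₃, ht₃, r₃⟩ := run_clear d s₂
  obtain ⟨t₄, ht₄, r₄⟩ := run_drain (i := d + 1) (j := d) (by omega) (update s₂ d [])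
  refine ⟨t₁ + (t₂ + (t₃ + t₄)), ?_, ?_⟩
  · have h2 := ht₂.trans (hU _)
    simp only [Ctx.size_prod] at h2
    have h3 : (s₂ d).length = g a := by simp [hs₂, hs₁]
    have h4 : (update s₂ d [] (d + 1)).length = f (a, g a) := by simp [hs₂]
    beta_reduce
    rw [h3] at ht₃
    rw [h4] at ht₄
    omega
  · convert r₁.seq (r₂.seq (r₃.seq r₄)) using 1
    funext l
    by_cases hl : l = d
    · subst hl; simp [hs₂]
    · by_cases hl' : l = d + 1
      · subst hl'; simp [hds]
      · simp [hl, hl', hs₂, hs₁]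

theorem zero : PT fun _ : α => 0 :=
  ⟨.const 0, fun _ d _ _ => ⟨pop d, fun _ => 1, .const 1, fun _ s _ _ _ hs =>
    ⟨1, le_rfl, by simpa [hs d le_rfl] using Run.pop d s⟩⟩⟩

theorem succ {f : α → ℕ} (hf : PT f) : PT fun a => f a + 1 := by
  refine ⟨hf.1.add (.const 1), fun ρ d hd hρ => ?_⟩
  obtain ⟨p, T, hT, hp⟩ := hf.2 ρ d hd hρ
  refine ⟨seq p (push d default), fun a => T a + 1, hT.add (.const 1), fun a s h0 h1 hs hds => ?_⟩
  obtain ⟨t, ht, r⟩ := hp a s h0 h1 hs hds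
  refine ⟨t + 1, Nat.add_le_add_right ht 1, ?_⟩
  simpa [num_succ] using r.seq (.push d default _)

theorem const (c : ℕ) : PT fun _ : α => c := by
  induction c with
  | zero => exact zero
  | succ c ih => exact ih.succ

/-- Bounded primitive recursion. -/
theorem natRec {g b : α → ℕ} {h : (α × ℕ) × ℕ → ℕ} (hg : PT g) (hb : PT b) (hh : PT h)
    {B : α → ℕ} (hB : PolyBdd B)
    (hbd : ∀ a, ∀ i ≤ b a, Nat.rec (g a) (fun i x => h ((a, i), x)) i ≤ B a) :
    PT fun a => Nat.rec (motive := fun _ => ℕ) (g a) (fun i x => h ((a, i), x)) (b a) := by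
  set R : α → ℕ → ℕ := fun a i => Nat.rec (motive := fun _ => ℕ) (g a)
    (fun i x => h ((a, i), x)) i with hR
  obtain ⟨bg, hg⟩ := hg
  obtain ⟨bb, hb⟩ := hb
  obtain ⟨bh, hh⟩ := hh
  refine ⟨hB.mono fun a => hbd a _ le_rfl, fun ρ d hd hρ => ?_⟩
  -- Layout of the registers: `d` holds the current value, `d + 1` the number of rounds left, `d +
  -- 2` the index of the round, and `d + 3` receives the next value.
  obtain ⟨pb, Tb, hTb, hpb⟩ := hb ρ (d + 1) (by omega) (fun r hr => by have := hρ r hr; omega)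
  obtain ⟨pg, Tg, hTg, hpg⟩ := hg ρ (d + 2) (by omega) (fun r hr => by have := hρ r hr; omega)
  obtain ⟨ph, Th, ⟨Ph, hTh⟩, hph⟩ := hh (d :: (d + 2) :: ρ) (d + 3) (by omega) (fun r hr => by
    simp only [List.mem_cons] at hr
    rcases hr with rfl | rfl | hr
    · omega
    · omega
    · have := hρ r hr; omega)
  let body : Prog A := seq (pop (d + 1)) (seq ph (seq (clear d) (seq (drain (d + 3) d)
    (push (d + 2) default))))
  let T : α → ℕ := fun a => Ph.eval (Ctx.size a + b a + B a) + (4 * B a + 4)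
  have hT : PolyBdd T := (PolyBdd.eval Ph ((PolyBdd.size.add bb).add hB)).add
    (((PolyBdd.const 4).mul hB).add (.const 4))
  refine ⟨seq pb (seq pg (seq (drain (d + 2) d) (seq (whileNE (d + 1) body) (clear (d + 2))))),
    fun a => Tb a + (Tg a + ((2 * g a + 1) + ((b a * (T a + 1) + 1) + (2 * b a + 1)))), ?_, ?_⟩
  · exact hTb.add (hTg.add ((((PolyBdd.const 2).mul bg).add (.const 1)).add
      (((bb.mul (hT.add (.const 1))).add (.const 1)).add
        (((PolyBdd.const 2).mul bb).add (.const 1)))))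
  · intro a s h0 h1 hs hds
    have hρs : ∀ s' : ℕ → List A, (∀ r < d, s' r = s r) → ρ.map s' = ρ.map s := fun s' h =>
      List.map_congr_left fun r hr => h r (hρ r hr)
    obtain ⟨t₁, ht₁, r₁⟩ := hpb a s h0 h1 hs (fun j hj => hds j (by omega))
    set s₁ := update s (d + 1) (num A (b a)) with hs₁
    obtain ⟨t₂, ht₂, r₂⟩ := hpg a s₁ (by rw [hs₁, Function.update_of_ne (by omega), h0])
      (by rw [hs₁, Function.update_of_ne (by omega), h1])
      (by rw [hρs s₁ (fun r hr => by rw [hs₁, Function.update_of_ne (by omega)]), hs])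
      (fun j hj => by rw [hs₁, Function.update_of_ne (by omega), hds j (by omega)])
    set s₂ := update s₁ (d + 2) (num A (g a)) with hs₂
    obtain ⟨t₃, ht₃, r₃⟩ := run_drain (i := d + 2) (j := d) (by omega) s₂
    let S : ℕ → ℕ → List A := fun i =>
      update (update (update s d (num A (R a i))) (d + 1) (num A (b a - i))) (d + 2) (num A i)
    have hS0 : update (update s₂ (d + 2) []) d ((s₂ (d + 2)).reverse ++ s₂ d) = S 0 := by
      funext l
      by_cases hl : l = d
      · subst hl; simp [S, hs₂, hs₁, hds, hR]
      · by_cases hl' : l = d + 1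
        · subst hl'; simp [S, hs₂, hs₁]
        · by_cases hl'' : l = d + 2
          · subst hl''; simp [S]
          · simp [S, hs₂, hs₁, hl, hl', hl'']
    rw [hS0] at r₃
    obtain ⟨t₄, ht₄, r₄⟩ := Run.while_of_seq (k := d + 1) (p := body) (T := T a) (N := b a) S
      (fun i _ => by simp [S]) (fun i hi => by
        set q₁ := update (S i) (d + 1) (S i (d + 1)).tail with hq₁
        obtain ⟨u₂, hu₂, w₂⟩ := hph ((a, i), R a i) q₁ (by
            simp only [hq₁, S]
            rw [Function.update_of_ne (by omega), Function.update_of_ne (by omega),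
              Function.update_of_ne (by omega), Function.update_of_ne (by omega), h0]
            rfl)
          (by
            simp only [hq₁, S]
            rw [Function.update_of_ne (by omega), Function.update_of_ne (by omega),
              Function.update_of_ne (by omega), Function.update_of_ne (by omega), h1])
          (by
            rw [List.map_cons, List.map_cons, hρs q₁ (fun r hr => by
              simp only [hq₁, S]
              rw [Function.update_of_ne (by omega), Function.update_of_ne (by omega),
                Function.update_of_ne (by omega), Function.update_of_ne (by omega)]), hs]
            simp [hq₁, S])
          (fun j hj => by
            simp only [hq₁, S]
            rw [Function.update_of_ne (by omega), Function.update_of_ne (by omega),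
              Function.update_of_ne (by omega), Function.update_of_ne (by omega),
              hds j (by omega)])
        set q₂ := update q₁ (d + 3) (num A (h ((a, i), R a i))) with hq₂
        obtain ⟨u₃, hu₃, w₃⟩ := run_clear d q₂
        obtain ⟨u₄, hu₄, w₄⟩ := run_drain (i := d + 3) (j := d) (by omega) (update q₂ d [])
        have hRs : h ((a, i), R a i) = R a (i + 1) := rfl
        refine ⟨1 + (u₂ + (u₃ + (u₄ + 1))), ?_, ?_⟩
        · have e1 : (q₂ d).length = R a i := by simp [hq₂, hq₁, S]
          have e2 : (update q₂ d [] (d + 3)).length = R a (i + 1) := by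
            rw [Function.update_of_ne (by omega), hq₂, Function.update_self, length_num, hRs]
          have e3 : R a i ≤ B a := hbd a i hi.le
          have e4 : R a (i + 1) ≤ B a := hbd a (i + 1) hi
          have e5 : Th ((a, i), R a i) ≤ Ph.eval (Ctx.size a + b a + B a) :=
            (hTh _).trans (eval_mono Ph (by simp only [Ctx.size_prod]; omega))
          simp only [T]
          omega
        · convert (Run.pop (d + 1) (S i)).seq (w₂.seq (w₃.seq (w₄.seq (.push (d + 2) default _))))
            using 1
          rw [hq₂, hRs, hq₁]
          funext l
          by_cases hl : l = d
          · subst hl; simp [S]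
          · by_cases hl' : l = d + 1
            · subst hl'; simp [S, Nat.sub_sub]
            · by_cases hl'' : l = d + 2
              · subst hl''; simp [S, num_succ]
              · by_cases hl3 : l = d + 3
                · subst hl3; simp [S, hds]
                · simp [S, hl, hl', hl'', hl3])
    obtain ⟨t₅, ht₅, r₅⟩ := run_clear (d + 2) (S (b a))
    refine ⟨t₁ + (t₂ + (t₃ + (t₄ + t₅))), ?_, ?_⟩
    · have e1 : (s₂ (d + 2)).length = g a := by simp [hs₂]
      have e2 : (S (b a) (d + 2)).length = b a := by simp [S]
      beta_reduce
      rw [e1] at ht₃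
      rw [e2] at ht₅
      omega
    · convert r₁.seq (r₂.seq (r₃.seq (r₄.seq r₅))) using 1
      funext l
      by_cases hl : l = d
      · subst hl; simp [S, hR]
      · by_cases hl' : l = d + 1
        · subst hl'; simp [S, hds]
        · by_cases hl'' : l = d + 2
          · subst hl''; simp [hds]
          · simp [S, hl, hl', hl'']

/-- The length of the word. -/
theorem wordLength : PT fun a : α => (Ctx.word a).length := by
  refine ⟨.length, fun ρ d hd hρ => ⟨seq (whileNE 0 (seq (move 0 1) (push d default))) (drain 1 0),
    fun a => ((Ctx.word a).length * 3 + 1) + (2 * (Ctx.word a).length + 1),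
    ((PolyBdd.length.mul (.const 3)).add (.const 1)).add
      (((PolyBdd.const 2).mul .length).add (.const 1)), fun a s h0 h1 hs hds => ?_⟩⟩
  set w := Ctx.word a with hw
  let S : ℕ → ℕ → List A := fun i =>
    update (update (update s 0 (w.drop i)) 1 (w.take i).reverse) d (num A i)
  have d0 : (0 : ℕ) ≠ d := by omega
  have d1 : (1 : ℕ) ≠ d := by omega
  obtain ⟨t₁, ht₁, r₁⟩ := Run.while_of_seq (k := 0) (p := seq (move 0 1) (push d (default : A)))
    (T := 2) (N := w.length) S (fun i _ => by simp [S, d0]) (fun i hi => by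
      refine ⟨1 + 1, le_rfl, ?_⟩
      convert (Run.move 0 1 (S i)).seq (Run.push d (default : A) _) using 1
      have : S i 0 = w[i] :: w.drop (i + 1) := by
        simp [S, d0]
      rw [moveTop, this]
      funext l
      by_cases hl : l = d
      · subst hl; simp [S, num_succ, d0.symm, d1.symm]
      · by_cases hl' : l = 1
        · subst hl'; simp [S, d1, reverse_take_succ hi]
        · by_cases hl'' : l = 0
          · subst hl''; simp [S, d0]
          · simp [S, hl, hl', hl''])
  obtain ⟨t₂, ht₂, r₂⟩ := run_drain (A := A) (i := 1) (j := 0) (by omega) (S w.length)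
  refine ⟨t₁ + t₂, ?_, ?_⟩
  · have : (S w.length 1).length = w.length := by simp [S, d1]
    beta_reduce
    rw [← hw]
    omega
  · have hS0 : S 0 = s := by
      funext l
      by_cases hl : l = d
      · subst hl; simp [S, hds]
      · by_cases hl' : l = 1
        · subst hl'; simp [S, d1, h1]
        · by_cases hl'' : l = 0
          · subst hl''; simp [S, d0, h0]
          · simp [S, hl, hl', hl'']
    rw [hS0] at r₁
    convert r₁.seq r₂ using 1
    funext l
    by_cases hl : l = d
    · subst hl; simp [S, d0.symm, d1.symm, hw]
    · by_cases hl' : l = 1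
      · subst hl'; simp [d1, h1]
      · by_cases hl'' : l = 0
        · subst hl''; simp [S, d0, d1, h0]
        · simp [S, hl, hl', hl'']

/-- Access to the word. -/
theorem chr (P : Option A → Bool) {f : α → ℕ} (hf : PT f) :
    PT fun a => if P (Ctx.word a)[f a]? then 1 else 0 := by
  refine ⟨(PolyBdd.const 1).mono fun a => by split <;> simp, fun ρ d hd hρ => ?_⟩
  obtain ⟨p, T, hT, hp⟩ := hf.2 ρ d hd hρ
  -- The value of `f` counts down in `d` while letters travel from stack `0` to stack `1`, which
  -- leaves the wanted letter on top of stack `0`. Beyond the end of the word `move` does nothing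
  -- and the top is `none`. The pop of the now empty `d` is a null operation, and the last loop
  -- restores the word.
  refine ⟨seq p (seq (whileNE d (seq (pop d) (move 0 1)))
    (seq (ifTop 0 P (push d default) (pop d)) (drain 1 0))),
    fun a => T a + ((f a * 3 + 1) + (2 + (2 * (Ctx.word a).length + 1))),
    hT.add (((hf.1.mul (.const 3)).add (.const 1)).add ((PolyBdd.const 2).add
      (((PolyBdd.const 2).mul .length).add (.const 1)))), fun a s h0 h1 hs hds => ?_⟩
  obtain ⟨t₁, ht₁, r₁⟩ := hp a s h0 h1 hs hds
  set w := Ctx.word a with hw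
  let S : ℕ → ℕ → List A := fun i =>
    update (update (update s 0 (w.drop i)) 1 (w.take i).reverse) d (num A (f a - i))
  have d0 : (0 : ℕ) ≠ d := by omega
  have d1 : (1 : ℕ) ≠ d := by omega
  obtain ⟨t₂, ht₂, r₂⟩ := Run.while_of_seq (k := d) (p := seq (pop d) (move 0 1))
    (T := 2) (N := f a) S (fun i _ => by simp [S]) (fun i hi => by
      refine ⟨1 + 1, le_rfl, ?_⟩
      convert (Run.pop d (S i)).seq (Run.move 0 1 _) using 1
      have e0 : update (S i) d (S i d).tail 0 = w.drop i := by
        simp [S, d0]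
      rw [moveTop, e0]
      by_cases hi : i < w.length
      · rw [List.drop_eq_getElem_cons hi]
        funext l
        by_cases hl : l = d
        · subst hl; simp [S, d0.symm, d1.symm, Nat.sub_sub]
        · by_cases hl' : l = 1
          · subst hl'; simp [S, d1, reverse_take_succ hi]
          · by_cases hl'' : l = 0
            · subst hl''; simp [S, d0]
            · simp [S, hl, hl', hl'']
      · have hi' : w.length ≤ i := by omega
        rw [List.drop_eq_nil_of_le hi']
        funext l
        by_cases hl : l = d
        · subst hl; simp [S, Nat.sub_sub]
        · by_cases hl' : l = 1
          · subst hl'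
            simp [S, d1, List.take_of_length_le hi', List.take_of_length_le (hi'.trans i.le_succ)]
          · by_cases hl'' : l = 0
            · subst hl''
              simp [S, d0, List.drop_eq_nil_of_le hi', List.drop_eq_nil_of_le (hi'.trans i.le_succ)]
            · simp [S, hl, hl', hl''])
  have hS0 : S 0 = update s d (num A (f a)) := by
    funext l
    by_cases hl : l = d
    · subst hl; simp [S]
    · by_cases hl' : l = 1
      · subst hl'; simp [S, d1, h1]
      · by_cases hl'' : l = 0
        · subst hl''; simp [S, d0, h0]
        · simp [S, hl, hl', hl'']
  rw [hS0] at r₂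
  set b : ℕ := if P w[f a]? then 1 else 0 with hb
  have r₃ : Run (ifTop 0 P (push d default) (pop d)) (S (f a))
      (update (S (f a)) d (num A b)) (1 + 1) := by
    have hh : (S (f a) 0).head? = w[f a]? := by simp [S, d0]
    by_cases hP : P w[f a]? = true
    · refine .ifTop_true (by rw [hh, hP]) ?_
      convert Run.push d (default : A) (S (f a)) using 1
      simp [S, hb, hP, num_succ]
    · refine .ifTop_false (by rw [hh]; simpa using hP) ?_
      convert Run.pop d (S (f a)) using 1
      simp [S, hb, hP]
  obtain ⟨t₄, ht₄, r₄⟩ := run_drain (A := A) (i := 1) (j := 0) (by omega)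
    (update (S (f a)) d (num A b))
  refine ⟨t₁ + (t₂ + ((1 + 1) + t₄)), ?_, ?_⟩
  · have : (update (S (f a)) d (num A b) 1).length ≤ w.length := by simp [S, d1]
    beta_reduce
    rw [← hw]
    omega
  · convert r₁.seq (r₂.seq (r₃.seq r₄)) using 1
    funext l
    by_cases hl : l = d
    · subst hl; simp [d0.symm, d1.symm, hb, hw]
    · by_cases hl' : l = 1
      · subst hl'; simp [d1, h1]
      · by_cases hl'' : l = 0
        · subst hl''; simp [S, d0, d1, h0]
        · simp [S, hl, hl', hl'']

end PT

end TemporalLearning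

/-! ### Closure properties: arithmetic, sums, iteration, bounded quantifiers. -/

namespace TemporalLearning

open Function (update)

namespace PT

open Prog

variable {A α β : Type} [Inhabited A] [Ctx A α] [Ctx A β]

theorem var₁ : PT fun c : (α × ℕ) × ℕ => c.1.2 := var₀.weaken
theorem var₂ : PT fun c : ((α × ℕ) × ℕ) × ℕ => c.1.1.2 := var₁.weaken
theorem var₃ : PT fun c : (((α × ℕ) × ℕ) × ℕ) × ℕ => c.1.1.1.2 := var₂.weaken

/-- Makes a function of the innermost variable usable beneath an intermediate binder on which it
does not depend. -/
theorem under {f : α × ℕ → ℕ} (hf : PT f) : PT fun c : (α × ℕ) × ℕ => f (c.1.1, c.2) :=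
  hf.reindex (fun c : (α × ℕ) × ℕ => (c.1.1, c.2)) (fun ρ => ρ.take 1 ++ ρ.drop 2)
    (fun ρ => List.append_subset.2 ⟨List.take_subset _ _, List.drop_subset _ _⟩) (fun _ => rfl)
    (fun b s ρ h => by rw [List.map_append, List.map_take, List.map_drop, h]; simp)
    (fun b => by simp [Ctx.size])

/-- Parsing functions are shown computable once, on a bare word with one position. This carries them
to every context and every computable position. -/
theorem comp₁ {f : List A → ℕ → ℕ} (hf : PT fun c : List A × ℕ => f c.1 c.2) {g : α → ℕ}
    (hg : PT g) : PT fun a => f (Ctx.word a) (g a) := by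
  have h : PT fun c : α × ℕ => f (Ctx.word c.1) c.2 :=
    hf.reindex (fun c : α × ℕ => (Ctx.word c.1, c.2)) (List.take 1)
      (fun ρ => List.take_subset 1 ρ) (fun _ => rfl)
      (fun b s ρ h => by rw [List.map_take, h]; simp)
      (fun b => by simp [Ctx.size])
  exact h.bind hg

/-- Bounded recursion for a function known in closed form, through its recursion equations; the
arithmetic operations below are instances. -/
theorem of_rec {g b : α → ℕ} {F : α → ℕ → ℕ} {h : (α × ℕ) × ℕ → ℕ} (hg : PT g) (hb : PT b)
    (hh : PT h) (h0 : ∀ a, F a 0 = g a) (hs : ∀ a i, F a (i + 1) = h ((a, i), F a i))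
    {B : α → ℕ} (hB : PolyBdd B) (hbd : ∀ a, ∀ i ≤ b a, F a i ≤ B a) :
    PT fun a => F a (b a) := by
  have key : ∀ a i, Nat.rec (motive := fun _ => ℕ) (g a) (fun i x => h ((a, i), x)) i = F a i := by
    intro a i
    induction i with
    | zero => exact (h0 a).symm
    | succ i ih => rw [hs, ← ih]
  have := natRec hg hb hh hB (fun a i hi => by rw [key]; exact hbd a i hi)
  simpa only [key] using this

theorem add {f g : α → ℕ} (hf : PT f) (hg : PT g) : PT fun a => f a + g a :=
  of_rec (F := fun a i => f a + i) hf hg var₀.succ (fun _ => rfl) (fun _ _ => rfl)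
    (hf.1.add hg.1) (fun a i hi => by omega)

theorem pred {f : α → ℕ} (hf : PT f) : PT fun a => f a - 1 :=
  of_rec (F := fun _ i => i - 1) zero hf var₁ (fun _ => rfl) (fun _ _ => rfl)
    hf.1 (fun a i hi => by omega)

theorem sub {f g : α → ℕ} (hf : PT f) (hg : PT g) : PT fun a => f a - g a :=
  of_rec (F := fun a i => f a - i) hf hg (pred var₀) (fun _ => rfl) (fun _ _ => rfl)
    hf.1 (fun a i hi => by omega)

theorem mul {f g : α → ℕ} (hf : PT f) (hg : PT g) : PT fun a => f a * g a :=
  of_rec (F := fun a i => f a * i) zero hg (add var₀ hf.weaken.weaken) (fun _ => rfl)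
    (fun _ _ => rfl) (hf.1.mul hg.1) (fun _ _ hi => Nat.mul_le_mul_left _ hi)

theorem sum {b : α → ℕ} {g : α → ℕ → ℕ} (hb : PT b) (hg : PT fun c : α × ℕ => g c.1 c.2) :
    PT fun a => ∑ i ∈ Finset.range (b a), g a i := by
  obtain ⟨P, hP⟩ := hg.1
  refine of_rec (F := fun a n => ∑ i ∈ Finset.range n, g a i) zero hb
    (add var₀ (hg.weaken)) (fun _ => rfl)
    (fun a i => by rw [Finset.sum_range_succ]) (B := fun a => b a * P.eval (Ctx.size a + b a))
    (hb.1.mul (.eval P (PolyBdd.size.add hb.1))) (fun a n hn => ?_)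
  calc ∑ i ∈ Finset.range n, g a i ≤ ∑ i ∈ Finset.range n, P.eval (Ctx.size a + b a) := by
        refine Finset.sum_le_sum fun i hi => (hP (a, i)).trans (eval_mono P ?_)
        have := Finset.mem_range.1 hi
        simp only [Ctx.size_prod]; omega
    _ ≤ _ := by
        simp only [Finset.sum_const, Finset.card_range, smul_eq_mul]
        exact Nat.mul_le_mul_right _ hn

/-- Recursion along `c a` with a step that ignores the previous value: the start value `f a`
survives only if there is no round. -/
theorem ite_zero {c f g : α → ℕ} (hc : PT c) (hf : PT f) (hg : PT g) :
    PT fun a => if c a = 0 then f a else g a :=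
  of_rec (F := fun a i => if i = 0 then f a else g a) hf hc (hg.weaken.weaken) (fun _ => rfl)
    (fun _ _ => by simp) (hf.1.add hg.1) (fun a i hi => by split <;> omega)

/-- Iteration does not preserve polynomial bounds in general; `hlen` keeps all iterates after the
first below the length of the word. -/
theorem iterate {f : List A → ℕ → ℕ} (hf : PT fun c : List A × ℕ => f c.1 c.2)
    (hlen : ∀ w i, f w i ≤ w.length) {g b : α → ℕ} (hg : PT g) (hb : PT b) :
    PT fun a => (f (Ctx.word a))^[b a] (g a) :=
  of_rec (F := fun a n => (f (Ctx.word a))^[n] (g a)) hg hb (comp₁ hf var₀)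
    (fun _ => rfl) (fun a i => by rw [Function.iterate_succ_apply']; rfl)
    (hg.1.add PolyBdd.length) (fun a i _ => by
      rcases i with _ | i
      · simp
      · rw [Function.iterate_succ_apply']
        exact (hlen _ _).trans (Nat.le_add_left _ _))

end PT

/-! ### Properties decidable in polynomial time -/

open Classical in
/-- The truth value of a proposition as a number. -/
noncomputable def ind (p : Prop) : ℕ := if p then 1 else 0

@[simp] theorem ind_eq_zero {p : Prop} : ind p = 0 ↔ ¬ p := by simp [ind]

theorem ind_of_true {p : Prop} (h : p) : ind p = 1 := by simp [ind, h]

theorem ind_of_false {p : Prop} (h : ¬ p) : ind p = 0 := by simp [ind, h]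

theorem ind_le_one (p : Prop) : ind p ≤ 1 := by
  unfold ind
  split <;> simp

/-- The property `p` can be decided in polynomial time. -/
def PTP {A α : Type} [Inhabited A] [Ctx A α] (p : α → Prop) : Prop :=
  PT fun a => ind (p a)

namespace PTP

variable {A α β : Type} [Inhabited A] [Ctx A α] [Ctx A β] {p q : α → Prop}

theorem of_zero {c : α → ℕ} (hc : PT c) (h : ∀ a, p a ↔ c a = 0) : PTP p := by
  have := PT.ite_zero hc (PT.const 1) (PT.const 0)
  unfold PTP
  convert this using 2 with a
  by_cases hp : p a
  · rw [ind_of_true hp, if_pos ((h a).1 hp)]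
  · rw [ind_of_false hp, if_neg fun h' => hp ((h a).2 h')]

theorem ite' (hp : PTP p) {f g : α → ℕ} (hf : PT f) (hg : PT g) [∀ a, Decidable (p a)] :
    PT fun a => if p a then f a else g a := by
  have := PT.ite_zero hp hg hf
  convert this using 2 with a
  by_cases h : p a <;> simp [h]

theorem not (hp : PTP p) : PTP fun a => ¬ p a :=
  of_zero hp fun a => by by_cases h : p a <;> simp [h]

theorem and (hp : PTP p) (hq : PTP q) : PTP fun a => p a ∧ q a :=
  of_zero (hp.not.add hq.not) fun a => by by_cases h : p a <;> by_cases h' : q a <;> simp [h, h']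

theorem congr (hp : PTP p) (h : ∀ a, q a ↔ p a) : PTP q := by
  have : q = p := funext fun a => propext (h a)
  rwa [this]

theorem or (hp : PTP p) (hq : PTP q) : PTP fun a => p a ∨ q a :=
  (hp.not.and hq.not).not.congr fun a => by tauto

theorem imp (hp : PTP p) (hq : PTP q) : PTP fun a => p a → q a :=
  (hp.not.or hq).congr fun a => by tauto

theorem iff (hp : PTP p) (hq : PTP q) : PTP fun a => p a ↔ q a :=
  ((hp.imp hq).and (hq.imp hp)).congr fun a => by tauto

/-- A fixed proposition need not be decidable, as its truth value is one of two constants. -/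
theorem const (r : Prop) : PTP fun _ : α => r := by
  unfold PTP
  exact PT.const _

theorem le {f g : α → ℕ} (hf : PT f) (hg : PT g) : PTP fun a => f a ≤ g a :=
  of_zero (hf.sub hg) fun a => by omega

theorem lt {f g : α → ℕ} (hf : PT f) (hg : PT g) : PTP fun a => f a < g a :=
  le hf.succ hg

theorem eq {f g : α → ℕ} (hf : PT f) (hg : PT g) : PTP fun a => f a = g a :=
  ((le hf hg).and (le hg hf)).congr fun a => by omega

/-- The predicate is wired into a branching instruction and need not be effective. In this way the
sets of allowed operators enter the verifier. -/
theorem chr (P : Option A → Prop) {f : α → ℕ} (hf : PT f) :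
    PTP fun a => P (Ctx.word a)[f a]? := by
  classical
  have := PT.chr (fun o => decide (P o)) hf
  unfold PTP
  convert this using 2 with a
  simp [ind]

/-- The number of counterexamples is a computable sum, and it is compared with zero. -/
theorem all {b : α → ℕ} {r : α → ℕ → Prop} (hb : PT b) (hr : PTP fun c : α × ℕ => r c.1 c.2) :
    PTP fun a => ∀ i < b a, r a i := by
  refine of_zero (PT.sum (g := fun a i => ind (¬ r a i)) hb hr.not) fun a => ?_
  simp

theorem ex {b : α → ℕ} {r : α → ℕ → Prop} (hb : PT b) (hr : PTP fun c : α × ℕ => r c.1 c.2) :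
    PTP fun a => ∃ i < b a, r a i :=
  (all (r := fun a i => ¬ r a i) hb hr.not).not.congr fun a => by push Not; rfl

/-- The quantifier is unrolled into a conjunction, so each instance may have its own program. -/
theorem allFin {X : Type} [Finite X] {r : X → α → Prop} (h : ∀ x, PTP (r x)) :
    PTP fun a => ∀ x, r x a := by
  have := Fintype.ofFinite X
  classical
  have key : ∀ s : Finset X, PTP fun a => ∀ x ∈ s, r x a := by
    intro s
    induction s using Finset.induction_on with
    | empty => exact (const True).congr fun a => by simp
    | insert x s _ ih => exact ((h x).and ih).congr fun a => by simp
  exact (key Finset.univ).congr fun a => by simp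

end PTP

theorem PT.ite {A α : Type} [Inhabited A] [Ctx A α] {p : α → Prop} (hp : PTP p) {f g : α → ℕ}
    (hf : PT f) (hg : PT g) [∀ a, Decidable (p a)] : PT fun a => if p a then f a else g a :=
  hp.ite' hf hg

/-- A property of words that is decidable in polynomial time in the above sense is decided by a
Turing machine in polynomial time. -/
theorem PTP.tm2ComputableInPolyTime {A : Type} [Inhabited A] [Fintype A] {V : List A → Prop}
    (hV : PTP V) {α : Type} (ea : α → List A) (f : α → Bool) (hf : ∀ a, f a = true ↔ V (ea a)) :
    Nonempty (Turing.TM2ComputableInPolyTime ea encodeBool f) := by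
  obtain ⟨p, T, ⟨Q, hQ⟩, hp⟩ := hV.2 [] 3 (by omega) (by simp)
  refine Prog.tm2ComputableInPolyTime ea f
    (.seq p (.seq (Prog.clear 0) (Prog.drain 3 2)))
    -- Erasing the input takes `2 * X + 1` steps; moving an answer of at most one symbol takes at
    -- most `3`.
    (Q + (2 * Polynomial.X + 1 + 3)) fun a => ?_
  set s := update (fun _ => []) 0 (ea a) with hs
  obtain ⟨t₁, ht₁, r₁⟩ := hp (ea a) s (by simp [hs]) (by simp [hs]) (by simp)
    (fun j hj => by simp [hs, show j ≠ 0 by omega])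
  set b : ℕ := ind (V (ea a)) with hb
  set s₁ := update s 3 (Prog.num A b) with hs₁
  obtain ⟨t₂, ht₂, r₂⟩ := Prog.run_clear 0 s₁
  obtain ⟨t₃, ht₃, r₃⟩ := Prog.run_drain (A := A) (i := 3) (j := 2) (by omega) (update s₁ 0 [])
  refine ⟨t₁ + (t₂ + t₃), ?_, ?_⟩
  · have h1 := ht₁.trans (hQ (ea a))
    have h2 : Ctx.size (ea a) = (ea a).length := by simp [Ctx.size]
    rw [h2] at h1
    have e1 : (s₁ 0).length = (ea a).length := by simp [hs₁, hs]
    have e2 : (update s₁ 0 [] 3).length ≤ 1 := by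
      simpa [hs₁] using ind_le_one _
    simp only [Polynomial.eval_add, Polynomial.eval_mul, Polynomial.eval_ofNat, Polynomial.eval_X,
      Polynomial.eval_one]
    omega
  · convert r₁.seq (r₂.seq r₃) using 1
    funext l
    have hV' : (if f a = true then [default] else []) = Prog.num A b := by
      by_cases h : f a = true
      · rw [if_pos h, hb, ind_of_true ((hf a).1 h)]; rfl
      · rw [if_neg h, hb, ind_of_false fun h' => h ((hf a).2 h')]; rfl
    by_cases hl : l = 2
    · subst hl; simp [hs₁, hs, hV']
    · by_cases hl' : l = 3
      · subst hl'; simp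
      · by_cases hl'' : l = 0
        · subst hl''; simp
        · simp [hs₁, hs, hl, hl', hl'']

end TemporalLearning

/-! ### Parsing an encoded input in polynomial time. -/

namespace TemporalLearning

/-! ### Bounded search -/

/-- The least number with property `p`, or `b` if there is none below `b`. -/
noncomputable def first (b : ℕ) (p : ℕ → Prop) : ℕ :=
  ∑ i ∈ Finset.range b, ind (∀ j < i + 1, ¬ p j)

/-- The summand at `i` is one exactly when `i < n`, so the sum counts up to `n`. -/
theorem first_eq {b n : ℕ} {p : ℕ → Prop} (hn : n ≤ b) (h : ∀ j < n, ¬ p j) (hp : p n) :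
    first b p = n := by
  have : ∀ i ∈ Finset.range b, ind (∀ j < i + 1, ¬ p j) = if i < n then 1 else 0 := by
    intro i _
    by_cases hi : i < n
    · rw [if_pos hi, ind_of_true fun j hj => h j (by omega)]
    · rw [if_neg hi, ind_of_false fun h' => h' n (by omega) hp]
  rw [first, Finset.sum_congr rfl this, ← Finset.sum_filter]
  have hf : (Finset.range b).filter (· < n) = Finset.range n := by
    ext i; simp; omega
  simp [hf]

theorem PT.first {A α : Type} [Inhabited A] [Ctx A α] {b : α → ℕ} {p : α → ℕ → Prop} (hb : PT b)
    (hp : PTP fun c : α × ℕ => p c.1 c.2) : PT fun a => first (b a) (p a) := by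
  refine PT.sum (g := fun a i => ind (∀ j < i + 1, ¬ p a j)) hb ?_
  refine PTP.all (r := fun (c : α × ℕ) j => ¬ p c.1 j) var₀.succ (PTP.not ?_)
  exact PT.under hp

/-! ### Reading encoded objects at a position of a word -/

section Parse

variable {Δ : Type}

instance : Inhabited (Γ' ⊕ Δ) := ⟨Sum.inl default⟩

/-- The symbol at position `i` is `γ`. -/
def ChAt (w : List (Γ' ⊕ Δ)) (i : ℕ) (γ : Γ') : Prop := w[i]? = some (Sum.inl γ)

/-- The word `l` occurs at position `i`. -/
def At (w : List (Γ' ⊕ Δ)) : ℕ → List Γ' → Prop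
  | _, [] => True
  | i, a :: l => ChAt w i a ∧ At w (i + 1) l

theorem at_append {w : List (Γ' ⊕ Δ)} {i : ℕ} {l₁ l₂ : List Γ'} :
    At w i (l₁ ++ l₂) ↔ At w i l₁ ∧ At w (i + l₁.length) l₂ := by
  induction l₁ generalizing i with
  | nil => simp [At]
  | cons a l ih => simp [At, ih, and_assoc, Nat.add_assoc, Nat.add_comm 1]

theorem At.le_length {w : List (Γ' ⊕ Δ)} {i : ℕ} {l : List Γ'} (h : At w i l) (hl : l ≠ []) :
    i + l.length ≤ w.length := by
  induction l generalizing i with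
  | nil => exact absurd rfl hl
  | cons a l ih =>
    have h1 : i < w.length := by
      have := h.1
      unfold ChAt at this
      exact (List.getElem?_eq_some_iff.1 this).1
    rcases l with _ | ⟨b, l⟩
    · simpa using h1
    · have := ih h.2 (by simp)
      simp at this ⊢
      omega

theorem at_of_append (l : List Γ') (u v : List (Γ' ⊕ Δ)) :
    At (u ++ (l.map Sum.inl ++ v)) u.length l := by
  induction l generalizing u with
  | nil => trivial
  | cons a l ih =>
    refine ⟨by simp [ChAt], ?_⟩
    have := ih (u ++ [Sum.inl a])
    simpa using this

/-- At an occurrence of the word `e`, the function `skip` gives the position after it; the word `e`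
does not start with a closing bracket. -/
structure Skips (Δ : Type) (skip : List (Γ' ⊕ Δ) → ℕ → ℕ) (e : List Γ') : Prop where
  ne_nil : e ≠ []
  head_ne : e.head? ≠ some Γ'.ket
  eq : ∀ w i, At w i e → skip w i = i + e.length

theorem At.not_ket {w : List (Γ' ⊕ Δ)} {i : ℕ} {l : List Γ'} (h : At w i l) (hl : l ≠ [])
    (hk : l.head? ≠ some Γ'.ket) : ¬ ChAt w i Γ'.ket := by
  rcases l with _ | ⟨a, l⟩
  · exact absurd rfl hl
  · have := h.1
    unfold ChAt at *
    rw [this]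
    simpa using hk

theorem Skips.append {s₁ s₂ : List (Γ' ⊕ Δ) → ℕ → ℕ} {e₁ e₂ : List Γ'} (h₁ : Skips Δ s₁ e₁)
    (h₂ : Skips Δ s₂ e₂) : Skips Δ (fun w i => s₂ w (s₁ w i)) (e₁ ++ e₂) where
  ne_nil := by simp [h₁.ne_nil]
  head_ne := by
    have := h₁.ne_nil
    have := h₁.head_ne
    rcases e₁ with _ | ⟨a, l⟩
    · contradiction
    · simpa using this
  eq w i h := by
    rw [at_append] at h
    rw [h₁.eq w i h.1, h₂.eq w _ h.2, List.length_append, Nat.add_assoc]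

theorem Skips.split {s : List (Γ' ⊕ Δ) → ℕ → ℕ} {e₁ e₂ : List Γ'} (h : Skips Δ s e₁)
    {w : List (Γ' ⊕ Δ)} {i : ℕ} (h' : At w i (e₁ ++ e₂)) : At w i e₁ ∧ At w (s w i) e₂ := by
  rw [at_append] at h'
  rw [h.eq w i h'.1]
  exact h'

/-- The position after one symbol. -/
def skipOne (_ : List (Γ' ⊕ Δ)) (i : ℕ) : ℕ := i + 1

theorem skips_bit (b : Bool) : Skips Δ skipOne [Γ'.bit b] := ⟨by simp, by simp, fun _ _ _ => rfl⟩

/-- The number written at position `i`. -/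
noncomputable def numAt (w : List (Γ' ⊕ Δ)) (i : ℕ) : ℕ :=
  first w.length fun j => ¬ ChAt w (i + j) (Γ'.bit true)

/-- The position after a number. -/
noncomputable def skipNat (w : List (Γ' ⊕ Δ)) (i : ℕ) : ℕ := i + numAt w i + 1

theorem encNat_ne_nil (n : ℕ) : encNat n ≠ [] := by simp [encNat]

@[simp] theorem length_encNat (n : ℕ) : (encNat n).length = n + 1 := by simp [encNat]

theorem at_replicate {w : List (Γ' ⊕ Δ)} {i n : ℕ} {γ : Γ'} (h : At w i (List.replicate n γ)) :
    ∀ j < n, ChAt w (i + j) γ := by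
  induction n generalizing i with
  | zero => simp
  | succ n ih =>
    intro j hj
    rcases j with _ | j
    · exact h.1
    · have := ih h.2 j (by omega)
      rwa [Nat.add_assoc, Nat.add_comm 1 j] at this

theorem numAt_eq {w : List (Γ' ⊕ Δ)} {i n : ℕ} (h : At w i (encNat n)) : numAt w i = n := by
  have hl := h.le_length (encNat_ne_nil n)
  rw [length_encNat] at hl
  unfold encNat at h
  rw [at_append, List.length_replicate] at h
  refine first_eq (by omega) (fun j hj => not_not.2 (at_replicate h.1 j hj)) ?_
  have := h.2.1
  unfold ChAt at *
  rw [this]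
  simp

theorem skips_nat (n : ℕ) : Skips Δ skipNat (encNat n) where
  ne_nil := encNat_ne_nil n
  head_ne := by rcases n with _ | n <;> simp [encNat, List.replicate_succ]
  eq w i h := by rw [skipNat, numAt_eq h, length_encNat, Nat.add_assoc]

/-- The position of the `j`-th item of the list at position `i`. -/
def nthAt (skip : List (Γ' ⊕ Δ) → ℕ → ℕ) (w : List (Γ' ⊕ Δ)) (i j : ℕ) : ℕ :=
  (fun x => min (skip w x) w.length)^[j] (i + 1)

/-- The length of the list at position `i`. -/
noncomputable def countAt (skip : List (Γ' ⊕ Δ) → ℕ → ℕ) (w : List (Γ' ⊕ Δ)) (i : ℕ) : ℕ :=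
  first w.length fun j => ChAt w (nthAt skip w i j) Γ'.ket

/-- The position after a list. -/
noncomputable def skipList (skip : List (Γ' ⊕ Δ) → ℕ → ℕ) (w : List (Γ' ⊕ Δ)) (i : ℕ) : ℕ :=
  nthAt skip w i (countAt skip w i) + 1

section List

variable {α : Type} {e : α → List Γ'} {l : List α} {skip : List (Γ' ⊕ Δ) → ℕ → ℕ}
  {w : List (Γ' ⊕ Δ)} {i : ℕ}

theorem length_encList : (encList e l).length = (l.flatMap e).length + 2 := by
  simp [encList]

theorem at_encList_take (h : At w i (encList e l)) (j : ℕ) :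
    At w (i + 1 + ((l.take j).flatMap e).length) ((l.drop j).flatMap e ++ [Γ'.ket]) := by
  rw [encList, List.append_assoc, at_append] at h
  have h2 := h.2
  rw [← List.take_append_drop j l, List.flatMap_append, List.append_assoc, at_append] at h2
  exact h2.2

/-- The truncation in `nthAt` is there to keep the iterates bounded on arbitrary words. On a
correctly encoded list it has no effect, because every item ends within the word. -/
theorem nthAt_eq (hs : ∀ x ∈ l, Skips Δ skip (e x)) (h : At w i (encList e l)) {j : ℕ}
    (hj : j ≤ l.length) : nthAt skip w i j = i + 1 + ((l.take j).flatMap e).length := by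
  induction j with
  | zero => simp [nthAt]
  | succ j ih =>
    have ih := ih (by omega)
    have h1 := at_encList_take h j
    rw [List.drop_eq_getElem_cons hj, List.flatMap_cons, List.append_assoc, at_append] at h1
    have hx := hs l[j] (List.getElem_mem _)
    have hlen := h1.1.le_length hx.ne_nil
    unfold nthAt at ih ⊢
    rw [Function.iterate_succ_apply', ih, hx.eq w _ h1.1, min_eq_left hlen,
      List.take_succ_eq_append_getElem hj, List.flatMap_append, List.length_append,
      List.flatMap_singleton]
    omega

theorem nthAt_at (hs : ∀ x ∈ l, Skips Δ skip (e x)) (h : At w i (encList e l)) {j : ℕ}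
    (hj : j < l.length) : At w (nthAt skip w i j) (e l[j]) := by
  have h1 := at_encList_take h j
  rw [List.drop_eq_getElem_cons hj, List.flatMap_cons, List.append_assoc, at_append] at h1
  rw [nthAt_eq hs h hj.le]
  exact h1.1

theorem length_le_flatMap (hs : ∀ x ∈ l, e x ≠ []) : l.length ≤ (l.flatMap e).length := by
  induction l with
  | nil => simp
  | cons a l ih =>
    have h1 := ih fun x hx => hs x (List.mem_cons_of_mem _ hx)
    have h2 := List.length_pos_iff.2 (hs a List.mem_cons_self)
    simp only [List.flatMap_cons, List.length_append, List.length_cons]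
    omega

theorem encList_ne_nil : encList e l ≠ [] := by simp [encList]

/-- No item starts with a closing bracket, so the first item position that shows one is the end of
this list. Brackets nested inside items are never inspected. -/
theorem countAt_eq (hs : ∀ x ∈ l, Skips Δ skip (e x)) (h : At w i (encList e l)) :
    countAt skip w i = l.length := by
  refine first_eq ?_ (fun j hj => ?_) ?_
  · have h1 := h.le_length encList_ne_nil
    rw [length_encList] at h1
    have h2 := length_le_flatMap (e := e) fun x hx => (hs x hx).ne_nil
    omega
  · have hx := hs l[j] (List.getElem_mem _)
    exact (nthAt_at hs h hj).not_ket hx.ne_nil hx.head_ne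
  · have h1 := at_encList_take h l.length
    rw [nthAt_eq hs h le_rfl]
    simp only [List.drop_length, List.flatMap_nil, List.nil_append] at h1
    exact h1.1

theorem skips_list (hs : ∀ x ∈ l, Skips Δ skip (e x)) : Skips Δ (skipList skip) (encList e l) where
  ne_nil := encList_ne_nil
  head_ne := by simp [encList]
  eq w i h := by
    rw [skipList, countAt_eq hs h, nthAt_eq hs h le_rfl, length_encList, List.take_length]
    omega

end List

theorem skips_subset {m : ℕ} (s : Finset (Fin m)) : Skips Δ (skipList skipOne) (encSubset s) :=
  skips_list fun _ _ => skips_bit _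

/-- The `q`-th bit of the bit string at position `i`. -/
def BitAt (w : List (Γ' ⊕ Δ)) (i q : ℕ) : Prop := ChAt w (nthAt skipOne w i q) (Γ'.bit true)

theorem bitAt_iff {m : ℕ} {s : Finset (Fin m)} {w : List (Γ' ⊕ Δ)} {i : ℕ}
    (h : At w i (encSubset s)) (q : Fin m) : BitAt w i q ↔ q ∈ s := by
  have := (nthAt_at (skip := skipOne) (fun _ _ => skips_bit _) h (j := q) (by simp)).1
  unfold BitAt
  unfold ChAt at *
  rw [this]
  simp

theorem nthAt_finRange {n : ℕ} {e : Fin n → List Γ'} {skip : List (Γ' ⊕ Δ) → ℕ → ℕ}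
    {w : List (Γ' ⊕ Δ)} {i : ℕ} (hs : ∀ x, Skips Δ skip (e x))
    (h : At w i (encList e (List.finRange n))) (q : Fin n) : At w (nthAt skip w i q) (e q) := by
  simpa using nthAt_at (fun x _ => hs x) h (j := q) (by simp)

variable {α : Type} [Ctx (Γ' ⊕ Δ) α] {f g : α → ℕ} {skip : List (Γ' ⊕ Δ) → ℕ → ℕ}

theorem PTP.chAt (γ : Γ') (hf : PT f) : PTP fun a => ChAt (Ctx.word a) (f a) γ :=
  PTP.chr (fun o => o = some (Sum.inl γ)) hf

theorem PT.numAt (hf : PT f) : PT fun a => numAt (Ctx.word a) (f a) :=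
  PT.first (p := fun a j => ¬ ChAt (Ctx.word a) (f a + j) (Γ'.bit true)) wordLength
    (PTP.not (PTP.chAt _ (hf.weaken.add var₀)))

/-- `skip` is computable in polynomial time. -/
def PTSkip (skip : List (Γ' ⊕ Δ) → ℕ → ℕ) : Prop :=
  PT fun c : List (Γ' ⊕ Δ) × ℕ => skip c.1 c.2

theorem PTSkip.pt (h : PTSkip skip) (hf : PT f) : PT fun a => skip (Ctx.word a) (f a) :=
  PT.comp₁ h hf

theorem PTSkip.one : PTSkip (skipOne (Δ := Δ)) := PT.var₀.succ

theorem PTSkip.nat : PTSkip (skipNat (Δ := Δ)) :=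
  (PT.var₀.add (PT.numAt PT.var₀)).succ

theorem PT.nthAt (h : PTSkip skip) (hf : PT f) (hg : PT g) :
    PT fun a => nthAt skip (Ctx.word a) (f a) (g a) :=
  PT.iterate (f := fun w x => min (skip w x) w.length)
    ((PT.ite (PTP.le h PT.wordLength) h PT.wordLength :
      PT fun c : List (Γ' ⊕ Δ) × ℕ => if skip c.1 c.2 ≤ c.1.length then skip c.1 c.2
        else c.1.length)) (fun _ _ => min_le_right _ _) hf.succ hg

theorem PT.countAt (h : PTSkip skip) (hf : PT f) : PT fun a => countAt skip (Ctx.word a) (f a) :=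
  PT.first (p := fun a j => ChAt (Ctx.word a) (TemporalLearning.nthAt skip (Ctx.word a) (f a) j)
    Γ'.ket) wordLength (PTP.chAt _ (PT.nthAt h hf.weaken var₀))

theorem PTSkip.list (h : PTSkip skip) : PTSkip (skipList skip) :=
  (PT.nthAt h PT.var₀ (PT.countAt h PT.var₀)).succ

theorem PTP.bitAt (hf : PT f) (hg : PT g) : PTP fun a => BitAt (Ctx.word a) (f a) (g a) :=
  PTP.chAt _ (PT.nthAt PTSkip.one hf hg)

end Parse

end TemporalLearning

/-! ### Model checking by fixed points of the one-step predecessor. -/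

namespace TemporalLearning

/-! ### Path formulas -/

/-- Weak until. -/
def weakSem (f g : ℕ → Prop) : Prop := untilSem f g ∨ ∀ i, f i

theorem untilSem_true {f : ℕ → Prop} : untilSem (fun _ => True) f ↔ ∃ i, f i := by
  simp [untilSem]

theorem weakSem_false {f : ℕ → Prop} : weakSem f (fun _ => False) ↔ ∀ i, f i := by
  simp [weakSem, untilSem]

theorem exists_first {p : ℕ → Prop} (h : ∃ i, p i) : ∃ i, p i ∧ ∀ j < i, ¬ p j := by
  classical
  exact ⟨Nat.find h, Nat.find_spec h, fun j hj => Nat.find_min h hj⟩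

/-- Let `i` be the first position with `f`. If `g` failed at some `j ≤ i`, release would provide `f`
before `j`, against the choice of `i`. -/
theorem mighty_iff {f g : ℕ → Prop} :
    releaseSem f g ∧ (∃ i, f i) ↔ untilSem g fun i => f i ∧ g i := by
  unfold releaseSem untilSem
  push Not
  constructor
  · rintro ⟨h, hf⟩
    obtain ⟨i, hi, hmin⟩ := exists_first hf
    have hg : ∀ j ≤ i, g j := by
      intro j hj
      by_contra hgj
      obtain ⟨l, hl, hfl⟩ := h j hgj
      exact hmin l (by omega) hfl
    exact ⟨i, ⟨hi, hg i le_rfl⟩, fun j hj => hg j hj.le⟩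
  · rintro ⟨i, ⟨hf, hg⟩, hlt⟩
    refine ⟨fun j hj => ⟨i, ?_, hf⟩, i, hf⟩
    by_contra hij
    rcases Nat.lt_or_ge j i with h | h
    · exact hj (hlt j h)
    · exact hj ((show j = i by omega) ▸ hg)

/-- If `f` holds somewhere, this is the case of mighty release; otherwise both sides say that `g`
holds always. -/
theorem release_iff {f g : ℕ → Prop} : releaseSem f g ↔ weakSem g fun i => f i ∧ g i := by
  by_cases hf : ∃ i, f i
  · constructor
    · exact fun h => Or.inl (mighty_iff.1 ⟨h, hf⟩)
    · rintro (h | h)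
      · exact (mighty_iff.2 h).1
      · rintro ⟨i, hi, -⟩
        exact hi (h i)
  · have h1 : releaseSem f g ↔ ∀ i, g i := by
      unfold releaseSem untilSem
      push Not at hf ⊢
      constructor
      · intro h i
        by_contra hi
        obtain ⟨j, -, hj⟩ := h i hi
        exact hf j hj
      · exact fun h i hi => absurd (h i) hi
    rw [h1]
    constructor
    · exact Or.inr
    · rintro (⟨i, hi, -⟩ | h)
      · exact absurd ⟨i, hi.1⟩ hf
      · exact h

theorem untilSem_succ {f g : ℕ → Prop} (h : f 0) (h' : untilSem (fun i => f (i + 1))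
    (fun i => g (i + 1))) : untilSem f g := by
  obtain ⟨i, hi, hlt⟩ := h'
  refine ⟨i + 1, hi, fun j hj => ?_⟩
  rcases j with _ | j
  · exact h
  · exact hlt j (by omega)

theorem weakSem_tail {f g : ℕ → Prop} (h0 : ¬ g 0) (h : weakSem f g) :
    f 0 ∧ weakSem (fun i => f (i + 1)) (fun i => g (i + 1)) := by
  rcases h with ⟨i, hi, hlt⟩ | h
  · rcases i with _ | i
    · exact absurd hi h0
    · exact ⟨hlt 0 (by omega), Or.inl ⟨i, hi, fun j hj => hlt (j + 1) (by omega)⟩⟩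
  · exact ⟨h 0, Or.inr fun i => h (i + 1)⟩

/-! ### Strategies and fixed points -/

namespace CGS

variable {k : ℕ} {P : Type} (C : CGS k P)

/-- The coalition `A` can force the next state into `S`. -/
def pre (A : Finset (Fin k)) (S : C.Q → Prop) (q : C.Q) : Prop :=
  ∃ α : (a : Fin k) → a ∈ A → Fin (C.d q a), ∀ q' ∈ C.succ A q α, S q'

variable {C}

theorem pre_mono {A : Finset (Fin k)} {S T : C.Q → Prop} (h : ∀ q, S q → T q) {q : C.Q}
    (hq : C.pre A S q) : C.pre A T q :=
  let ⟨α, hα⟩ := hq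
  ⟨α, fun q' hq' => h q' (hα q' hq')⟩

theorem succ_nonempty (A : Finset (Fin k)) (q : C.Q) (α : (a : Fin k) → a ∈ A → Fin (C.d q a)) :
    (C.succ A q α).Nonempty := by
  classical
  exact ⟨_, fun a => if h : a ∈ A then α a h else ⟨0, C.d_pos q a⟩,
    fun a ha => by simp [ha], rfl⟩

/-- The path that results from a choice of successors, with its history. -/
def build (next : List C.Q → C.Q → C.Q) (q : C.Q) : ℕ → List C.Q × C.Q
  | 0 => ([], q)
  | i + 1 => ((build next q i).1 ++ [(build next q i).2],
      next (build next q i).1 (build next q i).2)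

theorem build_fst (next : List C.Q → C.Q → C.Q) (q : C.Q) (i : ℕ) :
    (build next q i).1 = (List.range i).map fun j => (build next q j).2 := by
  induction i with
  | zero => rfl
  | succ i ih => rw [List.range_succ, List.map_append, ← ih]; rfl

/-- Plays the role of the opponents: a rule that picks, for each history, a successor allowed by the
strategies generates an outcome. -/
theorem exists_out {A : Finset (Fin k)} (s : (a : Fin k) → a ∈ A → C.Strategy a) (q : C.Q)
    (next : List C.Q → C.Q → C.Q)
    (hn : ∀ h x, next h x ∈ C.succ A x fun a ha => s a ha h x) :
    ∃ ρ ∈ C.out A s q, ∀ i, ρ (i + 1) = next ((List.range i).map ρ) (ρ i) := by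
  have key : ∀ i, (build next q (i + 1)).2 =
      next ((List.range i).map fun j => (build next q j).2) (build next q i).2 := by
    intro i
    rw [← build_fst]
    rfl
  refine ⟨fun i => (build next q i).2, ⟨rfl, fun i => ?_⟩, key⟩
  beta_reduce
  rw [key]
  exact hn _ _

theorem enforces_next {A : Finset (Fin k)} {S : C.Q → Prop} {q : C.Q} :
    C.Enforces A q {ρ | S (ρ 1)} ↔ C.pre A S q := by
  classical
  constructor
  · rintro ⟨s, hs⟩
    refine ⟨fun a ha => s a ha [] q, fun q' hq' => ?_⟩
    obtain ⟨ρ, hρ, hnext⟩ := exists_out s q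
      -- The opponents move to the prescribed `q'` in the first step and anywhere afterwards.
      (fun h x => if h = [] ∧ x = q then q' else (succ_nonempty A x fun a ha => s a ha h x).some)
      (fun h x => by
        split_ifs with hx
        · obtain ⟨rfl, rfl⟩ := hx
          exact hq'
        · exact (succ_nonempty A x fun a ha => s a ha h x).some_mem)
    have h1 := hnext 0
    rw [hρ.1] at h1
    simp only [List.range_zero, List.map_nil, true_and, if_true, zero_add] at h1
    have h2 : S (ρ 1) := hs ρ hρ
    rwa [h1] at h2
  · rintro ⟨α, hα⟩
    refine ⟨fun a ha _ x => if h : x = q then h ▸ α a ha else ⟨0, C.d_pos x a⟩, fun ρ hρ => ?_⟩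
    have h0 := hρ.1
    subst h0
    have := hρ.2 0
    simp only [dite_true] at this
    exact hα _ this

theorem out_tail {A : Finset (Fin k)} {s : (a : Fin k) → a ∈ A → C.Strategy a} {q : C.Q}
    {ρ : ℕ → C.Q} (hρ : ρ ∈ C.out A s q) :
    (fun i => ρ (i + 1)) ∈ C.out A (fun a ha h x => s a ha (q :: h) x) (ρ 1) := by
  refine ⟨rfl, fun i => ?_⟩
  have := hρ.2 (i + 1)
  rw [List.range_succ_eq_map, List.map_cons, hρ.1, List.map_map] at this
  exact this

theorem out_cons {A : Finset (Fin k)} {s : (a : Fin k) → a ∈ A → C.Strategy a} {q q' : C.Q}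
    (hq' : q' ∈ C.succ A q fun a ha => s a ha [] q) {ρ : ℕ → C.Q}
    (hρ : ρ ∈ C.out A (fun a ha h x => s a ha (q :: h) x) q') :
    (fun i => Nat.casesOn i q ρ) ∈ C.out A s q := by
  refine ⟨rfl, fun i => ?_⟩
  rcases i with _ | i
  · have : ρ 0 = q' := hρ.1
    simpa [this] using hq'
  · have := hρ.2 i
    rw [List.range_succ_eq_map, List.map_cons, List.map_map]
    exact this

/-- The coalition plays the one-step action and then switches to a winning strategy for whichever
successor was reached; the history tells which one it was. -/
theorem enforces_until_of_pre {A : Finset (Fin k)} {S T : C.Q → Prop} {q : C.Q} (hS : S q)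
    (h : C.pre A (fun q' => C.Enforces A q' {ρ | untilSem (fun i => S (ρ i)) fun i => T (ρ i)}) q) :
    C.Enforces A q {ρ | untilSem (fun i => S (ρ i)) fun i => T (ρ i)} := by
  classical
  obtain ⟨α, hα⟩ := h
  choose s hs using hα
  let dflt : (a : Fin k) → a ∈ A → C.Strategy a := fun a _ _ x => ⟨0, C.d_pos x a⟩
  let r : C.Q → (a : Fin k) → a ∈ A → C.Strategy a := fun q' =>
    if h : q' ∈ C.succ A q α then s q' h else dflt
  refine ⟨fun a ha h x => match h with
    | [] => if h : x = q then h ▸ α a ha else ⟨0, C.d_pos x a⟩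
    -- The second state of the play is the head of `h' ++ [x]`. The strategy chosen for it sees the
    -- history without the initial state.
    | _ :: h' => r ((h' ++ [x]).head (by simp)) a ha h' x, fun ρ hρ => ?_⟩
  have h0 := hρ.1
  subst h0
  have h1 : ρ 1 ∈ C.succ A (ρ 0) α := by
    have := hρ.2 0
    simpa using this
  have h2 : (fun i => ρ (i + 1)) ∈ C.out A (r (ρ 1)) (ρ 1) := by
    refine ⟨rfl, fun i => ?_⟩
    have h3 := (out_tail hρ).2 i
    have h4 : ((List.range i).map (fun i => ρ (i + 1)) ++ [ρ (i + 1)]).head (by simp) = ρ 1 := by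
      rcases i with _ | i
      · rfl
      · simp [List.range_succ_eq_map]
    simp only [h4] at h3
    exact h3
  simp only [r, h1, dite_true] at h2
  exact untilSem_succ hS (hs _ h1 _ h2)

/-- Let `Z` be closed under the operator and miss `q`. At a state of `S` outside `Z` no action of
the coalition forces `Z`, so the opponents can stay outside as long as `S` holds; but `T` lies
inside `Z`, so the until fails. Conversely, the set of states where the until is enforced is itself
closed, so no rank function is needed. -/
theorem enforces_until {A : Finset (Fin k)} {S T : C.Q → Prop} {q : C.Q} :
    C.Enforces A q {ρ | untilSem (fun i => S (ρ i)) fun i => T (ρ i)} ↔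
      ∀ Z : C.Q → Prop, (∀ x, T x ∨ S x ∧ C.pre A Z x → Z x) → Z q := by
  classical
  constructor
  · rintro ⟨s, hs⟩ Z hZ
    by_contra hq
    have hex : ∀ (h : List C.Q) (x : C.Q), ∃ y ∈ C.succ A x fun a ha => s a ha h x,
        (S x ∧ ¬ Z x → ¬ Z y) := by
      intro h x
      by_cases hx : S x ∧ ¬ Z x
      · by_contra! hcon
        refine hx.2 (hZ x (Or.inr ⟨hx.1, fun a ha => s a ha h x, fun y hy => ?_⟩))
        exact (hcon y hy).2
      · obtain ⟨y, hy⟩ := succ_nonempty A x fun a ha => s a ha h x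
        exact ⟨y, hy, fun h => absurd h hx⟩
    choose next hn hn' using hex
    obtain ⟨ρ, hρ, hnext⟩ := exists_out s q next hn
    obtain ⟨i, hi, hlt⟩ := hs ρ hρ
    have : ∀ j ≤ i, ¬ Z (ρ j) := by
      intro j
      induction j with
      | zero => intro _; rwa [hρ.1]
      | succ j ih =>
        intro hj
        rw [hnext]
        exact hn' _ _ ⟨hlt j hj, ih (by omega)⟩
    exact this i le_rfl (hZ _ (Or.inl hi))
  · intro h
    refine h (fun x => C.Enforces A x {ρ | untilSem (fun i => S (ρ i)) fun i => T (ρ i)}) ?_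
    rintro x (hT | ⟨hS, hp⟩)
    · exact ⟨fun a _ _ x => ⟨0, C.d_pos x a⟩, fun ρ hρ =>
        ⟨0, by beta_reduce; rw [hρ.1]; exact hT, fun j hj => absurd hj (by omega)⟩⟩
    · exact enforces_until_of_pre hS hp

/-- The set of states where the weak until is enforced is a post-fixed point, by passing to residual
strategies. Conversely, a memoryless strategy that keeps the play inside `Z` until `T` is met
suffices. -/
theorem enforces_weak {A : Finset (Fin k)} {S T : C.Q → Prop} {q : C.Q} :
    C.Enforces A q {ρ | weakSem (fun i => S (ρ i)) fun i => T (ρ i)} ↔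
      ∃ Z : C.Q → Prop, (∀ x, Z x → T x ∨ S x ∧ C.pre A Z x) ∧ Z q := by
  classical
  constructor
  · intro h
    refine ⟨fun x => C.Enforces A x {ρ | weakSem (fun i => S (ρ i)) fun i => T (ρ i)}, ?_, h⟩
    rintro x ⟨s, hs⟩
    by_cases hT : T x
    · exact Or.inl hT
    · refine Or.inr ⟨?_, fun a ha => s a ha [] x, fun y hy => ?_⟩
      · obtain ⟨ρ, hρ, -⟩ := exists_out s x _
          (fun h y => (succ_nonempty A y fun a ha => s a ha h y).some_mem)
        have := (weakSem_tail (by rw [hρ.1]; exact hT) (hs ρ hρ)).1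
        rwa [hρ.1] at this
      · refine ⟨fun a ha h z => s a ha (x :: h) z, fun ρ hρ => ?_⟩
        exact (weakSem_tail hT (hs _ (out_cons hy hρ))).2
  · rintro ⟨Z, hZ, hq⟩
    have hex : ∀ x : C.Q, ∃ α : (a : Fin k) → a ∈ A → Fin (C.d x a),
        Z x → ¬ T x → ∀ y ∈ C.succ A x α, Z y := by
      intro x
      by_cases hx : Z x ∧ ¬ T x
      · obtain ⟨α, hα⟩ := ((hZ x hx.1).resolve_left hx.2).2
        exact ⟨α, fun _ _ => hα⟩
      · exact ⟨fun a _ => ⟨0, C.d_pos x a⟩, fun h h' => absurd ⟨h, h'⟩ hx⟩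
    choose α hα using hex
    refine ⟨fun a ha _ x => α x a ha, fun ρ hρ => ?_⟩
    have key : ∀ i, (∀ j < i, ¬ T (ρ j)) → Z (ρ i) := by
      intro i
      induction i with
      | zero => intro _; rwa [hρ.1]
      | succ i ih =>
        intro h
        exact hα (ρ i) (ih fun j hj => h j (by omega)) (h i (by omega)) _ (hρ.2 i)
    by_cases hT : ∃ i, T (ρ i)
    · obtain ⟨i, hi, hmin⟩ := exists_first hT
      refine Or.inl ⟨i, hi, fun j hj => ?_⟩
      exact ((hZ _ (key j fun l hl => hmin l (by omega))).resolve_left (hmin j hj)).1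
    · push Not at hT
      exact Or.inr fun i => ((hZ _ (key i fun j _ => hT j)).resolve_left (hT i)).1

end CGS

/-! ### Iteration on finite sets -/

section Iterate

variable {n : ℕ} {H : Set (Fin n) → Set (Fin n)}

/-- The iterates increase. As long as they are not stationary, each step adds an element, which can
happen at most `n` times in `Fin n`. -/
theorem iterate_bot_fixed (hH : Monotone H) : H (H^[n] ∅) = H^[n] ∅ := by
  have hsub : ∀ i, H^[i] ∅ ⊆ H^[i + 1] ∅ := by
    intro i
    induction i with
    | zero => exact Set.empty_subset _
    | succ i ih =>
      rw [Function.iterate_succ_apply', Function.iterate_succ_apply' (n := i + 1)]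
      exact hH ih
  have key : ∀ i, H^[i + 1] ∅ = H^[i] ∅ ∨ i < (H^[i + 1] ∅).ncard := by
    intro i
    induction i with
    | zero =>
      by_cases h : H^[0 + 1] ∅ = H^[0] ∅
      · exact Or.inl h
      · exact Or.inr ((Set.ncard_pos (Set.toFinite _)).2 (Set.nonempty_iff_ne_empty.2 h))
    | succ i ih =>
      rcases ih with ih | ih
      · refine Or.inl ?_
        rw [Function.iterate_succ_apply' (n := i + 1), ih, ← Function.iterate_succ_apply' H, ih]
      · by_cases h : H^[i + 1 + 1] ∅ = H^[i + 1] ∅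
        · exact Or.inl h
        · refine Or.inr ?_
          have := Set.ncard_lt_ncard ((hsub (i + 1)).ssubset_of_ne fun h' => h h'.symm)
            (Set.toFinite _)
          omega
  rcases key n with h | h
  · rwa [Function.iterate_succ_apply'] at h
  · have h2 : (H^[n + 1] ∅).ncard ≤ n := by
      simpa using Set.ncard_le_ncard (Set.subset_univ (H^[n + 1] ∅)) (Set.toFinite _)
    omega

theorem mem_iterate_bot (hH : Monotone H) {q : Fin n} :
    q ∈ H^[n] ∅ ↔ ∀ Z : Set (Fin n), H Z ⊆ Z → q ∈ Z := by
  constructor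
  · intro h Z hZ
    have : ∀ i, H^[i] ∅ ⊆ Z := by
      intro i
      induction i with
      | zero => exact Set.empty_subset _
      | succ i ih =>
        rw [Function.iterate_succ_apply']
        exact (hH ih).trans hZ
    exact this n h
  · exact fun h => h _ (iterate_bot_fixed hH).le

/-- The least fixed point statement for the dual operator, by complementation. -/
theorem mem_iterate_top (hH : Monotone H) {q : Fin n} :
    q ∈ H^[n] Set.univ ↔ ∃ Z : Set (Fin n), Z ⊆ H Z ∧ q ∈ Z := by
  have hH' : Monotone fun Z : Set (Fin n) => (H Zᶜ)ᶜ :=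
    fun Z W h => Set.compl_subset_compl.2 (hH (Set.compl_subset_compl.2 h))
  have hi : ∀ i, (fun Z : Set (Fin n) => (H Zᶜ)ᶜ)^[i] ∅ = (H^[i] Set.univ)ᶜ := by
    intro i
    induction i with
    | zero => simp
    | succ i ih => rw [Function.iterate_succ_apply', Function.iterate_succ_apply', ih, compl_compl]
  have := mem_iterate_bot hH' (q := q)
  rw [hi, Set.mem_compl_iff] at this
  rw [← not_iff_not, this]
  push Not
  constructor
  · intro h Z hZ hq
    exact h Zᶜ (by rw [compl_compl]; exact Set.compl_subset_compl.2 hZ) hq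
  · intro h Z hZ
    by_contra hq
    exact h Zᶜ (Set.compl_subset_comm.1 hZ) hq

end Iterate

/-! ### Evaluation of one operator by iteration -/

/-- The outermost operators of `ATL^k` formulas. -/
inductive NodeOp (k : ℕ)
  | prop
  | neg
  | lg (o : BinLg)
  | un (A : Finset (Fin k)) (o : UnTp)
  | tp (A : Finset (Fin k)) (o : BinTp)

namespace NodeOp

variable {k : ℕ}

/-- The formula with the given outermost operator. -/
def form {P : Type} (p : P) (φ ψ : ATL k P) : NodeOp k → ATL k P
  | prop => .prop p
  | neg => .neg φ
  | lg o => .lg o φ ψ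
  | un A o => .un A o φ
  | tp A o => .tp A o φ ψ

/-- The truth value at the start of the iteration. -/
def start : NodeOp k → Prop
  | un _ .G => True
  | tp _ .R => True
  | tp _ .W => True
  | _ => False

/-- One step of the iteration, from the truth values of the proposition and of the operands at a
state, and from the truth of "the coalition can force the left operand, or the current iterate, in
one step". -/
def step (lab φ ψ : Prop) (preφ preZ : Finset (Fin k) → Prop) : NodeOp k → Prop
  | prop => lab
  | neg => ¬ φ
  | lg o => o.eval φ ψ
  | un A .X => preφ A
  | un A .F => φ ∨ preZ A
  | un A .G => φ ∧ preZ A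
  | tp A .U => ψ ∨ (φ ∧ preZ A)
  | tp A .R => ψ ∧ (φ ∨ preZ A)
  | tp A .W => ψ ∨ (φ ∧ preZ A)
  | tp A .M => ψ ∧ (φ ∨ preZ A)

end NodeOp

namespace CGS

variable {k : ℕ} {P : Type} (C : CGS k P)

/-- The iterates for an operator. -/
def iter (op : NodeOp k) (lab φ ψ : C.Q → Prop) : ℕ → C.Q → Prop
  | 0 => fun _ => op.start
  | i + 1 => fun q => op.step (lab q) (φ q) (ψ q) (fun A => C.pre A φ q)
      fun A => C.pre A (iter op lab φ ψ i) q

variable {C}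

theorem iterate_until {A : Finset (Fin k)} {S T : C.Q → Prop} {Z : ℕ → C.Q → Prop}
    (h0 : ∀ q, ¬ Z 0 q) (hs : ∀ i q, Z (i + 1) q ↔ T q ∨ S q ∧ C.pre A (Z i) q) (q : C.Q) :
    Z C.numStates q ↔ C.Enforces A q {ρ | untilSem (fun i => S (ρ i)) fun i => T (ρ i)} := by
  let H : Set C.Q → Set C.Q := fun Z => {q | T q ∨ S q ∧ C.pre A (· ∈ Z) q}
  have hH : Monotone H := fun Z W h q hq =>
    hq.imp_right fun hq => ⟨hq.1, pre_mono (fun _ hx => h hx) hq.2⟩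
  have hi : ∀ i, H^[i] ∅ = {q | Z i q} := by
    intro i
    induction i with
    | zero => ext q; simp [h0]
    | succ i ih =>
      rw [Function.iterate_succ_apply', ih]
      ext q
      simp [H, hs]
  have := mem_iterate_bot hH (q := q)
  rw [hi] at this
  rw [enforces_until]
  exact this

theorem iterate_weak {A : Finset (Fin k)} {S T : C.Q → Prop} {Z : ℕ → C.Q → Prop}
    (h0 : ∀ q, Z 0 q) (hs : ∀ i q, Z (i + 1) q ↔ T q ∨ S q ∧ C.pre A (Z i) q) (q : C.Q) :
    Z C.numStates q ↔ C.Enforces A q {ρ | weakSem (fun i => S (ρ i)) fun i => T (ρ i)} := by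
  let H : Set C.Q → Set C.Q := fun Z => {q | T q ∨ S q ∧ C.pre A (· ∈ Z) q}
  have hH : Monotone H := fun Z W h q hq =>
    hq.imp_right fun hq => ⟨hq.1, pre_mono (fun _ hx => h hx) hq.2⟩
  have hi : ∀ i, H^[i] Set.univ = {q | Z i q} := by
    intro i
    induction i with
    | zero => ext q; simp [h0]
    | succ i ih =>
      rw [Function.iterate_succ_apply', ih]
      ext q
      simp [H, hs]
  have := mem_iterate_top hH (q := q)
  rw [hi] at this
  rw [enforces_weak]
  exact this

theorem iter_of_pos (op : NodeOp k) (lab φ ψ : C.Q → Prop) {i : ℕ} (hi : 0 < i) (q : C.Q) :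
    C.iter op lab φ ψ i q ↔ op.step (lab q) (φ q) (ψ q) (fun A => C.pre A φ q)
      fun A => C.pre A (C.iter op lab φ ψ (i - 1)) q := by
  obtain ⟨i, rfl⟩ := Nat.exists_eq_succ_of_ne_zero hi.ne'
  rfl

/-- For operators without a fixed point the step ignores the iterate, so any positive number of
steps is right, and a structure with a state `q` has one. The others are an until iterated from
false or a weak until iterated from true. -/
theorem iter_numStates (op : NodeOp k) (p : P) (φ ψ : ATL k P) (q : C.Q) :
    C.iter op (fun q => p ∈ C.label q) (φ.SatAt C.label C.Enforces) (ψ.SatAt C.label C.Enforces)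
      C.numStates q ↔ (op.form p φ ψ).SatAt C.label C.Enforces q := by
  have hpos : 0 < C.numStates := q.pos
  cases op with
  | prop => exact iter_of_pos _ _ _ _ hpos q
  | neg => exact iter_of_pos _ _ _ _ hpos q
  | lg o => exact iter_of_pos _ _ _ _ hpos q
  | un A o =>
    cases o with
    | X => exact (iter_of_pos _ _ _ _ hpos q).trans enforces_next.symm
    | F =>
      refine (iterate_until (A := A) (S := fun _ => True) (T := φ.SatAt C.label C.Enforces)
        (fun _ h => h) (fun i q => ?_) q).trans ?_
      · simp only [true_and]; rfl
      · simp only [untilSem_true]; rfl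
    | G =>
      refine (iterate_weak (A := A) (S := φ.SatAt C.label C.Enforces) (T := fun _ => False)
        (fun _ => trivial) (fun i q => ?_) q).trans ?_
      · simp only [false_or]; rfl
      · simp only [weakSem_false]; rfl
  | tp A o =>
    cases o with
    | U =>
      exact iterate_until (A := A) (fun _ h => h) (fun i q => Iff.rfl) q
    | R =>
      refine (iterate_weak (A := A) (S := ψ.SatAt C.label C.Enforces)
        (T := fun q => φ.SatAt C.label C.Enforces q ∧ ψ.SatAt C.label C.Enforces q)
        (fun _ => trivial) (fun i q => ?_) q).trans ?_
      · simp only [iter, NodeOp.step]; tauto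
      · simp only [← release_iff]; rfl
    | W =>
      exact iterate_weak (A := A) (fun _ => trivial) (fun i q => Iff.rfl) q
    | M =>
      refine (iterate_until (A := A) (S := ψ.SatAt C.label C.Enforces)
        (T := fun q => φ.SatAt C.label C.Enforces q ∧ ψ.SatAt C.label C.Enforces q)
        (fun _ h => h) (fun i q => ?_) q).trans ?_
      · simp only [iter, NodeOp.step]; tauto
      · simp only [← mighty_iff]; rfl

end CGS

end TemporalLearning

/-! ### Formulas as graphs, and tables of truth values. -/

namespace TemporalLearning

/-! ### Sub-formulas -/

namespace ATL

variable {k : ℕ} {P : Type} [DecidableEq P]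

theorem self_mem_subF (φ : ATL k P) : φ ∈ φ.subF := by
  cases φ <;> simp [subF]

theorem subF_subset {φ ψ : ATL k P} (h : ψ ∈ φ.subF) : ψ.subF ⊆ φ.subF := by
  induction φ with
  | prop p =>
    simp only [subF, Finset.mem_singleton] at h
    rw [h]
  | neg φ ih | un A o φ ih =>
    simp only [subF, Finset.mem_insert] at h
    rcases h with rfl | h
    · rfl
    · exact (ih h).trans (Finset.subset_insert _ _)
  | lg o φ χ ih₁ ih₂ | tp A o φ χ ih₁ ih₂ =>
    simp only [subF, Finset.mem_insert, Finset.mem_union] at h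
    rcases h with rfl | h | h
    · rfl
    · exact ((ih₁ h).trans Finset.subset_union_left).trans (Finset.subset_insert _ _)
    · exact ((ih₂ h).trans Finset.subset_union_right).trans (Finset.subset_insert _ _)

theorem InFragment.of_mem_subF {Ut : Set UnOp} {Bt : Set BinTp} {Bl : Set BinLg} {φ ψ : ATL k P}
    (h : φ.InFragment Ut Bt Bl) (hψ : ψ ∈ φ.subF) : ψ.InFragment Ut Bt Bl := by
  induction φ with
  | prop p =>
    simp only [subF, Finset.mem_singleton] at hψ
    rwa [hψ]
  | neg φ ih | un A o φ ih =>
    simp only [subF, Finset.mem_insert] at hψ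
    rcases hψ with rfl | hψ
    · exact h
    · exact ih h.2 hψ
  | lg o φ χ ih₁ ih₂ | tp A o φ χ ih₁ ih₂ =>
    simp only [subF, Finset.mem_insert, Finset.mem_union] at hψ
    rcases hψ with rfl | hψ | hψ
    · exact h
    · exact ih₁ h.2.1 hψ
    · exact ih₂ h.2.2 hψ

/-- The outermost operator. -/
def op : ATL k P → NodeOp k
  | prop _ => .prop
  | neg _ => .neg
  | lg o _ _ => .lg o
  | un A o _ => .un A o
  | tp A o _ _ => .tp A o

/-- The left operand, if there is one. -/
def left : ATL k P → ATL k P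
  | prop p => prop p
  | neg φ => φ
  | lg _ φ _ => φ
  | un _ _ φ => φ
  | tp _ _ φ _ => φ

/-- The right operand, or the only one. -/
def right : ATL k P → ATL k P
  | prop p => prop p
  | neg φ => φ
  | lg _ _ φ => φ
  | un _ _ φ => φ
  | tp _ _ _ φ => φ

end ATL

namespace NodeOp

variable {k : ℕ}

/-- The operator is a proposition. -/
def IsProp : NodeOp k → Prop
  | prop => True
  | _ => False

/-- At other nodes the left pointer is no index of a proposition, so the label computed from it is
meaningless. It is also harmless, since only propositions look at it. -/
theorem step_congr {op : NodeOp k} (h : ¬ op.IsProp) (lab lab' φ ψ : Prop)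
    (preφ preZ : Finset (Fin k) → Prop) :
    op.step lab φ ψ preφ preZ = op.step lab' φ ψ preφ preZ := by
  cases op with
  | prop => exact absurd trivial h
  | un A o | tp A o => cases o <;> rfl
  | _ => rfl

/-- The operator is binary. -/
def IsBin : NodeOp k → Prop
  | lg _ => True
  | tp _ _ => True
  | _ => False

/-- The operator is allowed. -/
def InFragment (Ut : Set UnOp) (Bt : Set BinTp) (Bl : Set BinLg) : NodeOp k → Prop
  | prop => True
  | neg => UnOp.neg ∈ Ut
  | lg o => o ∈ Bl
  | un _ o => UnOp.tp o ∈ Ut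
  | tp _ o => o ∈ Bt

end NodeOp

namespace ATL

variable {k : ℕ} {P : Type} [DecidableEq P]

theorem left_mem_subF (φ : ATL k P) : φ.left ∈ φ.subF := by
  cases φ <;> simp [left, subF, self_mem_subF]

theorem right_mem_subF (φ : ATL k P) : φ.right ∈ φ.subF := by
  cases φ <;> simp [right, subF, self_mem_subF]

omit [DecidableEq P] in
theorem sizeOf_left_lt [SizeOf P] {φ : ATL k P} (h : ¬ φ.op.IsProp) : sizeOf φ.left < sizeOf φ := by
  cases φ <;> simp [left, op, NodeOp.IsProp] at h ⊢ <;> omega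

omit [DecidableEq P] in
theorem sizeOf_right_lt [SizeOf P] {φ : ATL k P} (h : ¬ φ.op.IsProp) :
    sizeOf φ.right < sizeOf φ := by
  cases φ <;> simp [right, op, NodeOp.IsProp] at h ⊢

omit [DecidableEq P] in
theorem isBin_iff (φ : ATL k P) : φ.isBin = true ↔ φ.op.IsBin := by
  cases φ <;> simp [isBin, op, NodeOp.IsBin]

omit [DecidableEq P] in
theorem InFragment.op {Ut : Set UnOp} {Bt : Set BinTp} {Bl : Set BinLg} {φ : ATL k P}
    (h : φ.InFragment Ut Bt Bl) : φ.op.InFragment Ut Bt Bl := by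
  cases φ with
  | prop p => trivial
  | _ => exact h.1

omit [DecidableEq P] in
theorem op_form (op : NodeOp k) (p : P) (φ ψ : ATL k P) : (op.form p φ ψ).op = op := by
  cases op <;> rfl

omit [DecidableEq P] in
theorem form_op (φ : ATL k P) (p : P) (h : φ.op.IsProp → φ = prop p) :
    φ.op.form p φ.left φ.right = φ := by
  cases φ with
  | prop q => exact (h trivial).symm
  | _ => rfl

end ATL

/-! ### Formulas as directed acyclic graphs -/

/-- A sequence of operators with pointers to their operands; for a proposition, `l` is its index. -/
structure Dag (k : ℕ) where
  op : ℕ → NodeOp k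
  l : ℕ → ℕ
  r : ℕ → ℕ

namespace Dag

variable {k m : ℕ} (D : Dag k)

/-- The pointers of node `i` lead to earlier nodes or to a proposition. -/
def NodeOK (m i : ℕ) : Prop :=
  ((D.op i).IsProp → D.l i < m) ∧ (¬ (D.op i).IsProp → D.l i < i ∧ D.r i < i)

/-- The proposition with a given index. -/
def toProp (hm : 0 < m) (x : ℕ) : Fin m := if h : x < m then ⟨x, h⟩ else ⟨0, hm⟩

/-- The nodes below `B` represent the formulas `f i`. -/
def Represents (hm : 0 < m) (B : ℕ) (f : ℕ → ATL k (Fin m)) : Prop :=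
  ∀ i < B, D.NodeOK m i ∧ f i = (D.op i).form (toProp hm (D.l i)) (f (D.l i)) (f (D.r i))

/-- The formula that a node represents. -/
def unfold (hm : 0 < m) (i : ℕ) : ATL k (Fin m) :=
  (D.op i).form (toProp hm (D.l i))
    -- The tests make the recursion well founded on every graph. At a valid operator node both
    -- succeed, and at a proposition the operands are not used.
    (if _h : D.l i < i then unfold hm (D.l i) else .prop ⟨0, hm⟩)
    (if _h : D.r i < i then unfold hm (D.r i) else .prop ⟨0, hm⟩)
termination_by i

variable {D} {hm : 0 < m} {B : ℕ}

theorem represents_unfold (h : ∀ i < B, D.NodeOK m i) : D.Represents hm B (D.unfold hm) := by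
  intro i hi
  refine ⟨h i hi, ?_⟩
  rw [unfold]
  by_cases hp : (D.op i).IsProp
  · cases hop : D.op i with
    | prop => rfl
    | _ => simp [hop, NodeOp.IsProp] at hp
  · obtain ⟨h1, h2⟩ := (h i hi).2 hp
    rw [dif_pos h1, dif_pos h2]

namespace Represents

variable {f : ℕ → ATL k (Fin m)} (hf : D.Represents hm B f)

include hf

theorem op_eq {i : ℕ} (hi : i < B) : (f i).op = D.op i := by
  rw [(hf i hi).2, ATL.op_form]

/-- Operands are formulas of earlier nodes, so every sub-formula belongs to some node. This bounds
the size by the number of nodes. -/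
theorem subF_subset {i : ℕ} (hi : i < B) : (f i).subF ⊆ (Finset.range B).image f := by
  induction i using Nat.strong_induction_on with
  | _ i ih =>
    have hself : f i ∈ (Finset.range B).image f := Finset.mem_image_of_mem f (by simpa using hi)
    have hl : ¬ (D.op i).IsProp → (f (D.l i)).subF ⊆ (Finset.range B).image f := fun hp => by
      have := ((hf i hi).1.2 hp).1
      exact ih _ this (by omega)
    have hr : ¬ (D.op i).IsProp → (f (D.r i)).subF ⊆ (Finset.range B).image f := fun hp => by
      have := ((hf i hi).1.2 hp).2
      exact ih _ this (by omega)
    have heq := (hf i hi).2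
    rw [heq] at hself ⊢
    cases hop : D.op i with
    | prop =>
      rw [hop] at hself
      simpa [NodeOp.form, ATL.subF] using hself
    | neg | un A o =>
      rw [hop] at hself hl
      exact Finset.insert_subset hself (hl id)
    | lg o | tp A o =>
      rw [hop] at hself hl hr
      exact Finset.insert_subset hself (Finset.union_subset (hl id) (hr id))

theorem size_le {i : ℕ} (hi : i < B) : (f i).size ≤ B :=
  (Finset.card_le_card (hf.subF_subset hi)).trans
    (Finset.card_image_le.trans (Finset.card_range B).le)

/-- Only an inequality, since a guessed graph may contain duplicate or unreachable nodes; both only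
raise the number that the verifier compares with `n`. -/
theorem numBin_le {i : ℕ} (hi : i < B) :
    (f i).numBin ≤ ∑ i ∈ Finset.range B, ind (D.op i).IsBin := by
  classical
  have h1 : (f i).subF.filter (fun ψ => ψ.isBin) ⊆
      ((Finset.range B).filter fun i => (D.op i).IsBin).image f := by
    intro ψ hψ
    rw [Finset.mem_filter] at hψ
    obtain ⟨j, hj, rfl⟩ := Finset.mem_image.1 (hf.subF_subset hi hψ.1)
    refine Finset.mem_image_of_mem f (Finset.mem_filter.2 ⟨hj, ?_⟩)
    rw [← hf.op_eq (Finset.mem_range.1 hj), ← ATL.isBin_iff]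
    exact hψ.2
  refine ((Finset.card_le_card h1).trans Finset.card_image_le).trans ?_
  rw [Finset.card_filter]
  refine Finset.sum_le_sum fun i _ => ?_
  unfold ind
  split <;> simp_all

theorem inFragment {Ut : Set UnOp} {Bt : Set BinTp} {Bl : Set BinLg}
    (h : ∀ i < B, (D.op i).InFragment Ut Bt Bl) {i : ℕ} (hi : i < B) :
    (f i).InFragment Ut Bt Bl := by
  induction i using Nat.strong_induction_on with
  | _ i ih =>
    have hl : ¬ (D.op i).IsProp → (f (D.l i)).InFragment Ut Bt Bl := fun hp => by
      have := ((hf i hi).1.2 hp).1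
      exact ih _ this (by omega)
    have hr : ¬ (D.op i).IsProp → (f (D.r i)).InFragment Ut Bt Bl := fun hp => by
      have := ((hf i hi).1.2 hp).2
      exact ih _ this (by omega)
    have ho := h i hi
    rw [(hf i hi).2]
    cases hop : D.op i with
    | prop => trivial
    | neg | un A o =>
      rw [hop] at ho hl
      exact ⟨ho, hl id⟩
    | lg o | tp A o =>
      rw [hop] at ho hl hr
      exact ⟨ho, hl id, hr id⟩

omit hf in
/-- The table `T` of truth values satisfies the local equations. -/
def _root_.TemporalLearning.Dag.TableOK (D : Dag k) {m : ℕ} (C : CGS k (Fin m)) (B : ℕ)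
    (T : ℕ → ℕ → C.Q → Prop) : Prop :=
  ∀ i < B, ∀ q, (T i 0 q ↔ (D.op i).start) ∧ ∀ j < C.numStates, T i (j + 1) q ↔
    (D.op i).step (∃ h : D.l i < m, ⟨D.l i, h⟩ ∈ C.label q) (T (D.l i) C.numStates q)
      (T (D.r i) C.numStates q) (fun A => C.pre A (T (D.l i) C.numStates) q)
      (fun A => C.pre A (T i j) q)

/-- A table that satisfies the local equations holds the truth values of the formulas. -/
theorem table_iff {C : CGS k (Fin m)} {T : ℕ → ℕ → C.Q → Prop} (hT : D.TableOK C B T) {i : ℕ}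
    (hi : i < B) (q : C.Q) : T i C.numStates q ↔ (f i).SatAt C.label C.Enforces q := by
  induction i using Nat.strong_induction_on generalizing q with
  | _ i ih =>
    -- The outer induction on nodes makes the final columns of the operands correct; then the
    -- columns of node `i` agree with the iterates by induction on the step.
    have key : ∀ j ≤ C.numStates, ∀ q, T i j q ↔
        C.iter (D.op i) (fun q => toProp hm (D.l i) ∈ C.label q)
          ((f (D.l i)).SatAt C.label C.Enforces) ((f (D.r i)).SatAt C.label C.Enforces) j q := by
      intro j hj
      induction j with
      | zero => exact fun q => (hT i hi q).1
      | succ j ihj =>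
        intro q
        have hZ : T i j = _ := funext fun q => propext (ihj (by omega) q)
        rw [(hT i hi q).2 j hj, CGS.iter, ← hZ]
        by_cases hp : (D.op i).IsProp
        · have hlt := (hf i hi).1.1 hp
          cases hop : D.op i with
          | prop => simp [NodeOp.step, toProp, hlt]
          | _ => simp [hop, NodeOp.IsProp] at hp
        · obtain ⟨h1, h2⟩ := (hf i hi).1.2 hp
          have e1 : T (D.l i) C.numStates = _ :=
            funext fun q => propext (ih _ h1 (h1.trans hi) q)
          have e2 : T (D.r i) C.numStates = _ :=
            funext fun q => propext (ih _ h2 (h2.trans hi) q)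
          rw [e1, e2]
          exact iff_of_eq (NodeOp.step_congr hp _ _ _ _ _ _)
    rw [key _ le_rfl, (hf i hi).2]
    exact CGS.iter_numStates _ _ _ _ q

/-- The iterates of the operators satisfy the local equations. -/
theorem tableOK (C : CGS k (Fin m)) : D.TableOK C B fun i =>
    C.iter (D.op i) (fun q => ∃ h : D.l i < m, ⟨D.l i, h⟩ ∈ C.label q)
      ((f (D.l i)).SatAt C.label C.Enforces) ((f (D.r i)).SatAt C.label C.Enforces) := by
  have key : ∀ i < B, ∀ q, C.iter (D.op i) (fun q => ∃ h : D.l i < m, ⟨D.l i, h⟩ ∈ C.label q)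
      ((f (D.l i)).SatAt C.label C.Enforces) ((f (D.r i)).SatAt C.label C.Enforces)
      C.numStates q ↔ (f i).SatAt C.label C.Enforces q := by
    intro i hi q
    rw [(hf i hi).2, ← CGS.iter_numStates]
    by_cases hp : (D.op i).IsProp
    · have hlt := (hf i hi).1.1 hp
      rw [CGS.iter_of_pos _ _ _ _ q.pos, CGS.iter_of_pos _ _ _ _ q.pos]
      cases hop : D.op i with
      | prop => simp [NodeOp.step, toProp, hlt]
      | _ => simp [hop, NodeOp.IsProp] at hp
    · obtain ⟨h1, h2⟩ := (hf i hi).1.2 hp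
      have : ∀ j, C.iter (D.op i) (fun q => ∃ h : D.l i < m, ⟨D.l i, h⟩ ∈ C.label q)
          ((f (D.l i)).SatAt C.label C.Enforces) ((f (D.r i)).SatAt C.label C.Enforces) j =
          C.iter (D.op i) (fun q => toProp hm (D.l i) ∈ C.label q)
          ((f (D.l i)).SatAt C.label C.Enforces) ((f (D.r i)).SatAt C.label C.Enforces) j := by
        intro j
        induction j with
        | zero => rfl
        | succ j ih =>
          funext q
          rw [CGS.iter, CGS.iter, ih]
          exact NodeOp.step_congr hp _ _ _ _ _ _
      rw [this]
  intro i hi q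
  refine ⟨Iff.rfl, fun j hj => ?_⟩
  beta_reduce
  rw [CGS.iter]
  by_cases hp : (D.op i).IsProp
  · cases hop : D.op i with
    | prop => rfl
    | _ => simp [hop, NodeOp.IsProp] at hp
  · obtain ⟨h1, h2⟩ := (hf i hi).1.2 hp
    rw [funext fun q => propext (key _ (h1.trans hi) q),
      funext fun q => propext (key _ (h2.trans hi) q)]

end Represents

/-- A formula with at most `B` sub-formulas is represented by a graph with `B` nodes. -/
theorem exists_represents (hm : 0 < m) (φ : ATL k (Fin m)) {B : ℕ} (hB : φ.size ≤ B) :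
    ∃ (D : Dag k) (f : ℕ → ATL k (Fin m)), D.Represents hm B f ∧ (∃ i < B, f i = φ) ∧
      ∑ i ∈ Finset.range B, ind (D.op i).IsBin ≤ φ.numBin ∧
      (∀ i, D.l i ≤ m + B ∧ D.r i ≤ m + B) ∧
      ∀ Ut Bt Bl, φ.InFragment Ut Bt Bl → ∀ i < B, (D.op i).InFragment Ut Bt Bl := by
  classical
  -- Operands have smaller `sizeOf`, so in this order every pointer leads backwards.
  set L := φ.subF.toList.mergeSort fun a b => decide (sizeOf a ≤ sizeOf b) with hL
  have hperm : L.Perm φ.subF.toList := List.mergeSort_perm _ _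
  have hmem : ∀ ψ, ψ ∈ L ↔ ψ ∈ φ.subF := fun ψ => by rw [hperm.mem_iff, Finset.mem_toList]
  have hlen : L.length = φ.size := by rw [hperm.length_eq, Finset.length_toList]; rfl
  have hnd : L.Nodup := hperm.nodup_iff.2 φ.subF.nodup_toList
  have hsorted : ∀ i j (hi : i < L.length) (hj : j < L.length), i < j →
      sizeOf L[i] ≤ sizeOf L[j] := by
    have := List.pairwise_mergeSort (le := fun a b : ATL k (Fin m) =>
      decide (sizeOf a ≤ sizeOf b)) (fun a b c h1 h2 => by simp at *; omega)
      (fun a b => by simp; omega) φ.subF.toList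
    rw [List.pairwise_iff_getElem] at this
    intro i j hi hj hij
    simpa using this i j hi hj hij
  -- Exactly `B` nodes are needed. The surplus ones are filled with a proposition, which lies in
  -- every fragment and is not binary.
  let f : ℕ → ATL k (Fin m) := fun i => L.getD i (.prop ⟨0, hm⟩)
  have hfi : ∀ i (hi : i < L.length), f i = L[i] := fun i hi => by
    simp [f, List.getElem?_eq_getElem hi]
  have hfi' : ∀ i, ¬ i < L.length → f i = .prop ⟨0, hm⟩ := fun i hi => by
    simp only [f, List.getD_eq_getElem?_getD]
    rw [List.getElem?_eq_none (by omega)]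
    rfl
  have hidx : ∀ ψ ∈ φ.subF, f (L.idxOf ψ) = ψ := by
    intro ψ hψ
    have h := List.idxOf_lt_length_iff.2 ((hmem ψ).2 hψ)
    rw [hfi _ h, List.getElem_idxOf]
  have hlt : ∀ i (hi : i < L.length) (ψ : ATL k (Fin m)), ψ ∈ φ.subF → sizeOf ψ < sizeOf L[i] →
      L.idxOf ψ < i := by
    intro i hi ψ hψ hsz
    have h := List.idxOf_lt_length_iff.2 ((hmem ψ).2 hψ)
    by_contra hge
    rcases Nat.lt_or_ge i (L.idxOf ψ) with h' | h'
    · have := hsorted i _ hi h h'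
      rw [List.getElem_idxOf] at this
      omega
    · have : i = L.idxOf ψ := by omega
      have h2 : L[i] = ψ := by simp only [this, List.getElem_idxOf]
      rw [h2] at hsz
      omega
  let pidx : ATL k (Fin m) → ℕ := fun ψ => match ψ with
    | .prop p => p
    | _ => L.idxOf ψ.left
  let D : Dag k := ⟨fun i => (f i).op, fun i => pidx (f i), fun i => L.idxOf (f i).right⟩
  have hsub : ∀ i (hi : i < L.length), L[i] ∈ φ.subF := fun i hi =>
    (hmem _).1 (List.getElem_mem hi)
  have hp : ∀ ψ : ATL k (Fin m), ψ.op.IsProp → ∃ p : Fin m, ψ = .prop p ∧ pidx ψ = p := by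
    intro ψ h
    cases ψ with
    | prop p => exact ⟨p, rfl, rfl⟩
    | _ => exact absurd h id
  have hnp : ∀ ψ : ATL k (Fin m), ¬ ψ.op.IsProp → pidx ψ = L.idxOf ψ.left := by
    intro ψ h
    cases ψ with
    | prop p => exact absurd trivial h
    | _ => rfl
  refine ⟨D, f, fun i hi => ⟨⟨fun h => ?_, fun h => ?_⟩, ?_⟩, ⟨L.idxOf φ, ?_, ?_⟩, ?_, ?_, ?_⟩
  · obtain ⟨p, -, h2⟩ := hp (f i) h
    exact h2.trans_lt p.2
  · by_cases hiL : i < L.length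
    · change pidx (f i) < i ∧ L.idxOf (f i).right < i
      have hs := hsub i hiL
      rw [hnp _ h]
      have h' : ¬ (f i).op.IsProp := h
      rw [hfi i hiL] at h' ⊢
      exact ⟨hlt i hiL _ (ATL.subF_subset hs (ATL.left_mem_subF _)) (ATL.sizeOf_left_lt h'),
        hlt i hiL _ (ATL.subF_subset hs (ATL.right_mem_subF _)) (ATL.sizeOf_right_lt h')⟩
    · refine absurd ?_ h
      change (f i).op.IsProp
      rw [hfi' i hiL]
      trivial
  · change f i = (f i).op.form (toProp hm (pidx (f i))) (f (pidx (f i))) (f (L.idxOf (f i).right))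
    by_cases h : (f i).op.IsProp
    · obtain ⟨p, h1, h2⟩ := hp (f i) h
      rw [h2, h1]
      simp [ATL.op, NodeOp.form, toProp]
    · have hiL : i < L.length := by
        by_contra hiL
        rw [hfi' i hiL] at h
        exact h trivial
      have hs := hsub i hiL
      rw [← hfi i hiL] at hs
      rw [hnp _ h, hidx _ (ATL.subF_subset hs (ATL.left_mem_subF _)),
        hidx _ (ATL.subF_subset hs (ATL.right_mem_subF _)),
        ATL.form_op _ _ fun h' => absurd h' h]
  · exact (List.idxOf_lt_length_iff.2 ((hmem φ).2 φ.self_mem_subF)).trans_le (hlen ▸ hB)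
  · exact hidx φ φ.self_mem_subF
  · have h1 : ∑ i ∈ Finset.range B, ind (D.op i).IsBin =
        ((Finset.range B).filter fun i => (f i).isBin = true).card := by
      rw [Finset.card_filter]
      refine Finset.sum_congr rfl fun i _ => ?_
      by_cases h : (f i).isBin = true
      · rw [if_pos h]
        exact ind_of_true ((ATL.isBin_iff _).1 h)
      · rw [if_neg h]
        exact ind_of_false fun h' => h ((ATL.isBin_iff _).2 h')
    have hlt' : ∀ i, (f i).isBin = true → i < L.length := by
      intro i h
      by_contra hiL
      rw [hfi' i hiL] at h
      exact absurd h (by simp [ATL.isBin])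
    rw [h1]
    -- Binary nodes are not padding, and the list has no duplicates, so distinct binary nodes carry
    -- distinct sub-formulas.
    refine Finset.card_le_card_of_injOn f (fun i hi => ?_) (fun i hi j hj hij => ?_)
    · have hb := (Finset.mem_filter.1 hi).2
      have hiL := hlt' i hb
      refine Finset.mem_coe.2 (Finset.mem_filter.2 ⟨?_, hb⟩)
      rw [hfi i hiL]
      exact hsub i hiL
    · have hi' := hlt' i (Finset.mem_filter.1 (Finset.mem_coe.1 hi)).2
      have hj' := hlt' j (Finset.mem_filter.1 (Finset.mem_coe.1 hj)).2
      rw [hfi i hi', hfi j hj'] at hij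
      exact hnd.getElem_inj_iff.1 hij
  · intro i
    -- The bound holds for unused pointers too, as the index of an absent formula is the length of
    -- the list. All pointers must fit in unary into the certificate.
    have hle : ∀ ψ, L.idxOf ψ ≤ m + B := fun ψ =>
      List.idxOf_le_length.trans ((hlen ▸ hB).trans (Nat.le_add_left _ _))
    refine ⟨?_, hle _⟩
    change pidx (f i) ≤ m + B
    by_cases h : (f i).op.IsProp
    · obtain ⟨p, -, h2⟩ := hp (f i) h
      have := p.2
      omega
    · rw [hnp _ h]
      exact hle _
  · intro Ut Bt Bl hφ i _
    change (f i).op.InFragment Ut Bt Bl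
    by_cases hiL : i < L.length
    · rw [hfi i hiL]
      exact (hφ.of_mem_subF (hsub i hiL)).op
    · rw [hfi' i hiL]
      trivial

end Dag

end TemporalLearning

/-! ### Certificates and a polynomial-time verifier. -/

namespace TemporalLearning

/-! ### Certificates -/

instance : Finite UnTp := by
  refine Finite.of_surjective (fun i : Fin 3 => ([.X, .F, .G] : List UnTp)[i]) fun x => ?_
  cases x
  exacts [⟨0, rfl⟩, ⟨1, rfl⟩, ⟨2, rfl⟩]

instance : Finite BinTp := by
  refine Finite.of_surjective (fun i : Fin 4 => ([.U, .R, .W, .M] : List BinTp)[i]) fun x => ?_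
  cases x
  exacts [⟨0, rfl⟩, ⟨1, rfl⟩, ⟨2, rfl⟩, ⟨3, rfl⟩]

instance : Finite BinLg := by
  refine Finite.of_surjective (fun i : Fin 10 => ([.or, .and, .impl, .conv, .iff, .nor, .nand,
    .nimpl, .nconv, .niff] : List BinLg)[i]) fun x => ?_
  cases x
  exacts [⟨0, rfl⟩, ⟨1, rfl⟩, ⟨2, rfl⟩, ⟨3, rfl⟩, ⟨4, rfl⟩, ⟨5, rfl⟩, ⟨6, rfl⟩, ⟨7, rfl⟩,
    ⟨8, rfl⟩, ⟨9, rfl⟩]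

instance (k : ℕ) : Finite (NodeOp k) := by
  refine Finite.of_surjective (fun x : Bool ⊕ BinLg ⊕ (Finset (Fin k) × UnTp) ⊕
      (Finset (Fin k) × BinTp) => match x with
    | .inl true => NodeOp.prop
    | .inl false => .neg
    | .inr (.inl o) => .lg o
    | .inr (.inr (.inl x)) => .un x.1 x.2
    | .inr (.inr (.inr x)) => .tp x.1 x.2) fun x => ?_
  cases x with
  | prop => exact ⟨.inl true, rfl⟩
  | neg => exact ⟨.inl false, rfl⟩
  | lg o => exact ⟨.inr (.inl o), rfl⟩
  | un A o => exact ⟨.inr (.inr (.inl (A, o))), rfl⟩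
  | tp A o => exact ⟨.inr (.inr (.inr (A, o))), rfl⟩

/-- The symbols of certificates: an operator, marks that give the pointers of a node in unary, and
an entry of the table of truth values. -/
structure Cell (k : ℕ) where
  op : NodeOp k
  l : Prop
  r : Prop
  t : Prop

instance (k : ℕ) : Finite (Cell k) :=
  Finite.of_surjective (fun x : NodeOp k × Prop × Prop × Prop => ⟨x.1, x.2.1, x.2.2.1, x.2.2.2⟩)
    fun x => ⟨(x.op, x.l, x.r, x.t), rfl⟩

/-- Words that consist of an encoded input and a certificate. -/
abbrev CertWord (k : ℕ) : Type := List (Γ' ⊕ Cell k)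

/-- The cell at a position. -/
def cell {k : ℕ} : Option (Γ' ⊕ Cell k) → Cell k
  | some (Sum.inr c) => c
  | _ => ⟨.prop, False, False, False⟩

section

variable {k : ℕ}

/-- The cell for node `i`, step `j`, model `M` and state `q`, in a certificate that starts at
position `L`. -/
def cellAt (w : CertWord k) (L i j M q : ℕ) : Cell k :=
  -- The four indices are the digits in base `L` of the offset of the cell.
  cell w[L + (((i * L + j) * L + M) * L + q)]?

/-- The graph described by a certificate. -/
noncomputable def certDag (w : CertWord k) (L : ℕ) : Dag k where
  -- Pointers are counts of marks and missing cells have a default, so every certificate describes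
  -- some graph and its format need not be checked.
  op i := (cellAt w L i 0 0 0).op
  l i := ∑ q ∈ Finset.range L, ind (cellAt w L i 0 0 q).l
  r i := ∑ q ∈ Finset.range L, ind (cellAt w L i 0 0 q).r

variable {α : Type} [Ctx (Γ' ⊕ Cell k) α]

theorem PTP.cellAt (P : Cell k → Prop) {L i j M q : α → ℕ} (hL : PT L) (hi : PT i) (hj : PT j)
    (hM : PT M) (hq : PT q) :
    PTP fun a => P (cellAt (Ctx.word a) (L a) (i a) (j a) (M a) (q a)) :=
  PTP.chr (fun o => P (cell o)) (hL.add ((((((hi.mul hL).add hj).mul hL).add hM).mul hL).add hq))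

theorem PTP.certDag_op (P : NodeOp k → Prop) {L i : α → ℕ} (hL : PT L) (hi : PT i) :
    PTP fun a => P ((certDag (Ctx.word a) (L a)).op (i a)) :=
  PTP.cellAt (fun c => P c.op) hL hi (PT.const 0) (PT.const 0) (PT.const 0)

theorem PT.certDag_l {L i : α → ℕ} (hL : PT L) (hi : PT i) :
    PT fun a => (certDag (Ctx.word a) (L a)).l (i a) :=
  PT.sum (g := fun a q => ind (TemporalLearning.cellAt (Ctx.word a) (L a) (i a) 0 0 q).l) hL
    (PTP.cellAt (fun c => c.l) hL.weaken hi.weaken (PT.const 0) (PT.const 0) var₀)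

theorem PT.certDag_r {L i : α → ℕ} (hL : PT L) (hi : PT i) :
    PT fun a => (certDag (Ctx.word a) (L a)).r (i a) :=
  PT.sum (g := fun a q => ind (TemporalLearning.cellAt (Ctx.word a) (L a) (i a) 0 0 q).r) hL
    (PTP.cellAt (fun c => c.r) hL.weaken hi.weaken (PT.const 0) (PT.const 0) var₀)

theorem PTP.binLg {p q : α → Prop} (hp : PTP p) (hq : PTP q) (o : BinLg) :
    PTP fun a => o.eval (p a) (q a) := by
  cases o with
  | or => exact hp.or hq
  | and => exact hp.and hq
  | impl => exact hp.imp hq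
  | conv => exact hq.imp hp
  | iff => exact hp.iff hq
  | nor => exact (hp.or hq).not
  | nand => exact (hp.and hq).not
  | nimpl => exact (hp.imp hq).not
  | nconv => exact (hq.imp hp).not
  | niff => exact (hp.iff hq).not

theorem PTP.step {lab φ ψ : α → Prop} {preφ preZ : α → Finset (Fin k) → Prop} (hlab : PTP lab)
    (hφ : PTP φ) (hψ : PTP ψ) (hpφ : ∀ A, PTP fun a => preφ a A) (hpZ : ∀ A, PTP fun a => preZ a A)
    (op : NodeOp k) : PTP fun a => op.step (lab a) (φ a) (ψ a) (preφ a) (preZ a) := by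
  cases op with
  | prop => exact hlab
  | neg => exact hφ.not
  | lg o => exact PTP.binLg hφ hψ o
  | un A o =>
    cases o with
    | X => exact hpφ A
    | F => exact hφ.or (hpZ A)
    | G => exact hφ.and (hpZ A)
  | tp A o =>
    cases o with
    | U => exact hψ.or (hφ.and (hpZ A))
    | R => exact hψ.and (hφ.or (hpZ A))
    | W => exact hψ.or (hφ.and (hpZ A))
    | M => exact hψ.and (hφ.or (hpZ A))

/-- The operator is read from the word. Since there are finitely many operators, the verifier
distinguishes all cases and uses the program for each. -/
theorem PTP.certDag_step {L i : α → ℕ} (hL : PT L) (hi : PT i)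
    {lab φ ψ : α → Prop} {preφ preZ : α → Finset (Fin k) → Prop} (hlab : PTP lab)
    (hφ : PTP φ) (hψ : PTP ψ) (hpφ : ∀ A, PTP fun a => preφ a A)
    (hpZ : ∀ A, PTP fun a => preZ a A) :
    PTP fun a => ((certDag (Ctx.word a) (L a)).op (i a)).step (lab a) (φ a) (ψ a) (preφ a)
      (preZ a) :=
  (PTP.allFin fun op => (PTP.certDag_op (fun o => o = op) hL hi).imp
    (PTP.step hlab hφ hψ hpφ hpZ op)).congr fun _ =>
      ⟨fun h _ ho => ho ▸ h, fun h => h _ rfl⟩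

end

/-! ### The verifier -/

/-- A class of models that can be read as concurrent game structures, with polynomial-time access to
the components of a model at a given position of a word. -/
structure Coding (k : ℕ) (Model : ℕ → Type) (enc : {m : ℕ} → Model m → List Γ') where
  toCGS : {m : ℕ} → Model m → CGS k (Fin m)
  skip : CertWord k → ℕ → ℕ
  nst : CertWord k → ℕ → ℕ
  init : CertWord k → ℕ → ℕ → Prop
  lab : CertWord k → ℕ → ℕ → ℕ → Prop
  pre : Finset (Fin k) → CertWord k → ℕ → ℕ → (ℕ → Prop) → Prop
  pt_skip : PTSkip skip
  pt_nst : PTSkip nst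
  pt_init : ∀ {α : Type} [Ctx (Γ' ⊕ Cell k) α] {s q : α → ℕ}, PT s → PT q →
    PTP fun a => init (Ctx.word a) (s a) (q a)
  pt_lab : ∀ {α : Type} [Ctx (Γ' ⊕ Cell k) α] {s q p : α → ℕ}, PT s → PT q → PT p →
    PTP fun a => lab (Ctx.word a) (s a) (q a) (p a)
  pt_pre : ∀ (A : Finset (Fin k)) {α : Type} [Ctx (Γ' ⊕ Cell k) α] {s q : α → ℕ}
    {Z : α → ℕ → Prop}, PT s → PT q → (PTP fun c : α × ℕ => Z c.1 c.2) →
    PTP fun a => pre A (Ctx.word a) (s a) (q a) (Z a)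
  skips : ∀ {m : ℕ} (X : Model m), Skips (Cell k) skip (enc X)
  nst_eq : ∀ {m : ℕ} (X : Model m) {w : CertWord k} {s : ℕ}, At w s (enc X) →
    nst w s = (toCGS X).numStates
  numStates_le : ∀ {m : ℕ} (X : Model m), (toCGS X).numStates ≤ (enc X).length
  init_iff : ∀ {m : ℕ} (X : Model m) {w : CertWord k} {s : ℕ}, At w s (enc X) →
    ∀ q : (toCGS X).Q, init w s q ↔ q ∈ (toCGS X).init
  lab_iff : ∀ {m : ℕ} (X : Model m) {w : CertWord k} {s : ℕ}, At w s (enc X) →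
    ∀ (q : (toCGS X).Q) (p : Fin m), lab w s q p ↔ p ∈ (toCGS X).label q
  pre_iff : ∀ {m : ℕ} (X : Model m) {w : CertWord k} {s : ℕ}, At w s (enc X) →
    ∀ (A : Finset (Fin k)) (q : (toCGS X).Q) (Z : ℕ → Prop),
      pre A w s q Z ↔ (toCGS X).pre A (fun q' => Z q') q

namespace Coding

variable {k : ℕ} {Model : ℕ → Type} {enc : {m : ℕ} → Model m → List Γ'} (K : Coding k Model enc)

/-- The position of the positive models. -/
noncomputable def posP (w : CertWord k) : ℕ := skipNat w 0

/-- The position of the negative models. -/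
noncomputable def posN (w : CertWord k) : ℕ := skipList K.skip w (posP w)

/-- The position of the bound. -/
noncomputable def posB (w : CertWord k) : ℕ := skipList K.skip w (K.posN w)

/-- The bound. -/
noncomputable def bound (w : CertWord k) : ℕ := numAt w (K.posB w)

/-- The position of the certificate. -/
noncomputable def posC (w : CertWord k) : ℕ := skipNat w (K.posB w)

/-- The entry of the table of truth values. -/
def entry (w : CertWord k) (L i j M q : ℕ) : Prop := (cellAt w L i j M q).t

/-- The table satisfies the local equations for the model at position `s`, which is the model number
`M`. -/
def ModelOK (w : CertWord k) (s M : ℕ) : Prop :=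
  ∀ i < K.bound w, ∀ q < K.nst w s,
    (entry w (K.posC w) i 0 M q ↔ ((certDag w (K.posC w)).op i).start) ∧
    ∀ j < K.nst w s, entry w (K.posC w) i (j + 1) M q ↔
      ((certDag w (K.posC w)).op i).step
        ((certDag w (K.posC w)).l i < numAt w 0 ∧ K.lab w s q ((certDag w (K.posC w)).l i))
        (entry w (K.posC w) ((certDag w (K.posC w)).l i) (K.nst w s) M q)
        (entry w (K.posC w) ((certDag w (K.posC w)).r i) (K.nst w s) M q)
        (fun A => K.pre A w s q
          fun q' => entry w (K.posC w) ((certDag w (K.posC w)).l i) (K.nst w s) M q')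
        (fun A => K.pre A w s q fun q' => entry w (K.posC w) i j M q')

/-- The verifier. -/
def Verify (Ut : Set UnOp) (Bt : Set BinTp) (Bl : Set BinLg) (n : ℕ∞) (w : CertWord k) : Prop :=
  (∀ i < K.bound w,
    (certDag w (K.posC w)).NodeOK (numAt w 0) i ∧
      ((certDag w (K.posC w)).op i).InFragment Ut Bt Bl) ∧
  ((∑ i ∈ Finset.range (K.bound w), ind ((certDag w (K.posC w)).op i).IsBin : ℕ) : ℕ∞) ≤ n ∧
  (∀ j < countAt K.skip w (posP w), K.ModelOK w (nthAt K.skip w (posP w) j) j) ∧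
  (∀ j < countAt K.skip w (K.posN w),
    K.ModelOK w (nthAt K.skip w (K.posN w) j) (countAt K.skip w (posP w) + j)) ∧
  ∃ i < K.bound w,
    (∀ j < countAt K.skip w (posP w), ∀ q < K.nst w (nthAt K.skip w (posP w) j),
      K.init w (nthAt K.skip w (posP w) j) q →
        entry w (K.posC w) i (K.nst w (nthAt K.skip w (posP w) j)) j q) ∧
    (∀ j < countAt K.skip w (K.posN w), ∃ q < K.nst w (nthAt K.skip w (K.posN w) j),
      K.init w (nthAt K.skip w (K.posN w) j) q ∧
        ¬ entry w (K.posC w) i (K.nst w (nthAt K.skip w (K.posN w) j))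
          (countAt K.skip w (posP w) + j) q)

section PT

variable {α : Type} [Ctx (Γ' ⊕ Cell k) α]

theorem pt_posP : PT fun a : α => posP (Ctx.word a) :=
  PTSkip.nat.pt (PT.const 0)

theorem pt_posN : PT fun a : α => K.posN (Ctx.word a) :=
  K.pt_skip.list.pt pt_posP

theorem pt_posB : PT fun a : α => K.posB (Ctx.word a) :=
  K.pt_skip.list.pt K.pt_posN

theorem pt_bound : PT fun a : α => K.bound (Ctx.word a) :=
  PT.numAt K.pt_posB

theorem pt_posC : PT fun a : α => K.posC (Ctx.word a) :=
  PTSkip.nat.pt K.pt_posB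

theorem pt_entry {i j M q : α → ℕ} (hi : PT i) (hj : PT j) (hM : PT M) (hq : PT q) :
    PTP fun a => entry (Ctx.word a) (K.posC (Ctx.word a)) (i a) (j a) (M a) (q a) :=
  PTP.cellAt (fun c => c.t) K.pt_posC hi hj hM hq

theorem pt_modelOK {s M : α → ℕ} (hs : PT s) (hM : PT M) :
    PTP fun a => K.ModelOK (Ctx.word a) (s a) (M a) := by
  refine PTP.all (r := fun a i => ∀ q < K.nst (Ctx.word a) (s a), _) K.pt_bound ?_
  refine PTP.all (r := fun (c : α × ℕ) q => _ ∧ ∀ j < K.nst (Ctx.word c) (s c.1), _)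
    (K.pt_nst.pt hs.weaken) (PTP.and ?_ ?_)
  · exact (K.pt_entry PT.var₁ (PT.const 0) hM.weaken.weaken PT.var₀).iff
      (PTP.certDag_op NodeOp.start K.pt_posC PT.var₁)
  -- From the innermost outwards the variables are the step, the state and the node. Inside a
  -- predecessor the successor state becomes the innermost one and shifts the others.
  · have hs3 : PT fun c : ((α × ℕ) × ℕ) × ℕ => s c.1.1.1 := hs.weaken.weaken.weaken
    have hM3 : PT fun c : ((α × ℕ) × ℕ) × ℕ => M c.1.1.1 := hM.weaken.weaken.weaken
    have hn3 : PT fun c : ((α × ℕ) × ℕ) × ℕ => K.nst (Ctx.word c) (s c.1.1.1) := K.pt_nst.pt hs3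
    have hl3 : PT fun c : ((α × ℕ) × ℕ) × ℕ =>
        (certDag (Ctx.word c) (K.posC (Ctx.word c))).l c.1.1.2 := PT.certDag_l K.pt_posC PT.var₂
    have hr3 : PT fun c : ((α × ℕ) × ℕ) × ℕ =>
        (certDag (Ctx.word c) (K.posC (Ctx.word c))).r c.1.1.2 := PT.certDag_r K.pt_posC PT.var₂
    refine PTP.all (r := fun (c : (α × ℕ) × ℕ) j => _) (K.pt_nst.pt hs.weaken.weaken)
      (PTP.iff (K.pt_entry PT.var₂ PT.var₀.succ hM3 PT.var₁) ?_)
    exact PTP.certDag_step K.pt_posC PT.var₂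
      ((PTP.lt hl3 (PT.numAt (PT.const 0))).and (K.pt_lab hs3 PT.var₁ hl3))
      (K.pt_entry hl3 hn3 hM3 PT.var₁) (K.pt_entry hr3 hn3 hM3 PT.var₁)
      (fun A => K.pt_pre A hs3 PT.var₁ (K.pt_entry hl3.weaken hn3.weaken hM3.weaken PT.var₀))
      (fun A => K.pt_pre A hs3 PT.var₁ (K.pt_entry PT.var₃ PT.var₁ hM3.weaken PT.var₀))

/-- A finite `n` is a constant of the machine; for `n = ∞` there is nothing to test. -/
theorem ptp_natCast_le {f : α → ℕ} (hf : PT f) (n : ℕ∞) : PTP fun a => (f a : ℕ∞) ≤ n := by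
  induction n using ENat.recTopCoe with
  | top => exact (PTP.const True).congr fun a => by simp
  | coe n => exact (PTP.le hf (PT.const n)).congr fun a => by simp

theorem pt_verify (Ut : Set UnOp) (Bt : Set BinTp) (Bl : Set BinLg) (n : ℕ∞) :
    PTP (K.Verify Ut Bt Bl n) := by
  have hJP : ∀ {α : Type} [Ctx (Γ' ⊕ Cell k) α],
      PT fun a : α => countAt K.skip (Ctx.word a) (posP (Ctx.word a)) :=
    PT.countAt K.pt_skip pt_posP
  have hJN : ∀ {α : Type} [Ctx (Γ' ⊕ Cell k) α],
      PT fun a : α => countAt K.skip (Ctx.word a) (K.posN (Ctx.word a)) :=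
    PT.countAt K.pt_skip K.pt_posN
  have hsP : ∀ {α : Type} [Ctx (Γ' ⊕ Cell k) α] {j : α → ℕ}, PT j →
      PT fun a : α => nthAt K.skip (Ctx.word a) (posP (Ctx.word a)) (j a) :=
    fun hj => PT.nthAt K.pt_skip pt_posP hj
  have hsN : ∀ {α : Type} [Ctx (Γ' ⊕ Cell k) α] {j : α → ℕ}, PT j →
      PT fun a : α => nthAt K.skip (Ctx.word a) (K.posN (Ctx.word a)) (j a) :=
    fun hj => PT.nthAt K.pt_skip K.pt_posN hj
  refine PTP.and ?_ (PTP.and ?_ (PTP.and ?_ (PTP.and ?_ ?_)))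
  · refine PTP.all (r := fun w i => _ ∧ _) K.pt_bound (PTP.and (PTP.and ?_ ?_) ?_)
    · exact (PTP.certDag_op NodeOp.IsProp K.pt_posC PT.var₀).imp
        (PTP.lt (PT.certDag_l K.pt_posC PT.var₀) (PT.numAt (PT.const 0)))
    · exact (PTP.certDag_op NodeOp.IsProp K.pt_posC PT.var₀).not.imp
        ((PTP.lt (PT.certDag_l K.pt_posC PT.var₀) PT.var₀).and
          (PTP.lt (PT.certDag_r K.pt_posC PT.var₀) PT.var₀))
    · exact PTP.certDag_op (NodeOp.InFragment Ut Bt Bl) K.pt_posC PT.var₀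
  · exact ptp_natCast_le (PT.sum (g := fun w i => ind ((certDag w (K.posC w)).op i).IsBin)
      K.pt_bound (PTP.certDag_op NodeOp.IsBin K.pt_posC PT.var₀)) n
  · exact PTP.all (r := fun w j => K.ModelOK w (nthAt K.skip w (posP w) j) j) hJP
      (K.pt_modelOK (hsP PT.var₀) PT.var₀)
  · exact PTP.all (r := fun w j => K.ModelOK w (nthAt K.skip w (K.posN w) j)
      (countAt K.skip w (posP w) + j)) hJN (K.pt_modelOK (hsN PT.var₀) (hJP.add PT.var₀))
  · refine PTP.ex (r := fun w i => _ ∧ _) K.pt_bound (PTP.and ?_ ?_)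
    · refine PTP.all (r := fun (c : CertWord k × ℕ) j => ∀ q < K.nst c.1
        (nthAt K.skip c.1 (posP c.1) j), _) hJP ?_
      refine PTP.all (r := fun (c : (CertWord k × ℕ) × ℕ) q => _ → _)
        (K.pt_nst.pt (hsP PT.var₀)) (PTP.imp (K.pt_init (hsP PT.var₁) PT.var₀) ?_)
      exact K.pt_entry PT.var₂ (K.pt_nst.pt (hsP PT.var₁)) PT.var₁ PT.var₀
    · refine PTP.all (r := fun (c : CertWord k × ℕ) j => ∃ q < K.nst c.1
        (nthAt K.skip c.1 (K.posN c.1) j), _) hJN ?_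
      refine PTP.ex (r := fun (c : (CertWord k × ℕ) × ℕ) q => _ ∧ _)
        (K.pt_nst.pt (hsN PT.var₀)) (PTP.and (K.pt_init (hsN PT.var₁) PT.var₀) (PTP.not ?_))
      exact K.pt_entry PT.var₂ (K.pt_nst.pt (hsN PT.var₁)) (hJP.add PT.var₁) PT.var₀

end PT

end Coding

end TemporalLearning

/-! ### Soundness and completeness of the verifier. -/

namespace TemporalLearning

/-! ### Correctness of the verifier -/

/-- A graph and a table read from a finite certificate agree with the intended ones only below `b`.
That is enough when the pointers stay below `b`. -/
theorem Dag.TableOK.congr {k m : ℕ} {D D' : Dag k} {C : CGS k (Fin m)} {B b : ℕ}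
    {T T' : ℕ → ℕ → C.Q → Prop} (h : D.TableOK C B T) (hB : B ≤ b)
    (hop : ∀ i < B, D'.op i = D.op i) (hl : ∀ i < B, D'.l i = D.l i)
    (hr : ∀ i < B, D'.r i = D.r i) (hlr : ∀ i < B, D.l i < b ∧ D.r i < b)
    (hT : ∀ i < b, ∀ j ≤ C.numStates, T' i j = T i j) : D'.TableOK C B T' := by
  intro i hi q
  have hib := hi.trans_le hB
  obtain ⟨h1, h2⟩ := h i hi q
  rw [hop i hi, hl i hi, hr i hi, hT i hib 0 (Nat.zero_le _), hT _ (hlr i hi).1 _ le_rfl,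
    hT _ (hlr i hi).2 _ le_rfl]
  refine ⟨h1, fun j hj => ?_⟩
  rw [hT i hib _ hj, hT i hib _ hj.le]
  exact h2 j hj

/-- A certificate of length `L ^ 4`, as a list. -/
def certificate {k : ℕ} (L : ℕ) (g : ℕ → ℕ → ℕ → ℕ → Cell k) : List (Cell k) :=
  (List.range (L ^ 4)).map fun t => g (t / L / L / L) (t / L / L % L) (t / L % L) (t % L)

theorem mul_add_lt {a b c L : ℕ} (ha : a < c) (hb : b < L) : a * L + b < c * L := by
  have : (a + 1) * L ≤ c * L := Nat.mul_le_mul_right L ha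
  rw [Nat.succ_mul] at this
  omega

theorem cellAt_certificate {k : ℕ} (l : List Γ') (g : ℕ → ℕ → ℕ → ℕ → Cell k) {i j M q : ℕ}
    (hi : i < l.length) (hj : j < l.length) (hM : M < l.length) (hq : q < l.length) :
    cellAt (l.map Sum.inl ++ (certificate l.length g).map Sum.inr) l.length i j M q =
      g i j M q := by
  set L := l.length with hL
  have hlt : ((i * L + j) * L + M) * L + q < L ^ 4 := by
    rw [show L ^ 4 = ((L * L) * L) * L by ring]
    exact mul_add_lt (mul_add_lt (mul_add_lt hi hj) hM) hq
  have hd : ∀ a b, b < L → (a * L + b) / L = a ∧ (a * L + b) % L = b := fun a b hb => by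
    rw [Nat.mul_comm, Nat.mul_add_div (by omega), Nat.mul_add_mod, Nat.div_eq_of_lt hb,
      Nat.mod_eq_of_lt hb]
    exact ⟨rfl, rfl⟩
  rw [cellAt, List.getElem?_append_right (by simp [hL])]
  simp only [List.length_map, ← hL, Nat.add_sub_cancel_left, certificate, List.map_map]
  rw [List.getElem?_map, List.getElem?_range hlt]
  simp only [Option.map_some, Function.comp, cell, (hd _ _ hq).1, (hd _ _ hq).2, (hd _ _ hM).1,
    (hd _ _ hM).2, (hd _ _ hj).1, (hd _ _ hj).2]

/-- A pointer `n` is written by marking the cells `q < n`; counting the marks recovers it. -/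
theorem sum_ind_lt {L n : ℕ} (h : n ≤ L) : ∑ q ∈ Finset.range L, ind (q < n) = n := by
  have : ∀ q ∈ Finset.range L, ind (q < n) = if q < n then 1 else 0 := fun q _ => by
    split_ifs with hq
    exacts [ind_of_true hq, ind_of_false hq]
  rw [Finset.sum_congr rfl this, ← Finset.sum_filter]
  have hf : (Finset.range L).filter (· < n) = Finset.range n := by
    ext i; simp; omega
  simp [hf]

namespace Coding

variable {k : ℕ} {Model : ℕ → Type} {enc : {m : ℕ} → Model m → List Γ'} (K : Coding k Model enc)
  {x : Sample Model} {w : CertWord k}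

theorem numAt_zero (h : At w 0 (x.encode enc)) : numAt w 0 = x.numProp := by
  rw [Sample.encode, List.append_assoc, List.append_assoc] at h
  exact numAt_eq ((skips_nat _).split h).1

include K in
theorem at_pos (h : At w 0 (x.encode enc)) : At w (posP w) (encList enc x.pos) := by
  rw [Sample.encode, List.append_assoc, List.append_assoc] at h
  exact ((skips_list fun X _ => K.skips X).split ((skips_nat _).split h).2).1

theorem at_neg (h : At w 0 (x.encode enc)) : At w (K.posN w) (encList enc x.neg) := by
  rw [Sample.encode, List.append_assoc, List.append_assoc] at h
  exact ((skips_list fun X _ => K.skips X).split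
    ((skips_list fun X _ => K.skips X).split ((skips_nat _).split h).2).2).1

theorem at_bound (h : At w 0 (x.encode enc)) : At w (K.posB w) (encNat x.bound) := by
  rw [Sample.encode, List.append_assoc, List.append_assoc] at h
  exact ((skips_list fun X _ => K.skips X).split
    ((skips_list fun X _ => K.skips X).split ((skips_nat _).split h).2).2).2

theorem bound_eq (h : At w 0 (x.encode enc)) : K.bound w = x.bound :=
  numAt_eq (K.at_bound h)

theorem posC_eq (h : At w 0 (x.encode enc)) : K.posC w = (x.encode enc).length := by
  have := ((((skips_nat x.numProp).append (skips_list (l := x.pos) fun X _ => K.skips X)).append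
    (skips_list (l := x.neg) fun X _ => K.skips X)).append (skips_nat x.bound)).eq w 0 h
  rw [Nat.zero_add] at this
  exact this

theorem modelOK_iff {m : ℕ} (X : Model m) {s M : ℕ} (hm : numAt w 0 = m) (h : At w s (enc X)) :
    K.ModelOK w s M ↔ (certDag w (K.posC w)).TableOK (K.toCGS X) (K.bound w)
      fun i j q => entry w (K.posC w) i j M q := by
  unfold ModelOK Dag.TableOK
  refine forall₂_congr fun i hi => ?_
  rw [K.nst_eq X h, hm]
  refine ⟨fun H q => ?_, fun H q hq => ?_⟩
  · have := H q q.2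
    simpa only [← K.pre_iff X h, ← K.lab_iff X h, exists_prop] using this
  · have := H ⟨q, hq⟩
    simpa only [← K.pre_iff X h, ← K.lab_iff X h, exists_prop] using this

/-- What the verifier checks, in terms of the input. -/
theorem verify_iff (Ut : Set UnOp) (Bt : Set BinTp) (Bl : Set BinLg) (n : ℕ∞)
    (h : At w 0 (x.encode enc)) {L : ℕ} (hL : L = (x.encode enc).length) :
    K.Verify Ut Bt Bl n w ↔
      (∀ i < x.bound, (certDag w L).NodeOK x.numProp i ∧
        ((certDag w L).op i).InFragment Ut Bt Bl) ∧
      ((∑ i ∈ Finset.range x.bound, ind ((certDag w L).op i).IsBin : ℕ) : ℕ∞) ≤ n ∧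
      (∀ j (hj : j < x.pos.length), (certDag w L).TableOK (K.toCGS x.pos[j]) x.bound
        fun a b q => entry w L a b j q) ∧
      (∀ j (hj : j < x.neg.length), (certDag w L).TableOK (K.toCGS x.neg[j]) x.bound
        fun a b q => entry w L a b (x.pos.length + j) q) ∧
      ∃ i < x.bound,
        (∀ j (hj : j < x.pos.length), ∀ q : (K.toCGS x.pos[j]).Q, q ∈ (K.toCGS x.pos[j]).init →
          entry w L i (K.toCGS x.pos[j]).numStates j q) ∧
        (∀ j (hj : j < x.neg.length), ∃ q : (K.toCGS x.neg[j]).Q, q ∈ (K.toCGS x.neg[j]).init ∧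
          ¬ entry w L i (K.toCGS x.neg[j]).numStates (x.pos.length + j) q) := by
  have hP : ∀ j (hj : j < x.pos.length), At w (nthAt K.skip w (posP w) j) (enc x.pos[j]) :=
    fun j hj => nthAt_at (fun X _ => K.skips X) (K.at_pos h) hj
  have hN : ∀ j (hj : j < x.neg.length), At w (nthAt K.skip w (K.posN w) j) (enc x.neg[j]) :=
    fun j hj => nthAt_at (fun X _ => K.skips X) (K.at_neg h) hj
  unfold Verify
  rw [countAt_eq (fun X _ => K.skips X) (K.at_pos h), countAt_eq (fun X _ => K.skips X)
    (K.at_neg h), K.bound_eq h, numAt_zero h, K.posC_eq h, ← hL]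
  refine and_congr Iff.rfl (and_congr Iff.rfl (and_congr ?_ (and_congr ?_ ?_)))
  · refine forall₂_congr fun j hj => ?_
    rw [K.modelOK_iff _ (numAt_zero h) (hP j hj), K.bound_eq h, K.posC_eq h, ← hL]
  · refine forall₂_congr fun j hj => ?_
    rw [K.modelOK_iff _ (numAt_zero h) (hN j hj), K.bound_eq h, K.posC_eq h, ← hL]
  · refine exists_congr fun i => and_congr Iff.rfl (and_congr ?_ ?_)
    · refine forall₂_congr fun j hj => ?_
      rw [K.nst_eq _ (hP j hj)]
      exact ⟨fun H q hq => H q q.2 ((K.init_iff _ (hP j hj) q).2 hq),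
        fun H q hq hi => H ⟨q, hq⟩ ((K.init_iff _ (hP j hj) ⟨q, hq⟩).1 hi)⟩
    · refine forall₂_congr fun j hj => ?_
      rw [K.nst_eq _ (hN j hj)]
      exact ⟨fun ⟨q, hq, hi, H⟩ => ⟨⟨q, hq⟩, (K.init_iff _ (hN j hj) ⟨q, hq⟩).1 hi, H⟩,
        fun ⟨q, hi, H⟩ => ⟨q, q.2, (K.init_iff _ (hN j hj) q).2 hi, H⟩⟩

/-- There is a formula for the learning problem with input `x`. -/
def Learnable (Ut : Set UnOp) (Bt : Set BinTp) (Bl : Set BinLg) (n : ℕ∞) (x : Sample Model) :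
    Prop :=
  ∃ φ : ATL k (Fin x.numProp), φ.InFragment Ut Bt Bl ∧ φ.size ≤ x.bound ∧ (φ.numBin : ℕ∞) ≤ n ∧
    (∀ X ∈ x.pos, (K.toCGS X).Sat φ) ∧ ∀ X ∈ x.neg, ¬ (K.toCGS X).Sat φ

/-- Nothing is assumed about the certificate: the checked graph unfolds to a formula, and the local
equations force the table to hold its truth values. -/
theorem learnable_of_verify {Ut : Set UnOp} {Bt : Set BinTp} {Bl : Set BinLg} {n : ℕ∞}
    (h : At w 0 (x.encode enc)) (hV : K.Verify Ut Bt Bl n w) : K.Learnable Ut Bt Bl n x := by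
  obtain ⟨h1, h2, h3, h4, i, hi, h5, h6⟩ := (K.verify_iff Ut Bt Bl n h rfl).1 hV
  have hf := Dag.represents_unfold (hm := x.numProp_pos) fun i hi => (h1 i hi).1
  refine ⟨_, hf.inFragment (fun i hi => (h1 i hi).2) hi, hf.size_le hi,
    (Nat.cast_le.2 (hf.numBin_le hi)).trans h2, fun X hX => ?_, fun X hX => ?_⟩
  · obtain ⟨j, hj, rfl⟩ := List.mem_iff_getElem.1 hX
    exact fun q hq => (hf.table_iff (h3 j hj) hi q).1 (h5 j hj q hq)
  · obtain ⟨j, hj, rfl⟩ := List.mem_iff_getElem.1 hX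
    obtain ⟨q, hq, hne⟩ := h6 j hj
    exact fun hs => hne ((hf.table_iff (h4 j hj) hi q).2 (hs q hq))

theorem length_encode (x : Sample Model) : (x.encode enc).length =
    x.numProp + (x.pos.flatMap enc).length + (x.neg.flatMap enc).length + x.bound + 6 := by
  simp only [Sample.encode, List.length_append, length_encNat, length_encList]
  omega

theorem length_le_flatMap_of_mem {α β : Type} {l : List α} {e : α → List β} {a : α} (ha : a ∈ l) :
    (e a).length ≤ (l.flatMap e).length := by
  induction l with
  | nil => simp at ha
  | cons b l ih =>
    rw [List.flatMap_cons, List.length_append]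
    rcases List.mem_cons.1 ha with rfl | h
    · omega
    · have := ih h
      omega

/-- The certificate lists the graph of the formula and the true iterates in all models. -/
theorem verify_of_learnable {Ut : Set UnOp} {Bt : Set BinTp} {Bl : Set BinLg} {n : ℕ∞}
    (hx : K.Learnable Ut Bt Bl n x) :
    ∃ c : List (Cell k), c.length ≤ (x.encode enc).length ^ 4 ∧
      K.Verify Ut Bt Bl n ((x.encode enc).map Sum.inl ++ c.map Sum.inr) := by
  obtain ⟨φ, hφ, hs, hn, hpos, hneg⟩ := hx
  obtain ⟨D, f, hf, ⟨i₀, hi₀, rfl⟩, hb, hlr, hfr⟩ := Dag.exists_represents x.numProp_pos φ hs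
  set L := (x.encode enc).length with hL
  have hlen := length_encode (enc := enc) x
  rw [← hL] at hlen
  -- The length of the encoding exceeds every pointer, the number of models and the number of states
  -- of each model, so all indices are digits in base `L`.
  have hb1 : x.numProp + x.bound < L := by omega
  have hb2 : x.pos.length + x.neg.length < L := by
    have := length_le_flatMap (l := x.pos) (e := enc) fun X _ => (K.skips X).ne_nil
    have := length_le_flatMap (l := x.neg) (e := enc) fun X _ => (K.skips X).ne_nil
    omega
  have hb3 : ∀ X ∈ x.pos ++ x.neg, (K.toCGS X).numStates < L := fun X hX => by
    have h0 := K.numStates_le X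
    rcases List.mem_append.1 hX with h | h
    · have := length_le_flatMap_of_mem (e := enc) h
      omega
    · have := length_le_flatMap_of_mem (e := enc) h
      omega
  let T : (C : CGS k (Fin x.numProp)) → ℕ → ℕ → C.Q → Prop := fun C i =>
    C.iter (D.op i) (fun q => ∃ h : D.l i < x.numProp, ⟨D.l i, h⟩ ∈ C.label q)
      ((f (D.l i)).SatAt C.label C.Enforces) ((f (D.r i)).SatAt C.label C.Enforces)
  have hT : ∀ C, D.TableOK C x.bound (T C) := fun C => hf.tableOK C
  -- The data of a node is repeated for all steps and models, though it is only read at step and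
  -- model zero. Positive models are numbered before negative ones.
  let g : ℕ → ℕ → ℕ → ℕ → Cell k := fun i j M q => ⟨D.op i, q < D.l i, q < D.r i,
    ∃ (hM : M < (x.pos ++ x.neg).length) (hq : q < (K.toCGS (x.pos ++ x.neg)[M]).numStates),
      T (K.toCGS (x.pos ++ x.neg)[M]) i j ⟨q, hq⟩⟩
  refine ⟨certificate L g, by simp [certificate], ?_⟩
  set w : CertWord k := (x.encode enc).map Sum.inl ++ (certificate L g).map Sum.inr with hw
  have hcell : ∀ i j M q, i < L → j < L → M < L → q < L → cellAt w L i j M q = g i j M q :=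
    fun i j M q hi hj hM hq => cellAt_certificate (x.encode enc) g hi hj hM hq
  have hL0 : 0 < L := by omega
  have hop : ∀ i < L, (certDag w L).op i = D.op i := fun i hi => by
    simp only [certDag, hcell i 0 0 0 hi hL0 hL0 hL0, g]
  have hl : ∀ i < L, (certDag w L).l i = D.l i := fun i hi => by
    have := (hlr i).1
    change ∑ q ∈ Finset.range L, ind (cellAt w L i 0 0 q).l = D.l i
    refine (Finset.sum_congr rfl fun q hq => ?_).trans (sum_ind_lt (by omega : D.l i ≤ L))
    rw [hcell i 0 0 q hi hL0 hL0 (Finset.mem_range.1 hq)]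
  have hr : ∀ i < L, (certDag w L).r i = D.r i := fun i hi => by
    have := (hlr i).2
    change ∑ q ∈ Finset.range L, ind (cellAt w L i 0 0 q).r = D.r i
    refine (Finset.sum_congr rfl fun q hq => ?_).trans (sum_ind_lt (by omega : D.r i ≤ L))
    rw [hcell i 0 0 q hi hL0 hL0 (Finset.mem_range.1 hq)]
  have hent : ∀ M (hM : M < (x.pos ++ x.neg).length), ∀ i < L,
      ∀ j ≤ (K.toCGS (x.pos ++ x.neg)[M]).numStates,
        (fun q : (K.toCGS (x.pos ++ x.neg)[M]).Q => entry w L i j M q) =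
          T (K.toCGS (x.pos ++ x.neg)[M]) i j := by
    intro M hM i hi j hj
    funext q
    have hN := hb3 _ (List.getElem_mem hM)
    have hML : M < L := by rw [List.length_append] at hM; omega
    have := q.2
    rw [entry, hcell i j M q hi (by omega) hML (by omega)]
    exact propext ⟨fun ⟨_, _, h⟩ => h, fun h => ⟨hM, q.2, h⟩⟩
  have htab : ∀ M (hM : M < (x.pos ++ x.neg).length),
      (certDag w L).TableOK (K.toCGS (x.pos ++ x.neg)[M]) x.bound
        fun i j q => entry w L i j M q := fun M hM =>
    (hT _).congr (b := L) (by omega) (fun i hi => hop i (by omega)) (fun i hi => hl i (by omega))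
      (fun i hi => hr i (by omega)) (fun i _ => by have := hlr i; omega) (hent M hM)
  have hf' : (certDag w L).Represents x.numProp_pos x.bound f := fun i hi => by
    have := hf i hi
    have hiL : i < L := by omega
    unfold Dag.NodeOK at this ⊢
    rwa [hop i hiL, hl i hiL, hr i hiL]
  have hat : At w 0 (x.encode enc) := at_of_append (x.encode enc) [] _
  have hgp : ∀ j (hj : j < x.pos.length), (x.pos ++ x.neg)[j]'(by simp; omega) = x.pos[j] :=
    fun j hj => List.getElem_append_left hj
  have hgn : ∀ j (hj : j < x.neg.length), (x.pos ++ x.neg)[x.pos.length + j]'(by simp; omega) =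
      x.neg[j] := fun j hj => by simp
  have htp : ∀ j (hj : j < x.pos.length), (certDag w L).TableOK (K.toCGS x.pos[j]) x.bound
        fun a b q => entry w L a b j q := fun j hj => hgp j hj ▸ htab j (by simp; omega)
  have htn : ∀ j (hj : j < x.neg.length), (certDag w L).TableOK (K.toCGS x.neg[j]) x.bound
        fun a b q => entry w L a b (x.pos.length + j) q := fun j hj =>
    hgn j hj ▸ htab (x.pos.length + j) (by simp; omega)
  refine (K.verify_iff Ut Bt Bl n hat hL).2 ⟨fun i hi => ⟨(hf' i hi).1, ?_⟩, ?_, htp, htn, i₀, hi₀,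
    fun j hj q hq => ?_, fun j hj => ?_⟩
  · rw [hop i (by omega)]
    exact hfr Ut Bt Bl hφ i hi
  · refine le_trans (Nat.cast_le.2 (le_trans (le_of_eq ?_) hb)) hn
    refine Finset.sum_congr rfl fun i hi => ?_
    have := Finset.mem_range.1 hi
    rw [hop i (by omega)]
  · exact (hf'.table_iff (htp j hj) hi₀ q).2 (hpos _ (List.getElem_mem hj) q hq)
  · have := hneg _ (List.getElem_mem hj)
    unfold CGS.Sat at this
    push Not at this
    obtain ⟨q, hq, hne⟩ := this
    exact ⟨q, hq, fun he => hne ((hf'.table_iff (htn j hj) hi₀ q).1 he)⟩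

/-- A learning problem for models with a coding has polynomial-time verifiable certificates. -/
theorem inNP (D : DecisionProblem) (Ut : Set UnOp) (Bt : Set BinTp) (Bl : Set BinLg) (n : ℕ∞)
    (toSample : D.Input → Sample Model) (henc : ∀ x, D.encode x = (toSample x).encode enc)
    (hyes : ∀ x, x ∈ D.yes ↔ K.Learnable Ut Bt Bl n (toSample x))
    (hlen : ∃ q : Polynomial ℕ, ∀ x, (D.encode x).length ≤ q.eval (D.size x)) : D.InNP := by
  classical
  refine ⟨hlen, Cell k, Fintype.ofFinite _, Polynomial.X ^ 4,
    fun y => decide (K.Verify Ut Bt Bl n (D.encodePair y)), ?_, fun x => ?_⟩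
  · have := Fintype.ofFinite (Cell k)
    exact (K.pt_verify Ut Bt Bl n).tm2ComputableInPolyTime _ _ fun y => by simp
  · simp only [decide_eq_true_eq, Polynomial.eval_pow, Polynomial.eval_X,
      DecisionProblem.encodePair, henc]
    rw [hyes]
    -- Soundness holds for certificates of any length; the bound only matters for completeness.
    refine ⟨fun h => K.verify_of_learnable h, fun ⟨c, _, hV⟩ => ?_⟩
    exact K.learnable_of_verify (at_of_append ((toSample x).encode enc) [] _) hV

end Coding

end TemporalLearning

/-! ### Reading game structures and Kripke structures. -/

namespace TemporalLearning

/-! ### Access to encoded models -/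

section Positions

variable {Δ : Type}

/-- The position of the initial states in a model that starts at position `s`. -/
noncomputable def posInit (w : List (Γ' ⊕ Δ)) (s : ℕ) : ℕ := skipNat w s

/-- The position of the list of labels. -/
noncomputable def posLabels (w : List (Γ' ⊕ Δ)) (s : ℕ) : ℕ := skipList skipOne w (posInit w s)

/-- The position after the list of labels. -/
noncomputable def posTrans (w : List (Γ' ⊕ Δ)) (s : ℕ) : ℕ :=
  skipList (skipList skipOne) w (posLabels w s)

/-- The label at state `q` contains the proposition `p`. -/
def LabelAt (w : List (Γ' ⊕ Δ)) (s q p : ℕ) : Prop :=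
  BitAt w (nthAt (skipList skipOne) w (posLabels w s) q) p

theorem at_header {m N : ℕ} {I : Finset (Fin N)} {lab : Fin N → Finset (Fin m)} {e : List Γ'}
    {w : List (Γ' ⊕ Δ)} {s : ℕ} (h : At w s (encNat N ++ encSubset I ++
      encList (fun q => encSubset (lab q)) (List.finRange N) ++ e)) :
    numAt w s = N ∧ (∀ q : Fin N, BitAt w (posInit w s) q ↔ q ∈ I) ∧
      (∀ (q : Fin N) (p : Fin m), LabelAt w s q p ↔ p ∈ lab q) ∧ At w (posTrans w s) e := by
  rw [List.append_assoc, List.append_assoc] at h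
  obtain ⟨h1, h⟩ := (skips_nat _).split h
  obtain ⟨h2, h⟩ := (skips_subset _).split h
  obtain ⟨h3, h⟩ := (skips_list fun q _ => skips_subset _).split h
  exact ⟨numAt_eq h1, bitAt_iff h2,
    fun q p => bitAt_iff (nthAt_finRange (fun q => skips_subset _) h3 q) p, h⟩

theorem skips_header {m N : ℕ} (I : Finset (Fin N)) (lab : Fin N → Finset (Fin m)) :
    Skips Δ posTrans (encNat N ++ encSubset I ++
      encList (fun q => encSubset (lab q)) (List.finRange N)) :=
  ((skips_nat N).append (skips_subset I)).append (skips_list fun q _ => skips_subset (lab q))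

theorem PTSkip.comp {f g : List (Γ' ⊕ Δ) → ℕ → ℕ} (hf : PTSkip f) (hg : PTSkip g) :
    PTSkip fun w i => g w (f w i) := hg.pt hf

theorem PTSkip.init : PTSkip (posInit (Δ := Δ)) := PTSkip.nat

theorem PTSkip.labels : PTSkip (posLabels (Δ := Δ)) := PTSkip.init.comp PTSkip.one.list

theorem PTSkip.trans : PTSkip (posTrans (Δ := Δ)) := PTSkip.labels.comp PTSkip.one.list.list

theorem PTSkip.numAt : PTSkip (TemporalLearning.numAt (Δ := Δ)) := PT.numAt PT.var₀

variable {α : Type} [Ctx (Γ' ⊕ Δ) α] {s q p : α → ℕ}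

theorem PTP.labelAt (hs : PT s) (hq : PT q) (hp : PT p) :
    PTP fun a => LabelAt (Ctx.word a) (s a) (q a) (p a) :=
  PTP.bitAt (PT.nthAt PTSkip.one.list (PTSkip.labels.pt hs) hq) hp

end Positions

/-! ### Concurrent game structures -/

/-- A move of the coalition is represented by any joint action that extends it. Hence the search
runs over the lines of the transition table, whose number is part of the size of the structure. -/
theorem CGS.pre_iff {k : ℕ} {P : Type} {C : CGS k P} {A : Finset (Fin k)} {S : C.Q → Prop}
    {q : C.Q} : C.pre A S q ↔ ∃ β : (a : Fin k) → Fin (C.d q a), ∀ β' : (a : Fin k) → Fin (C.d q a),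
      (∀ a ∈ A, β' a = β a) → S (C.δ q β') := by
  classical
  constructor
  · rintro ⟨α, hα⟩
    refine ⟨fun a => if h : a ∈ A then α a h else ⟨0, C.d_pos q a⟩, fun β' hβ' => ?_⟩
    exact hα _ ⟨β', fun a ha => (hβ' a ha).trans (dif_pos ha), rfl⟩
  · rintro ⟨β, hβ⟩
    refine ⟨fun a _ => β a, ?_⟩
    rintro _ ⟨β', hβ', rfl⟩
    exact hβ β' hβ'

section Row

variable {Δ : Type}

/-- The position after a line of the transition table. -/
noncomputable def skipRow (w : List (Γ' ⊕ Δ)) (i : ℕ) : ℕ :=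
  skipNat w (skipList skipNat w (skipNat w i))

/-- The action of agent `a` in the line at position `i`. -/
noncomputable def rowAction (a : ℕ) (w : List (Γ' ⊕ Δ)) (i : ℕ) : ℕ :=
  numAt w (nthAt skipNat w (skipNat w i) a)

/-- The next state in the line at position `i`. -/
noncomputable def rowNext (w : List (Γ' ⊕ Δ)) (i : ℕ) : ℕ :=
  numAt w (skipList skipNat w (skipNat w i))

/-- The position of the lines for state `q`. -/
noncomputable def posRows (w : List (Γ' ⊕ Δ)) (s q : ℕ) : ℕ :=
  nthAt (skipList skipRow) w (skipList (skipList skipNat) w (posTrans w s)) q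

theorem PTSkip.row : PTSkip (skipRow (Δ := Δ)) :=
  (PTSkip.nat.comp PTSkip.nat.list).comp PTSkip.nat

theorem PTSkip.rowAction (a : ℕ) : PTSkip (TemporalLearning.rowAction (Δ := Δ) a) :=
  PT.numAt (PT.nthAt PTSkip.nat (PTSkip.nat.pt PT.var₀) (PT.const a))

theorem PTSkip.rowNext : PTSkip (TemporalLearning.rowNext (Δ := Δ)) :=
  PT.numAt (PTSkip.nat.list.pt (PTSkip.nat.pt PT.var₀))

theorem PT.posRows {α : Type} [Ctx (Γ' ⊕ Δ) α] {s q : α → ℕ} (hs : PT s) (hq : PT q) :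
    PT fun a => posRows (Ctx.word a) (s a) (q a) :=
  PT.nthAt PTSkip.row.list (PTSkip.nat.list.list.pt (PTSkip.trans.pt hs)) hq

variable {k m : ℕ} (C : CGS k (Fin m))

theorem skips_row (q : C.Q) (α : (a : Fin k) → Fin (C.d q a)) :
    Skips Δ skipRow (C.encodeRow q α) :=
  ((skips_nat _).append (skips_list fun _ _ => skips_nat _)).append (skips_nat _)

theorem at_row {C : CGS k (Fin m)} {q : C.Q} {α : (a : Fin k) → Fin (C.d q a)}
    {w : List (Γ' ⊕ Δ)} {i : ℕ} (h : At w i (C.encodeRow q α)) :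
    (∀ a : Fin k, rowAction a w i = α a) ∧ rowNext w i = C.δ q α := by
  rw [CGS.encodeRow, List.append_assoc] at h
  obtain ⟨-, h⟩ := (skips_nat _).split h
  obtain ⟨h1, h2⟩ := (skips_list fun a _ => skips_nat _).split h
  exact ⟨fun a => numAt_eq (nthAt_finRange (fun a => skips_nat _) h1 a), numAt_eq h2⟩

theorem at_rows {C : CGS k (Fin m)} {w : List (Γ' ⊕ Δ)} {s : ℕ} (h : At w s C.encode) (q : C.Q) :
    At w (posRows w s q) (encList (fun j => C.encodeRow q (finPiFinEquiv.symm j))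
      (List.finRange (∏ a, C.d q a))) := by
  rw [CGS.encode, List.append_assoc] at h
  have h1 := (at_header h).2.2.2
  have h2 := ((skips_list fun q _ => skips_list fun a _ => skips_nat _).split h1).2
  exact nthAt_finRange (fun q => skips_list fun j _ => skips_row C q _) h2 q

end Row

/-- Concurrent game structures. -/
noncomputable def cgsCoding (k : ℕ) : Coding k (fun m => CGS k (Fin m)) CGS.encode where
  toCGS C := C
  skip w s := skipList (skipList skipRow) w (skipList (skipList skipNat) w (posTrans w s))
  nst := numAt
  init w s q := BitAt w (posInit w s) q
  lab := LabelAt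
  pre A w s q Z :=
    ∃ j < countAt skipRow w (posRows w s q), ∀ j' < countAt skipRow w (posRows w s q),
      (∀ a : Fin k, a ∈ A → rowAction a w (nthAt skipRow w (posRows w s q) j') =
        rowAction a w (nthAt skipRow w (posRows w s q) j)) →
      Z (rowNext w (nthAt skipRow w (posRows w s q) j'))
  pt_skip := (PTSkip.trans.comp PTSkip.nat.list.list).comp PTSkip.row.list.list
  pt_nst := PTSkip.numAt
  pt_init hs hq := PTP.bitAt (PTSkip.init.pt hs) hq
  pt_lab hs hq hp := PTP.labelAt hs hq hp
  pt_pre A α _ s q Z hs hq hZ := by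
    have hrow := PT.posRows hs hq
    have h0 := PT.nthAt PTSkip.row hrow.weaken.weaken PT.var₀
    have h1 := PT.nthAt PTSkip.row hrow.weaken.weaken PT.var₁
    refine PTP.ex (r := fun a j => ∀ j' < countAt skipRow (Ctx.word a)
      (posRows (Ctx.word a) (s a) (q a)), _) (PT.countAt PTSkip.row hrow) ?_
    refine PTP.all (r := fun (c : α × ℕ) j' => _ → _) (PT.countAt PTSkip.row hrow.weaken)
      (PTP.imp (PTP.allFin fun a => PTP.imp (PTP.const _) (PTP.eq ((PTSkip.rowAction a).pt h0)
        ((PTSkip.rowAction a).pt h1))) ?_)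
    -- The set `Z` depends on the outer context and on the next state, but on neither of the two
    -- line numbers; hence `under` twice.
    exact PT.bind (PT.under (PT.under hZ)) (PTSkip.rowNext.pt h0)
  skips C := ((skips_header C.init C.label).append
    (skips_list fun q _ => skips_list fun a _ => skips_nat _)).append
      (skips_list fun q _ => skips_list fun j _ => skips_row C q _)
  nst_eq C w s h := by
    rw [CGS.encode, List.append_assoc] at h
    exact (at_header h).1
  numStates_le C := by
    simp only [CGS.encode, List.length_append, length_encNat]
    omega
  init_iff C w s h := by
    rw [CGS.encode, List.append_assoc] at h
    exact (at_header h).2.1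
  lab_iff C w s h := by
    rw [CGS.encode, List.append_assoc] at h
    exact (at_header h).2.2.1
  pre_iff C w s h A q Z := by
    have hr := at_rows h q
    have hc := countAt_eq (fun j _ => skips_row C q _) hr
    rw [List.length_finRange] at hc
    have hj : ∀ j : Fin (∏ a, C.d q a), _ := fun j =>
      at_row (nthAt_finRange (fun j => skips_row C q _) hr j)
    rw [hc, CGS.pre_iff]
    constructor
    · rintro ⟨j, hjlt, H⟩
      refine ⟨finPiFinEquiv.symm ⟨j, hjlt⟩, fun β' hβ' => ?_⟩
      obtain ⟨j', rfl⟩ := finPiFinEquiv.symm.surjective β'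
      rw [← (hj j').2]
      refine H j' j'.2 fun a ha => ?_
      rw [(hj j').1, (hj ⟨j, hjlt⟩).1, hβ' a ha]
    · rintro ⟨β, hβ⟩
      obtain ⟨j, rfl⟩ := finPiFinEquiv.symm.surjective β
      refine ⟨j, j.2, fun j' hj' H => ?_⟩
      rw [(hj ⟨j', hj'⟩).2]
      refine hβ _ fun a ha => Fin.ext ?_
      rw [← (hj ⟨j', hj'⟩).1, ← (hj j).1, H a ha]

/-! ### Kripke structures -/

namespace Kripke

variable {P : Type} (K : Kripke P)

/-- A Kripke structure as a game structure with one agent, who chooses the successor. -/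
noncomputable abbrev toCGS : CGS 1 P where
  numStates := K.numStates
  init := K.init
  label := K.label
  d q _ := (K.succ q).card
  d_pos q _ := (K.succ_nonempty q).card_pos
  δ q β := (K.succ q).equivFin.symm (β 0)

variable {K}

theorem exists_toCGS_δ {q q' : K.Q} :
    (∃ β : (a : Fin 1) → Fin (K.toCGS.d q a), K.toCGS.δ q β = q') ↔ q' ∈ K.succ q := by
  constructor
  · rintro ⟨β, rfl⟩
    exact ((K.succ q).equivFin.symm (β 0)).2
  · exact fun h => ⟨fun _ => (K.succ q).equivFin ⟨q', h⟩, by simp [toCGS]⟩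

theorem mem_succ_of_mem {A : Finset (Fin 1)} {q q' : K.Q}
    {α : (a : Fin 1) → a ∈ A → Fin (K.toCGS.d q a)} (h : q' ∈ K.toCGS.succ A q α) :
    q' ∈ K.succ q :=
  let ⟨β, _, h⟩ := h
  exists_toCGS_δ.1 ⟨β, h⟩

theorem eq_empty_or_univ (A : Finset (Fin 1)) : A = ∅ ∨ A = Finset.univ := by
  rcases A.eq_empty_or_nonempty with h | ⟨a, ha⟩
  · exact Or.inl h
  · refine Or.inr (Finset.eq_univ_of_forall fun b => ?_)
    rwa [Subsingleton.elim b a]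

theorem enforces_empty {q : K.Q} {S : Set (ℕ → K.Q)} :
    K.toCGS.Enforces ∅ q S ↔ ∀ ρ ∈ K.out q, ρ ∈ S := by
  have hout : ∀ s, K.toCGS.out ∅ s q = K.out q := fun s => by
    refine Set.ext fun ρ => and_congr Iff.rfl (forall_congr' fun i => ?_)
    refine Iff.trans ?_ exists_toCGS_δ
    exact exists_congr fun β => by simp
  constructor
  · rintro ⟨s, hs⟩
    rwa [hout] at hs
  · intro h
    refine ⟨fun a ha => absurd ha (Finset.notMem_empty a), ?_⟩
    rwa [hout]

/-- When the only agent belongs to the coalition, a strategy fixes the path, and every path is the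
outcome of a strategy that follows it. -/
theorem enforces_univ {q : K.Q} {S : Set (ℕ → K.Q)} :
    K.toCGS.Enforces Finset.univ q S ↔ ∃ ρ ∈ K.out q, ρ ∈ S := by
  classical
  constructor
  · rintro ⟨s, hs⟩
    choose next hn using fun (h : List K.Q) (x : K.Q) =>
      K.toCGS.succ_nonempty Finset.univ x fun a ha => s a ha h x
    obtain ⟨ρ, hρ, -⟩ := CGS.exists_out s q next hn
    exact ⟨ρ, ⟨hρ.1, fun i => mem_succ_of_mem (hρ.2 i)⟩, hs ρ hρ⟩
  · rintro ⟨ρ, ⟨h0, hρ⟩, hS⟩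
    -- The length of the history is the current position on `ρ`. The default action is for states
    -- from which the next state of `ρ` is not reachable, which never occur in the outcome.
    refine ⟨fun _ _ h x => if e : ρ (h.length + 1) ∈ K.succ x then (K.succ x).equivFin ⟨_, e⟩
      else ⟨0, (K.succ_nonempty x).card_pos⟩, fun ρ' hρ' => ?_⟩
    suffices ρ' = ρ by rwa [this]
    funext i
    induction i with
    | zero => exact hρ'.1.trans h0.symm
    | succ i ih =>
      obtain ⟨γ, hγ, h⟩ := hρ'.2 i
      have hmem : ρ (((List.range i).map ρ').length + 1) ∈ K.succ (ρ' i) := by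
        rw [ih, List.length_map, List.length_range]
        exact hρ i
      have h1 : γ 0 = (K.succ (ρ' i)).equivFin ⟨_, hmem⟩ :=
        (hγ 0 (Finset.mem_univ 0)).trans (dif_pos hmem)
      rw [← h]
      change ((K.succ (ρ' i)).equivFin.symm (γ 0) : K.Q) = ρ (i + 1)
      rw [h1, Equiv.symm_apply_apply]
      simp

theorem quant_eq : K.Quant = K.toCGS.Enforces := by
  funext A q S
  refine propext ?_
  unfold Quant
  rcases eq_empty_or_univ A with rfl | rfl
  · simp only [true_and, enforces_empty, or_iff_left_iff_imp]
    rintro ⟨h, -⟩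
    exact absurd h (by decide)
  · simp only [true_and, enforces_univ, or_iff_right_iff_imp]
    rintro ⟨h, -⟩
    exact absurd h (by decide)

theorem sat_toCGS (φ : CTL P) : K.toCGS.Sat φ ↔ K.Sat φ := by
  unfold CGS.Sat Sat
  rw [quant_eq]

theorem pre_empty {S : K.Q → Prop} {q : K.Q} :
    K.toCGS.pre ∅ S q ↔ ∀ q' ∈ K.succ q, S q' := by
  refine CGS.pre_iff.trans ?_
  constructor
  · rintro ⟨_, h⟩ q' hq'
    obtain ⟨β, rfl⟩ := exists_toCGS_δ.2 hq'
    exact h β (by simp)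
  · exact fun h => ⟨fun a => ⟨0, K.toCGS.d_pos q a⟩, fun β' _ =>
      h _ (exists_toCGS_δ.1 ⟨β', rfl⟩)⟩

theorem pre_univ {S : K.Q → Prop} {q : K.Q} :
    K.toCGS.pre Finset.univ S q ↔ ∃ q' ∈ K.succ q, S q' := by
  refine CGS.pre_iff.trans ?_
  constructor
  · exact fun ⟨β, h⟩ => ⟨_, exists_toCGS_δ.1 ⟨β, rfl⟩, h β fun _ _ => rfl⟩
  · rintro ⟨q', hq', h⟩
    obtain ⟨β, rfl⟩ := exists_toCGS_δ.2 hq'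
    refine ⟨β, fun β' hβ' => ?_⟩
    rwa [funext fun a => hβ' a (Finset.mem_univ a)]

end Kripke

/-- In the Kripke structure at position `s`, state `q'` is a successor of `q`. -/
def SuccAt {Δ : Type} (w : List (Γ' ⊕ Δ)) (s q q' : ℕ) : Prop :=
  BitAt w (nthAt (skipList skipOne) w (posTrans w s) q) q'

theorem PTP.succAt {Δ α : Type} [Ctx (Γ' ⊕ Δ) α] {s q p : α → ℕ} (hs : PT s) (hq : PT q)
    (hp : PT p) : PTP fun a => SuccAt (Ctx.word a) (s a) (q a) (p a) :=
  PTP.bitAt (PT.nthAt PTSkip.one.list (PTSkip.trans.pt hs) hq) hp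

theorem succAt_iff {Δ : Type} {m : ℕ} {K : Kripke (Fin m)} {w : List (Γ' ⊕ Δ)} {s : ℕ}
    (h : At w s K.encode) (q q' : K.Q) : SuccAt w s q q' ↔ q' ∈ K.succ q :=
  bitAt_iff (nthAt_finRange (fun _ => skips_subset _) (at_header h).2.2.2 q) q'

/-- Kripke structures. -/
noncomputable def kripkeCoding : Coding 1 (fun m => Kripke (Fin m)) Kripke.encode where
  toCGS K := K.toCGS
  skip w s := skipList (skipList skipOne) w (posTrans w s)
  nst := numAt
  init w s q := BitAt w (posInit w s) q
  lab := LabelAt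
  pre A w s q Z := (A = ∅ ∧ ∀ q' < numAt w s, SuccAt w s q q' → Z q') ∨
    (A = Finset.univ ∧ ∃ q' < numAt w s, SuccAt w s q q' ∧ Z q')
  pt_skip := PTSkip.trans.comp PTSkip.one.list.list
  pt_nst := PTSkip.numAt
  pt_init hs hq := PTP.bitAt (PTSkip.init.pt hs) hq
  pt_lab hs hq hp := PTP.labelAt hs hq hp
  pt_pre A α _ s q Z hs hq hZ := by
    refine PTP.or (PTP.and (PTP.const _) ?_) (PTP.and (PTP.const _) ?_)
    · exact PTP.all (r := fun a q' => SuccAt (Ctx.word a) (s a) (q a) q' → Z a q') (PT.numAt hs)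
        (PTP.imp (PTP.succAt hs.weaken hq.weaken PT.var₀) hZ)
    · exact PTP.ex (r := fun a q' => SuccAt (Ctx.word a) (s a) (q a) q' ∧ Z a q') (PT.numAt hs)
        (PTP.and (PTP.succAt hs.weaken hq.weaken PT.var₀) hZ)
  skips K := (skips_header K.init K.label).append (skips_list fun q _ => skips_subset _)
  nst_eq K w s h := (at_header h).1
  numStates_le K := by
    simp only [Kripke.encode, List.length_append, length_encNat]
    omega
  init_iff K w s h := (at_header h).2.1
  lab_iff K w s h := (at_header h).2.2.1
  pre_iff K w s h A q Z := by
    have hN : numAt w s = K.numStates := (at_header h).1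
    have hs : ∀ q' : K.Q, SuccAt w s q q' ↔ _ := succAt_iff h q
    rw [hN]
    rcases Kripke.eq_empty_or_univ A with rfl | rfl
    · have : (∅ : Finset (Fin 1)) ≠ Finset.univ := by decide
      simp only [this, true_and, false_and, or_false]
      refine Iff.trans ?_ Kripke.pre_empty.symm
      exact ⟨fun H q' hq' => H q' q'.2 ((hs q').2 hq'),
        fun H q' hq' h' => H ⟨q', hq'⟩ ((hs ⟨q', hq'⟩).1 h')⟩
    · have : (Finset.univ : Finset (Fin 1)) ≠ ∅ := by decide
      simp only [this, true_and, false_and, false_or]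
      refine Iff.trans ?_ Kripke.pre_univ.symm
      exact ⟨fun ⟨q', hq', h', H⟩ => ⟨⟨q', hq'⟩, (hs ⟨q', hq'⟩).1 h', H⟩,
        fun ⟨q', h', H⟩ => ⟨q', q'.2, (hs q').2 h', H⟩⟩

end TemporalLearning

/-! ### Ultimately periodic words as game structures without agents. -/

namespace TemporalLearning

/-! ### LTL as the logic of game structures without agents -/

namespace LTL

variable {P : Type}

/-- An LTL formula as a state formula for game structures without agents. -/
def toATL : LTL P → ATL 0 P
  | prop p => .prop p
  | un .neg φ => .neg φ.toATL
  | un (.tp o) φ => .un ∅ o φ.toATL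
  | tp o φ ψ => .tp ∅ o φ.toATL ψ.toATL
  | lg o φ ψ => .lg o φ.toATL ψ.toATL

/-- The inverse of `toATL`. -/
def ofATL : ATL 0 P → LTL P
  | .prop p => prop p
  | .neg φ => un .neg (ofATL φ)
  | .un _ o φ => un (.tp o) (ofATL φ)
  | .tp _ o φ ψ => tp o (ofATL φ) (ofATL ψ)
  | .lg o φ ψ => lg o (ofATL φ) (ofATL ψ)

theorem ofATL_toATL (φ : LTL P) : ofATL φ.toATL = φ := by
  induction φ with
  | prop p => rfl
  | un o φ ih => cases o <;> simp [toATL, ofATL, ih]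
  | tp o φ ψ ih₁ ih₂ | lg o φ ψ ih₁ ih₂ => simp [toATL, ofATL, ih₁, ih₂]

/-- Without agents the empty coalition is the only one, so the translation is onto and no formulas
are gained. -/
theorem toATL_ofATL (φ : ATL 0 P) : (ofATL φ).toATL = φ := by
  induction φ with
  | prop p => rfl
  | neg φ ih => simp [toATL, ofATL, ih]
  | un A o φ ih => simp [toATL, ofATL, ih, Subsingleton.elim A ∅]
  | tp A o φ ψ ih₁ ih₂ => simp [toATL, ofATL, ih₁, ih₂, Subsingleton.elim A ∅]
  | lg o φ ψ ih₁ ih₂ => simp [toATL, ofATL, ih₁, ih₂]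

theorem toATL_injective : Function.Injective (toATL (P := P)) :=
  Function.LeftInverse.injective ofATL_toATL

theorem inFragment_toATL {Ut : Set UnOp} {Bt : Set BinTp} {Bl : Set BinLg} (φ : LTL P) :
    φ.toATL.InFragment Ut Bt Bl ↔ φ.InFragment Ut Bt Bl := by
  induction φ with
  | prop p => rfl
  | un o φ ih => cases o <;> simp [toATL, InFragment, ATL.InFragment, ih]
  | tp o φ ψ ih₁ ih₂ | lg o φ ψ ih₁ ih₂ => simp [toATL, InFragment, ATL.InFragment, ih₁, ih₂]

theorem isBin_toATL (φ : LTL P) : φ.toATL.isBin = φ.isBin := by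
  cases φ with
  | un o φ => cases o <;> rfl
  | _ => rfl

variable [DecidableEq P]

theorem subF_toATL (φ : LTL P) : φ.toATL.subF = φ.subF.image toATL := by
  induction φ with
  | prop p => rfl
  | un o φ ih => cases o <;> simp [toATL, subF, ATL.subF, ih]
  | tp o φ ψ ih₁ ih₂ | lg o φ ψ ih₁ ih₂ =>
    simp [toATL, subF, ATL.subF, ih₁, ih₂, Finset.image_union]

theorem size_toATL (φ : LTL P) : φ.toATL.size = φ.size := by
  rw [ATL.size, subF_toATL, Finset.card_image_of_injective _ toATL_injective, size]

theorem numBin_toATL (φ : LTL P) : φ.toATL.numBin = φ.numBin := by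
  rw [ATL.numBin, subF_toATL, Finset.filter_image,
    Finset.card_image_of_injective _ toATL_injective, numBin]
  simp only [isBin_toATL]

end LTL

namespace UPWord

variable {P : Type} (x : UPWord P)

theorem length_v_pos : 0 < x.v.length := List.length_pos_of_ne_nil x.v_ne

theorem size_pos : 0 < x.size := Nat.add_pos_right _ x.length_v_pos

/-- The position after `q`, where the end of the period is followed by its start. -/
def next (q : ℕ) : ℕ := if q + 1 < x.size then q + 1 else x.u.length

theorem next_lt (q : ℕ) : x.next q < x.size := by
  have := x.length_v_pos
  unfold next
  split_ifs with h
  · exact h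
  · unfold size
    omega

/-- An ultimately periodic word as a game structure without agents. -/
abbrev toCGS : CGS 0 P where
  numStates := x.size
  init := {⟨0, x.size_pos⟩}
  label q := x.word q
  d _ a := a.elim0
  d_pos _ a := a.elim0
  δ q _ := ⟨x.next q, x.next_lt q⟩

/-- The state at position `i`. -/
def state (i : ℕ) : x.toCGS.Q :=
  ⟨if i < x.u.length then i else x.u.length + (i - x.u.length) % x.v.length, by
    have := Nat.mod_lt (i - x.u.length) x.length_v_pos
    split_ifs <;> simp only [size] <;> omega⟩

theorem coe_state (i : ℕ) : (x.state i : ℕ) =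
    if i < x.u.length then i else x.u.length + (i - x.u.length) % x.v.length := rfl

theorem word_state (i : ℕ) : x.word (x.state i) = x.word i := by
  unfold state word
  dsimp only
  by_cases h : i < x.u.length
  · simp [h]
  · simp [h]

/-- The cases are a step within `u`, the step from `u` to `v`, and a step within the period, which
may wrap around. -/
theorem state_succ (i : ℕ) : (x.state (i + 1) : ℕ) = x.next (x.state i) := by
  have hv := x.length_v_pos
  rw [coe_state, coe_state, next, size]
  rcases lt_trichotomy (i + 1) x.u.length with h | h | h
  · rw [if_pos h, if_pos (by omega : i < x.u.length), if_pos (by omega)]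
  · rw [if_neg (by omega), if_pos (by omega : i < x.u.length), if_pos (by omega)]
    simp [h]
  · rw [if_neg (by omega), if_neg (by omega : ¬ i < x.u.length)]
    obtain ⟨t, rfl⟩ := Nat.exists_eq_add_of_le (show x.u.length ≤ i by omega)
    have e : x.u.length + t + 1 - x.u.length = t + 1 := by omega
    rw [e, Nat.add_sub_cancel_left]
    have ht := Nat.mod_lt t hv
    rw [← Nat.mod_add_mod]
    split_ifs with h'
    · rw [Nat.mod_eq_of_lt (by omega)]
      omega
    · rw [show t % x.v.length + 1 = x.v.length by omega, Nat.mod_self, Nat.add_zero]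

/-- Without agents there is one joint action at each state, so the transitions are deterministic and
the word itself is the only path. -/
theorem mem_out {s : (a : Fin 0) → a ∈ (∅ : Finset (Fin 0)) → x.toCGS.Strategy a} {i : ℕ}
    {ρ : ℕ → x.toCGS.Q} :
    ρ ∈ x.toCGS.out ∅ s (x.state i) ↔ ρ = fun j => x.state (i + j) := by
  constructor
  · rintro ⟨h0, h⟩
    funext j
    induction j with
    | zero => exact h0
    | succ j ih =>
      obtain ⟨β, -, hβ⟩ := h j
      rw [← hβ, ih]
      exact Fin.ext (x.state_succ (i + j)).symm
  · rintro rfl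
    exact ⟨rfl, fun j => ⟨fun a => a.elim0, fun a => a.elim0, Fin.ext (x.state_succ (i + j)).symm⟩⟩

theorem enforces_iff {i : ℕ} {S : Set (ℕ → x.toCGS.Q)} :
    x.toCGS.Enforces ∅ (x.state i) S ↔ (fun j => x.state (i + j)) ∈ S := by
  constructor
  · exact fun ⟨s, hs⟩ => hs _ ((mem_out x).2 rfl)
  · intro h
    refine ⟨fun a => a.elim0, fun ρ hρ => ?_⟩
    rwa [(mem_out x).1 hρ]

theorem satAt_toATL (φ : LTL P) (i : ℕ) :
    φ.toATL.SatAt x.toCGS.label x.toCGS.Enforces (x.state i) ↔ φ.Sat fun j => x.word (i + j) := by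
  induction φ generalizing i with
  | prop p =>
    change p ∈ x.word (x.state i) ↔ _
    rw [word_state]
    rfl
  | un o φ ih =>
    have h : (fun j => φ.toATL.SatAt x.toCGS.label x.toCGS.Enforces (x.state (i + j))) =
        fun j => φ.Sat fun l => x.word (i + (j + l)) :=
      funext fun j => propext ((ih _).trans (by simp only [Nat.add_assoc]))
    cases o with
    | neg => exact not_congr (iff_of_eq (congrFun h 0))
    | tp o => exact (enforces_iff x).trans (iff_of_eq (congrArg o.eval h))
  | tp o φ ψ ih₁ ih₂ =>
    have h₁ : (fun j => φ.toATL.SatAt x.toCGS.label x.toCGS.Enforces (x.state (i + j))) =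
        fun j => φ.Sat fun l => x.word (i + (j + l)) :=
      funext fun j => propext ((ih₁ _).trans (by simp only [Nat.add_assoc]))
    have h₂ : (fun j => ψ.toATL.SatAt x.toCGS.label x.toCGS.Enforces (x.state (i + j))) =
        fun j => ψ.Sat fun l => x.word (i + (j + l)) :=
      funext fun j => propext ((ih₂ _).trans (by simp only [Nat.add_assoc]))
    exact (enforces_iff x).trans (iff_of_eq (congrArg₂ o.eval h₁ h₂))
  | lg o φ ψ ih₁ ih₂ => exact iff_of_eq (congrArg₂ o.eval (propext (ih₁ i)) (propext (ih₂ i)))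

theorem sat_toATL (φ : LTL P) : x.toCGS.Sat φ.toATL ↔ φ.Sat x.word := by
  have h0 : x.state 0 = ⟨0, x.size_pos⟩ := by
    refine Fin.ext ?_
    unfold state
    dsimp only
    split_ifs with h
    · rfl
    · simp [Nat.eq_zero_of_not_pos h]
  unfold CGS.Sat
  simp only [Finset.mem_singleton, forall_eq]
  rw [← h0]
  simpa using x.satAt_toATL φ 0

theorem pre_iff {A : Finset (Fin 0)} {S : x.toCGS.Q → Prop} {q : x.toCGS.Q} :
    x.toCGS.pre A S q ↔ S ⟨x.next q, x.next_lt q⟩ :=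
  CGS.pre_iff.trans ⟨fun ⟨β, h⟩ => h β fun _ _ => rfl, fun h => ⟨fun a => a.elim0, fun _ _ => h⟩⟩

end UPWord

section Words

variable {Δ : Type}

/-- The position of the period of the word at position `s`. -/
noncomputable def posPeriod (w : List (Γ' ⊕ Δ)) (s : ℕ) : ℕ := skipList (skipList skipOne) w s

/-- The length of the list of letters at position `s`. -/
noncomputable def numLetters (w : List (Γ' ⊕ Δ)) (s : ℕ) : ℕ := countAt (skipList skipOne) w s

/-- The number of positions of the word at position `s`. -/
noncomputable def wordSize (w : List (Γ' ⊕ Δ)) (s : ℕ) : ℕ :=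
  numLetters w s + numLetters w (posPeriod w s)

/-- The `q`-th letter of the list of letters at position `s` contains `p`. -/
def LetterAt (w : List (Γ' ⊕ Δ)) (s q p : ℕ) : Prop :=
  BitAt w (nthAt (skipList skipOne) w s q) p

theorem PTSkip.period : PTSkip (posPeriod (Δ := Δ)) := PTSkip.one.list.list

theorem PTSkip.letters : PTSkip (numLetters (Δ := Δ)) := PT.countAt PTSkip.one.list PT.var₀

theorem PTSkip.wordSize : PTSkip (TemporalLearning.wordSize (Δ := Δ)) :=
  PT.add PTSkip.letters (PTSkip.period.comp PTSkip.letters)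

theorem PTP.letterAt {α : Type} [Ctx (Γ' ⊕ Δ) α] {s q p : α → ℕ} (hs : PT s) (hq : PT q)
    (hp : PT p) : PTP fun a => LetterAt (Ctx.word a) (s a) (q a) (p a) :=
  PTP.bitAt (PT.nthAt PTSkip.one.list hs hq) hp

variable {m : ℕ} {w : List (Γ' ⊕ Δ)} {s : ℕ}

theorem numLetters_eq {l : List (Finset (Fin m))} (h : At w s (encList encSubset l)) :
    numLetters w s = l.length :=
  countAt_eq (fun _ _ => skips_subset _) h

theorem letterAt_iff {l : List (Finset (Fin m))} (h : At w s (encList encSubset l)) {q : ℕ}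
    (hq : q < l.length) (p : Fin m) : LetterAt w s q p ↔ p ∈ l[q] :=
  bitAt_iff (nthAt_at (fun _ _ => skips_subset _) h hq) p

theorem at_word {x : UPWord (Fin m)} (h : At w s x.encode) :
    At w s (encList encSubset x.u) ∧ At w (posPeriod w s) (encList encSubset x.v) :=
  (skips_list fun _ _ => skips_subset _).split h

theorem wordSize_eq {x : UPWord (Fin m)} (h : At w s x.encode) : wordSize w s = x.size := by
  rw [wordSize, numLetters_eq (at_word h).1, numLetters_eq (at_word h).2, UPWord.size]

end Words

/-- Ultimately periodic words. -/
noncomputable def wordCoding : Coding 0 (fun m => UPWord (Fin m)) UPWord.encode where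
  toCGS x := x.toCGS
  skip w s := posPeriod w (posPeriod w s)
  nst := wordSize
  init _ _ q := q = 0
  -- States are positions below `|u| + |v|`, so the letter in the period is found by subtraction and
  -- no remainder is computed.
  lab w s q p := (q < numLetters w s ∧ LetterAt w s q p) ∨
    (¬ q < numLetters w s ∧ LetterAt w (posPeriod w s) (q - numLetters w s) p)
  pre _ w s q Z := (q + 1 < wordSize w s ∧ Z (q + 1)) ∨
    (¬ q + 1 < wordSize w s ∧ Z (numLetters w s))
  pt_skip := PTSkip.period.comp PTSkip.period
  pt_nst := PTSkip.wordSize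
  pt_init _ hq := PTP.eq hq (PT.const 0)
  pt_lab hs hq hp :=
    ((PTP.lt hq (PTSkip.letters.pt hs)).and (PTP.letterAt hs hq hp)).or
      ((PTP.lt hq (PTSkip.letters.pt hs)).not.and
        (PTP.letterAt (PTSkip.period.pt hs) (PT.sub hq (PTSkip.letters.pt hs)) hp))
  pt_pre _ _ _ _ _ _ hs hq hZ :=
    ((PTP.lt hq.succ (PTSkip.wordSize.pt hs)).and (PT.bind hZ hq.succ)).or
      ((PTP.lt hq.succ (PTSkip.wordSize.pt hs)).not.and (PT.bind hZ (PTSkip.letters.pt hs)))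
  skips _ := (skips_list fun _ _ => skips_subset _).append (skips_list fun _ _ => skips_subset _)
  nst_eq _ _ _ h := wordSize_eq h
  numStates_le x := by
    have h1 := length_le_flatMap (l := x.u) (e := encSubset) fun _ _ => encList_ne_nil
    have h2 := length_le_flatMap (l := x.v) (e := encSubset) fun _ _ => encList_ne_nil
    simp only [UPWord.encode, List.length_append, length_encList, UPWord.size]
    omega
  init_iff x w s h q := by
    rw [Finset.mem_singleton, Fin.ext_iff]
  lab_iff x w s h q p := by
    obtain ⟨hu, hv⟩ := at_word h
    have hq : (q : ℕ) < x.u.length + x.v.length := q.2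
    change _ ↔ p ∈ x.word q
    rw [numLetters_eq hu, UPWord.word]
    by_cases hlt : (q : ℕ) < x.u.length
    · simp [hlt, letterAt_iff hu hlt]
    · have h' : (q : ℕ) - x.u.length < x.v.length := by omega
      simp [hlt, letterAt_iff hv h', Nat.mod_eq_of_lt h']
  pre_iff x w s h A q Z := by
    refine Iff.trans ?_ x.pre_iff.symm
    rw [wordSize_eq h, numLetters_eq (at_word h).1]
    unfold UPWord.next
    by_cases hlt : (q : ℕ) + 1 < x.size <;> simp [hlt]

end TemporalLearning

/-! ### Polynomial length of the encodings, and the conclusion. -/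

namespace TemporalLearning

/-! ### The length of encodings -/

theorem length_encList_eq_sum {α : Type} (e : α → List Γ') (l : List α) :
    (encList e l).length = (l.map fun x => (e x).length).sum + 2 := by
  rw [length_encList, List.length_flatMap]

theorem length_encList_finRange {n : ℕ} (e : Fin n → List Γ') :
    (encList e (List.finRange n)).length = ∑ i, (e i).length + 2 := by
  rw [length_encList_eq_sum, Fin.sum_univ_def]

theorem length_encSubset {m : ℕ} (s : Finset (Fin m)) : (encSubset s).length = m + 2 := by
  simp [encSubset, length_encList_finRange]

theorem length_encList_encSubset {m : ℕ} (l : List (Finset (Fin m))) :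
    (encList encSubset l).length = l.length * (m + 2) + 2 := by
  simp [length_encList_eq_sum, length_encSubset]

theorem UPWord.length_encode_le {m : ℕ} (x : UPWord (Fin m)) :
    x.encode.length ≤ (x.size + m + 4) ^ 2 := by
  simp only [encode, List.length_append, length_encList_encSubset, size]
  nlinarith

theorem Kripke.length_encode_le {m : ℕ} (K : Kripke (Fin m)) :
    K.encode.length ≤ (K.size + m + 7) ^ 2 := by
  -- Every state has a successor, so the number of states is at most the number of transitions; thus
  -- the quadratic bit matrix of successors is short enough.
  have hN : K.numStates + m ≤ K.size := by
    have : ∑ _q : K.Q, 1 ≤ ∑ q, (K.succ q).card :=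
      Finset.sum_le_sum fun q _ => (K.succ_nonempty q).card_pos
    simp only [Finset.sum_const, Finset.card_univ, Fintype.card_fin, smul_eq_mul, mul_one] at this
    simpa [size] using this
  simp only [encode, List.length_append, length_encList_finRange, length_encSubset, length_encNat,
    Finset.sum_const, Finset.card_univ, Fintype.card_fin, smul_eq_mul]
  nlinarith

namespace CGS

variable {k m : ℕ} (C : CGS k (Fin m))

theorem numStates_le_sum : C.numStates ≤ ∑ q, ∏ a, C.d q a := by
  have : ∑ _q : C.Q, 1 ≤ ∑ q, ∏ a, C.d q a :=
    Finset.sum_le_sum fun q _ => Finset.prod_pos fun a _ => C.d_pos q a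
  simpa using this

theorem d_le_sum (q : C.Q) (a : Fin k) : C.d q a ≤ ∑ q, ∏ a, C.d q a :=
  (Nat.le_of_dvd (Finset.prod_pos fun a _ => C.d_pos q a)
    (Finset.dvd_prod_of_mem _ (Finset.mem_univ a))).trans
    (Finset.single_le_sum (f := fun q => ∏ a, C.d q a) (fun _ _ => Nat.zero_le _)
      (Finset.mem_univ q))

theorem length_encodeRow_le {s : ℕ} (hs : ∑ q, ∏ a, C.d q a ≤ s) (q : C.Q)
    (α : (a : Fin k) → Fin (C.d q a)) : (C.encodeRow q α).length ≤ 2 * s + 4 + k * (s + 1) := by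
  have h1 : ∑ a, ((α a : ℕ) + 1) ≤ ∑ _a : Fin k, (s + 1) := Finset.sum_le_sum fun a _ => by
    have := (α a).2
    have := C.d_le_sum q a
    omega
  simp only [Finset.sum_const, Finset.card_univ, Fintype.card_fin, smul_eq_mul] at h1
  have hN := C.numStates_le_sum
  have h2 := q.2
  have h3 := (C.δ q α).2
  simp only [encodeRow, List.length_append, length_encNat, length_encList_finRange]
  omega

theorem length_encode_le : C.encode.length ≤ (C.size + m + (k + 10)) ^ 3 := by
  obtain ⟨s, hs⟩ : ∃ s, s = ∑ q, ∏ a, C.d q a := ⟨_, rfl⟩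
  have hN := hs ▸ C.numStates_le_sum
  have h1 : ∑ q, (∑ a, (C.d q a + 1) + 2) ≤ s * (k * (s + 1) + 2) := by
    refine le_trans (Finset.sum_le_sum (g := fun _ => k * (s + 1) + 2) fun q _ => ?_) ?_
    · refine Nat.add_le_add_right (le_trans (Finset.sum_le_sum (g := fun _ => s + 1) fun a _ => ?_)
        ?_) 2
      · exact Nat.add_le_add_right (hs ▸ C.d_le_sum q a) 1
      · simp
    · rw [Finset.sum_const, Finset.card_univ, Fintype.card_fin, smul_eq_mul]
      exact Nat.mul_le_mul_right _ hN
  have h2 : ∑ q, (∑ j : Fin (∏ a, C.d q a), (C.encodeRow q (finPiFinEquiv.symm j)).length + 2) ≤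
      s * (2 * s + 4 + k * (s + 1)) + 2 * s := by
    rw [Finset.sum_add_distrib]
    refine Nat.add_le_add ?_ (by simpa [Nat.mul_comm] using Nat.mul_le_mul_right 2 hN)
    nth_rw 1 [hs]
    rw [Finset.sum_mul]
    refine Finset.sum_le_sum fun q _ => ?_
    refine le_trans (Finset.sum_le_sum fun j _ => C.length_encodeRow_le hs.ge q _) ?_
    simp
  have h3 : C.numStates * (m + 2) ≤ s * (m + 2) := Nat.mul_le_mul_right _ hN
  have hle : C.encode.length ≤ s + 1 + (s + 2) + (s * (m + 2) + 2) + (s * (k * (s + 1) + 2) + 2) +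
      (s * (2 * s + 4 + k * (s + 1)) + 2 * s + 2) := by
    simp only [encode, List.length_append, length_encList_finRange, length_encSubset,
      length_encNat, Finset.sum_const, Finset.card_univ, Fintype.card_fin, smul_eq_mul]
    omega
  have hsz : C.size = s + m := by rw [size, ← hs, Fintype.card_fin]
  rw [hsz]
  refine hle.trans ?_
  -- After expansion the difference has only non-negative coefficients. The number of agents is
  -- fixed, so it may appear in the constant `k + 10`.
  have : 0 ≤ ((s + m + m + (k + 10)) ^ 3 - (s + 1 + (s + 2) + (s * (m + 2) + 2) +
      (s * (k * (s + 1) + 2) + 2) + (s * (2 * s + 4 + k * (s + 1)) + 2 * s + 2)) : ℤ) := by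
    ring_nf
    positivity
  zify
  linarith

end CGS

/-- Models of size at least one are no more numerous than their total size. A structure without
states still has positive size, because there is at least one proposition. -/
theorem sum_map_le {α : Type} {l : List α} {f g : α → ℕ} {b c : ℕ} (hf : ∀ x ∈ l, f x ≤ b)
    (hg : ∀ x ∈ l, 1 ≤ g x) (hc : (l.map g).sum ≤ c) : (l.map f).sum ≤ c * b := by
  refine le_trans (List.sum_le_card_nsmul _ b fun y hy => ?_) ?_
  · obtain ⟨x, hx, rfl⟩ := List.mem_map.1 hy
    exact hf x hx
  · have : (l.map g).length ≤ (l.map g).sum := List.length_le_sum_of_one_le _ fun y hy => by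
      obtain ⟨x, hx, rfl⟩ := List.mem_map.1 hy
      exact hg x hx
    rw [List.length_map] at this
    rw [List.length_map, smul_eq_mul]
    exact Nat.mul_le_mul_right b (this.trans hc)

theorem Sample.length_encode_le {Model : ℕ → Type} {enc : {m : ℕ} → Model m → List Γ'}
    {modelSize : {m : ℕ} → Model m → ℕ} {c e : ℕ}
    (hsz : ∀ {m : ℕ} (X : Model m), 0 < m → 1 ≤ modelSize X)
    (h : ∀ {m : ℕ} (X : Model m), (enc X).length ≤ (modelSize X + m + c) ^ e) :
    ∃ q : Polynomial ℕ, ∀ x : Sample Model, (x.encode enc).length ≤ q.eval (x.size modelSize) := by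
  refine ⟨Polynomial.X + 6 + 2 * (Polynomial.X * (Polynomial.X + Polynomial.C c) ^ e),
    fun x => ?_⟩
  obtain ⟨s, hs⟩ : ∃ s, s = x.size modelSize := ⟨_, rfl⟩
  have hs' := hs
  rw [Sample.size] at hs'
  have hsum : ∀ l : List (Model x.numProp), (l.map modelSize).sum + x.numProp ≤ s →
      (l.flatMap enc).length ≤ s * (s + c) ^ e := fun l hl => by
    rw [List.length_flatMap]
    refine sum_map_le (g := modelSize) (fun X hX => (h X).trans ?_)
      (fun X _ => hsz X x.numProp_pos) (by omega)
    refine Nat.pow_le_pow_left ?_ e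
    have := List.le_sum_of_mem (List.mem_map_of_mem (f := modelSize) hX)
    omega
  have h1 := hsum x.pos (by omega)
  have h2 := hsum x.neg (by omega)
  rw [Coding.length_encode, ← hs]
  simp only [Polynomial.eval_add, Polynomial.eval_mul, Polynomial.eval_pow, Polynomial.eval_X,
    Polynomial.eval_C, Polynomial.eval_ofNat]
  omega

/-! ### Membership in NP -/

variable (Ut : Set UnOp) (Bt : Set BinTp) (Bl : Set BinLg) (n : ℕ∞)

theorem ltlLearn_inNP : (LTLLearn Ut Bt Bl n).InNP := by
  refine wordCoding.inNP _ Ut Bt Bl n (fun x => x) (fun x => rfl) (fun x => ?_)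
    (Sample.length_encode_le (Model := fun m => UPWord (Fin m)) (modelSize := UPWord.size)
      (fun X _ => X.size_pos) UPWord.length_encode_le)
  constructor
  · rintro ⟨φ, h1, h2, h3, h4, h5⟩
    exact ⟨φ.toATL, φ.inFragment_toATL.2 h1, φ.size_toATL.symm ▸ h2, φ.numBin_toATL.symm ▸ h3,
      fun X hX => (X.sat_toATL φ).2 (h4 X hX), fun X hX h => h5 X hX ((X.sat_toATL φ).1 h)⟩
  · rintro ⟨ψ, h⟩
    obtain ⟨φ, rfl⟩ : ∃ φ : LTL (Fin x.numProp), φ.toATL = ψ := ⟨_, LTL.toATL_ofATL ψ⟩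
    obtain ⟨h1, h2, h3, h4, h5⟩ := h
    exact ⟨φ, φ.inFragment_toATL.1 h1, φ.size_toATL ▸ h2, φ.numBin_toATL ▸ h3,
      fun X hX => (X.sat_toATL φ).1 (h4 X hX), fun X hX h => h5 X hX ((X.sat_toATL φ).2 h)⟩

theorem ctlLearn_inNP : (CTLLearn Ut Bt Bl n).InNP := by
  refine kripkeCoding.inNP _ Ut Bt Bl n (fun x => x) (fun x => rfl) (fun x => ?_)
    (Sample.length_encode_le (Model := fun m => Kripke (Fin m)) (modelSize := fun K => K.size)
      (fun K hm => ?_) Kripke.length_encode_le)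
  · change (∃ φ : CTL (Fin x.numProp), _) ↔ ∃ φ : ATL 1 (Fin x.numProp), _
    refine exists_congr fun φ => and_congr Iff.rfl (and_congr Iff.rfl (and_congr Iff.rfl
      (and_congr (forall₂_congr fun K _ => (Kripke.sat_toCGS φ).symm)
        (forall₂_congr fun K _ => not_congr (Kripke.sat_toCGS φ).symm))))
  · rw [Kripke.size, Fintype.card_fin]
    omega

theorem atlLearn_inNP (k : ℕ) : (ATLLearn k Ut Bt Bl n).InNP := by
  refine (cgsCoding k).inNP _ Ut Bt Bl n (fun x => x) (fun x => rfl) (fun x => Iff.rfl)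
    (Sample.length_encode_le (Model := fun m => CGS k (Fin m)) (modelSize := fun C => C.size)
      (fun C hm => ?_) CGS.length_encode_le)
  rw [CGS.size, Fintype.card_fin]
  omega

end TemporalLearning

theorem mainTheorem3 (Ut : Set TemporalLearning.UnOp) (Bt : Set TemporalLearning.BinTp)
    (Bl : Set TemporalLearning.BinLg) (n : ℕ∞) :
    (TemporalLearning.LTLLearn Ut Bt Bl n).InNP ∧
    (TemporalLearning.CTLLearn Ut Bt Bl n).InNP ∧
    ∀ k : ℕ, 1 ≤ k → (TemporalLearning.ATLLearn k Ut Bt Bl n).InNP :=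
  ⟨TemporalLearning.ltlLearn_inNP Ut Bt Bl n, TemporalLearning.ctlLearn_inNP Ut Bt Bl n,
    fun k _ => TemporalLearning.atlLearn_inNP Ut Bt Bl n k⟩
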